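/- Let $\mathbb{H}^2=\{p\in\mathbb{R}^3: p_1^2+p_2^2-p_3^2=-1,\ p_3>0\}$ carry the metric of curvature $-1$ induced from $\langle p,q\rangle=p_1q_1+p_2q_2-p_3q_3$, and let $\mathbb{H}^2\times\mathbb{R}$ carry the product metric, with $t$ the coordinate of $\mathbb{R}$. Let $F:M\to\mathbb{H}^2\times\mathbb{R}$ be a smooth isometrically immersed surface with smooth unit normal field $\xi$; write $\partial_t=T+\cos\theta\,\xi$ with $T$ tangent to $M$ and $\theta:M\to[0,\pi]$, and assume that $\theta$ never takes the values $0$ and $\frac{\pi}{2}$. For $c_1,c_2\in\mathbb{R}$ put $$a(x)=c_1\cosh x+c_2\sinh x,\qquad b(x)=a'(x),\qquad \chi(x)=\int_0^x\frac{d\tau}{\sqrt{a(\tau)^2+1}}.$$ Then $M$ is minimal and has $T$ as a principal direction (at every point $T$ is a nonzero eigenvector of the shape operator) if and only if, around every point of $M$, there are smooth local coordinates $(x,y)$ on $M$, an isometry $\Phi$ of $\mathbb{H}^2\times\mathbb{R}$ and constants $c_1,c_2\in\mathbb{R}$ such that $\Phi\circ F$ is given in these coordinates by (a) $\displaystyle\left(\frac{b(x)}{\sqrt{1+c_1^2-c_2^2}},\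 \frac{\sqrt{a(x)^2+1}}{\sqrt{1+c_1^2-c_2^2}}\sinh y,\ \frac{\sqrt{a(x)^2+1}}{\sqrt{1+c_1^2-c_2^2}}\cosh y,\ \chi(x)\right)$ with $1+c_1^2-c_2^2>0$, or (b) $\displaystyle\left(\frac{\sqrt{a(x)^2+1}}{\sqrt{c_2^2-c_1^2-1}}\cos y,\ \frac{\sqrt{a(x)^2+1}}{\sqrt{c_2^2-c_1^2-1}}\sin y,\ \frac{b(x)}{\sqrt{c_2^2-c_1^2-1}},\ \chi(x)\right)$ with $1+c_1^2-c_2^2<0$, or (c) $\displaystyle\left(b(x)\,y,\ \frac{b(x)}{2}(1-y^2)-\frac{1}{2b(x)},\ \frac{b(x)}{2}(1+y^2)+\frac{1}{2b(x)},\ \chi(x)\right)$ with $1+c_1^2-c_2^2=0$. Moreover, in every such local representation $a(x)\neq0$ and $\tan\theta=\pm\frac{1}{a(x)}$, the sign depending on the choice of $\xi$; and if $M$ is minimal with $T$ as a principal direction, the local representations can be chosen so that $\tan\theta=\frac{1}{a(x)}$, that is, $\theta=\arctan\frac{1}{a(x)}$ modulo $\pi$. -/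

import Mathlib

open scoped Manifold ContDiff

namespace HypCyl

noncomputable section

/-- The vector space `ℝ³₁ × ℝ`, with coordinates indexed by `0, 1, 2, 3`; index `3` is the
`t`-coordinate. -/
abbrev E4 : Type := Fin 4 → ℝ

/-- The model space of a surface. -/
abbrev E2 : Type := EuclideanSpace ℝ (Fin 2)

/-- The Lorentzian form of `ℝ³₁`, of signature `(+, +, -)`, on the first three coordinates. -/
def lorentz (v w : E4) : ℝ := v 0 * w 0 + v 1 * w 1 - v 2 * w 2

/-- The form of `ℝ³₁ × ℝ`. On vectors tangent to `ℍ² × ℝ` it is the product Riemannian metric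
`g_H + dt²`. -/
def metric (v w : E4) : ℝ := lorentz v w + v 3 * w 3

/-- `ℍ² × ℝ`, where `ℍ²` is the hyperboloid model (upper sheet) of curvature `-1`. -/
def ambient : Set E4 := {p | lorentz p p = -1 ∧ 0 < p 2}

/-- `v` is tangent to `ℍ² × ℝ` at the point `p`. -/
def IsAmbientTangent (p v : E4) : Prop := lorentz p v = 0

/-- The unit vector field tangent to the factor `ℝ`. -/
def dt : E4 := ![0, 0, 0, 1]

/-- The component of `p` in `ℝ³₁`. At a point of `ℍ² × ℝ` it is a normal vector of `ℍ² × ℝ` in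
`ℝ³₁ × ℝ`, of square `-1`. -/
def hypPart (p : E4) : E4 := ![p 0, p 1, p 2, 0]

/-- The orthogonal projection of `ℝ³₁ × ℝ` onto the tangent space of `ℍ² × ℝ` at `p`. -/
def tangentProj (p v : E4) : E4 := v + metric v (hypPart p) • hypPart p

/-- `Φ` restricts to an isometry of the Riemannian manifold `ℍ² × ℝ`: a smooth bijection
of `ℍ² × ℝ` whose differential preserves the metric. (Only the values of `Φ` on `ℍ² × ℝ` matter,
`Φ` being a smooth extension of them.) -/
structure IsAmbientIsometry (Φ : E4 → E4) : Prop where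
  bijOn : Set.BijOn Φ ambient ambient
  smooth : ∀ p ∈ ambient, ContDiffAt ℝ ∞ Φ p
  preserves : ∀ p ∈ ambient, ∀ v w : E4, IsAmbientTangent p v → IsAmbientTangent p w →
    metric (fderiv ℝ Φ p v) (fderiv ℝ Φ p w) = metric v w

section Surface

variable {M : Type*} [TopologicalSpace M] [ChartedSpace E2 M]

/-- The differential at `p` of a map from the surface to the vector space `ℝ³₁ × ℝ`. -/
def diff (V : M → E4) (p : M) : TangentSpace 𝓘(ℝ, E2) p →L[ℝ] E4 :=
  mfderiv 𝓘(ℝ, E2) 𝓘(ℝ, E4) V p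

/-- `F` is an immersion of the surface in `ℍ² × ℝ`. The surface carries the induced metric. -/
structure IsImmersedSurface (F : M → E4) : Prop where
  smooth : ContMDiff 𝓘(ℝ, E2) 𝓘(ℝ, E4) ∞ F
  mem : ∀ p, F p ∈ ambient
  immersion : ∀ p, Function.Injective (diff F p)

/-- `ξ` is a smooth unit normal field of the surface `F` in `ℍ² × ℝ`. -/
structure IsUnitNormal (F ξ : M → E4) : Prop where
  smooth : ContMDiff 𝓘(ℝ, E2) 𝓘(ℝ, E4) ∞ ξ
  tangent : ∀ p, IsAmbientTangent (F p) (ξ p)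
  unit : ∀ p, metric (ξ p) (ξ p) = 1
  normal : ∀ p, ∀ v : TangentSpace 𝓘(ℝ, E2) p, metric (ξ p) (diff F p v) = 0

/-- The angle function, with values in `[0, π]`: the angle between `∂_t` and `ξ`. -/
def angle (ξ : M → E4) (p : M) : ℝ := Real.arccos (metric dt (ξ p))

/-- The covariant derivative, with respect to the Levi-Civita connection of `ℍ² × ℝ`, of a vector
field `V` along `F`: the flat derivative projected on the tangent space of `ℍ² × ℝ`. -/
def covDeriv (F V : M → E4) (p : M) (v : TangentSpace 𝓘(ℝ, E2) p) : E4 :=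
  tangentProj (F p) (diff V p v)

/-- `A` is the shape operator at `p` of the surface `F` with unit normal `ξ`, given by the
Weingarten formula `∇̃_v ξ = -A v`. -/
def IsShapeOperator (F ξ : M → E4) (p : M)
    (A : Module.End ℝ (TangentSpace 𝓘(ℝ, E2) p)) : Prop :=
  ∀ v, covDeriv F ξ p v = -diff F p (A v)

/-- `t` is the vector `T` at `p`, the projection of `∂_t` on the tangent space of the surface:
`∂_t = T + cos θ ξ`. -/
def IsTangentPart (F ξ : M → E4) (p : M) (t : TangentSpace 𝓘(ℝ, E2) p) : Prop :=
  dt = diff F p t + Real.cos (angle ξ p) • ξ p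

/-- The surface is minimal: the trace of its shape operator vanishes. -/
def IsMinimal (F ξ : M → E4) : Prop :=
  ∀ p, ∃ A, IsShapeOperator F ξ p A ∧ LinearMap.trace ℝ (TangentSpace 𝓘(ℝ, E2) p) A = 0

/-- `T` is a principal direction at every point: a (nonzero) eigenvector of the shape operator. -/
def IsPrincipalT (F ξ : M → E4) : Prop :=
  ∀ p, ∃ A, IsShapeOperator F ξ p A ∧
    ∃ t, IsTangentPart F ξ p t ∧ ∃ κ : ℝ, Module.End.HasEigenvector A κ t

end Surface

/-- `a(x) = c₁ cosh x + c₂ sinh x`. -/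
def a (c₁ c₂ x : ℝ) : ℝ := c₁ * Real.cosh x + c₂ * Real.sinh x

/-- `b = a'`. -/
def b (c₁ c₂ x : ℝ) : ℝ := deriv (a c₁ c₂) x

/-- `χ(x) = ∫₀ˣ dτ / √(a(τ)² + 1)`. -/
def chi (c₁ c₂ x : ℝ) : ℝ := ∫ τ in (0 : ℝ)..x, 1 / Real.sqrt (a c₁ c₂ τ ^ 2 + 1)

/-- The parametrization for `1 + c₁² - c₂² > 0`. -/
def modelPos (c₁ c₂ x y : ℝ) : E4 :=
  ![b c₁ c₂ x / Real.sqrt (1 + c₁ ^ 2 - c₂ ^ 2),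
    Real.sqrt (a c₁ c₂ x ^ 2 + 1) / Real.sqrt (1 + c₁ ^ 2 - c₂ ^ 2) * Real.sinh y,
    Real.sqrt (a c₁ c₂ x ^ 2 + 1) / Real.sqrt (1 + c₁ ^ 2 - c₂ ^ 2) * Real.cosh y,
    chi c₁ c₂ x]

/-- The parametrization for `1 + c₁² - c₂² < 0`. -/
def modelNeg (c₁ c₂ x y : ℝ) : E4 :=
  ![Real.sqrt (a c₁ c₂ x ^ 2 + 1) / Real.sqrt (c₂ ^ 2 - c₁ ^ 2 - 1) * Real.cos y,
    Real.sqrt (a c₁ c₂ x ^ 2 + 1) / Real.sqrt (c₂ ^ 2 - c₁ ^ 2 - 1) * Real.sin y,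
    b c₁ c₂ x / Real.sqrt (c₂ ^ 2 - c₁ ^ 2 - 1),
    chi c₁ c₂ x]

/-- The parametrization for `1 + c₁² - c₂² = 0`. -/
def modelZero (c₁ c₂ x y : ℝ) : E4 :=
  ![b c₁ c₂ x * y,
    b c₁ c₂ x / 2 * (1 - y ^ 2) - 1 / (2 * b c₁ c₂ x),
    b c₁ c₂ x / 2 * (1 + y ^ 2) + 1 / (2 * b c₁ c₂ x),
    chi c₁ c₂ x]

/-- In the local coordinates `(x, y) = e` of the surface, and up to the isometry `Φ` of `ℍ² × ℝ`,
the immersion `F` is given by the one of the three parametrizations that the sign of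
`1 + c₁² - c₂²` selects. (As `Φ ∘ F` takes values in `ℍ² × ℝ`, in the last two cases `b` is
necessarily positive.) -/
structure IsLocallyModel {M : Type*} [TopologicalSpace M] [ChartedSpace E2 M] (F : M → E4)
    (Φ : E4 → E4) (e : OpenPartialHomeomorph M E2) (c₁ c₂ : ℝ) : Prop where
  isometry : IsAmbientIsometry Φ
  chart : e ∈ IsManifold.maximalAtlas 𝓘(ℝ, E2) ∞ M
  param :
    (0 < 1 + c₁ ^ 2 - c₂ ^ 2 ∧ ∀ q ∈ e.source, Φ (F q) = modelPos c₁ c₂ (e q 0) (e q 1)) ∨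
    (1 + c₁ ^ 2 - c₂ ^ 2 < 0 ∧ ∀ q ∈ e.source, Φ (F q) = modelNeg c₁ c₂ (e q 0) (e q 1)) ∨
    (1 + c₁ ^ 2 - c₂ ^ 2 = 0 ∧ ∀ q ∈ e.source, Φ (F q) = modelZero c₁ c₂ (e q 0) (e q 1))

end

end HypCyl

/-! Write ν = cos θ for the last component of ξ, and ⟨·,·⟩ for the Lorentzian form on horizontal
parts. The theorem rests on one vector W of ℝ³₁: the three families are the surfaces along which ⟨F,
W⟩ and t depend on a single function x through b and ±χ + const, and the sign of ⟨W, W⟩ = 1 + c₁² -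
c₂² selects the family.

Pointwise, minimality together with principality of T says that the shape operator has eigenvalue κ
on T and -κ on its orthogonal complement. This is one formula for dξ, `IsMinimalPrincipal`;
`isMinimal_and_isPrincipalT_iff` is the translation.

From the formula to the models (`IsPatch.exists_axis`): put W = (κ F - ξ)/(1 - ν²), horizontal parts
understood. The formula for dξ makes dW a multiple l F of F for some one-form l. Since d(dW) = 0 and
the horizontal part of dF has rank two when ν ≠ 0, l vanishes (`IsPatch.coefficient_eq_zero`), so W
is constant; this replaces the Codazzi equation. With A = ν/√(1 - ν²) = cot θ and B = ⟨F, W⟩ one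
gets dA = B√(A² + 1) dt, dB = A√(A² + 1) dt and ⟨W, W⟩ = 1 + A² - B². The coordinate x with dx =
√(A² + 1) dt turns this into A = a(x), B = b(x), t = χ(x) + const (`exists_coordinate`). A Lorentz
frame adapted to W gives the isometry and the coordinate y (`IsPatch.exists_isModelOn`), and the
inverse function theorem makes (x, y) a chart.

From the models to the formula: the relations ⟨F, W⟩ = b(x), ±t + c = χ(x) alone determine the
normal up to sign, and differentiating it yields the formula and ν = ±a/√(a² + 1)
(`IsPatch.of_model`). An arbitrary isometry Φ must first be removed. It acts on ℝ by t ↦ ±t + c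
(`IsAmbientIsometry.exists_height`) and on ℍ² by a Lorentz map (`IsAmbientIsometry.exists_adjoint`),
so the relations hold for F itself with another W. That Φ respects the product structure comes from
the invariance of curvature (`IsAmbientIsometry.gauss`). -/

namespace HypCyl

/-! ### Algebra of the Lorentzian form and of the product form -/

section Algebra

theorem lorentz_comm (v w : E4) : lorentz v w = lorentz w v := by
  simp only [lorentz]; ring

theorem metric_comm (v w : E4) : metric v w = metric w v := by
  simp only [metric, lorentz]; ring

theorem lorentz_add_left (u v w : E4) : lorentz (u + v) w = lorentz u w + lorentz v w := by
  simp only [lorentz, Pi.add_apply]; ring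

theorem lorentz_smul_left (r : ℝ) (v w : E4) : lorentz (r • v) w = r * lorentz v w := by
  simp only [lorentz, Pi.smul_apply, smul_eq_mul]; ring

theorem lorentz_add_right (u v w : E4) : lorentz u (v + w) = lorentz u v + lorentz u w := by
  simp only [lorentz, Pi.add_apply]; ring

theorem lorentz_smul_right (r : ℝ) (v w : E4) : lorentz v (r • w) = r * lorentz v w := by
  simp only [lorentz, Pi.smul_apply, smul_eq_mul]; ring

theorem metric_add_left (u v w : E4) : metric (u + v) w = metric u w + metric v w := by
  simp only [metric, lorentz, Pi.add_apply]; ring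

theorem metric_smul_left (r : ℝ) (v w : E4) : metric (r • v) w = r * metric v w := by
  simp only [metric, lorentz, Pi.smul_apply, smul_eq_mul]; ring

theorem metric_add_right (u v w : E4) : metric u (v + w) = metric u v + metric u w := by
  simp only [metric, lorentz, Pi.add_apply]; ring

theorem metric_smul_right (r : ℝ) (v w : E4) : metric v (r • w) = r * metric v w := by
  simp only [metric, lorentz, Pi.smul_apply, smul_eq_mul]; ring

theorem metric_sub_left (u v w : E4) : metric (u - v) w = metric u w - metric v w := by
  simp only [metric, lorentz, Pi.sub_apply]; ring

theorem metric_sub_right (u v w : E4) : metric u (v - w) = metric u v - metric u w := by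
  simp only [metric, lorentz, Pi.sub_apply]; ring

theorem metric_neg_left (v w : E4) : metric (-v) w = -metric v w := by
  simp only [metric, lorentz, Pi.neg_apply]; ring

@[simp] theorem hypPart_zero (p : E4) : hypPart p 0 = p 0 := rfl
@[simp] theorem hypPart_one (p : E4) : hypPart p 1 = p 1 := rfl
@[simp] theorem hypPart_two (p : E4) : hypPart p 2 = p 2 := rfl
@[simp] theorem hypPart_three (p : E4) : hypPart p 3 = 0 := rfl
@[simp] theorem dt_zero : dt 0 = 0 := rfl
@[simp] theorem dt_one : dt 1 = 0 := rfl
@[simp] theorem dt_two : dt 2 = 0 := rfl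
@[simp] theorem dt_three : dt 3 = 1 := rfl

theorem lorentz_hypPart_left (v w : E4) : lorentz (hypPart v) w = lorentz v w := rfl

theorem lorentz_hypPart_right (v w : E4) : lorentz v (hypPart w) = lorentz v w := rfl

theorem metric_hypPart_left (v w : E4) : metric (hypPart v) w = lorentz v w := by
  simp [metric, lorentz]

theorem metric_hypPart_right (v w : E4) : metric v (hypPart w) = lorentz v w := by
  simp [metric, lorentz]

theorem metric_dt_left (v : E4) : metric dt v = v 3 := by simp [metric, lorentz]

theorem metric_dt_right (v : E4) : metric v dt = v 3 := by simp [metric, lorentz]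

theorem hypPart_add_dt (v : E4) : hypPart v + v 3 • dt = v := by
  ext i; fin_cases i <;> simp

theorem ext_E4 {v w : E4} (h0 : v 0 = w 0) (h1 : v 1 = w 1) (h2 : v 2 = w 2) (h3 : v 3 = w 3) :
    v = w := by
  ext i; fin_cases i <;> assumption

theorem metric_nondegenerate {v : E4} (h : ∀ w, metric v w = 0) : v = 0 := by
  have h0 := h ![1, 0, 0, 0]
  have h1 := h ![0, 1, 0, 0]
  have h2 := h ![0, 0, 1, 0]
  have h3 := h ![0, 0, 0, 1]
  simp [metric, lorentz] at h0 h1 h2 h3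
  exact ext_E4 h0 h1 h2 h3

/-- On vectors orthogonal to a timelike vector the Lorentzian form is positive definite. -/
theorem lorentz_self_pos {p v : E4} (hp : lorentz p p < 0) (hv : lorentz p v = 0) :
    0 ≤ lorentz v v ∧ (lorentz v v = 0 → hypPart v = 0) := by
  simp only [lorentz] at *
  have hp2 : 0 < p 2 ^ 2 := by nlinarith [sq_nonneg (p 0), sq_nonneg (p 1)]
  -- Orthogonality expresses p₂v₂ as p₀v₀ + p₁v₁; the rest is Lagrange's identity in the plane.
  have key : p 2 ^ 2 * (v 0 * v 0 + v 1 * v 1 - v 2 * v 2) =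
      (p 0 * v 1 - p 1 * v 0) ^ 2 * 1 +
        (v 0 ^ 2 + v 1 ^ 2) * (p 2 ^ 2 - p 0 ^ 2 - p 1 ^ 2) := by
    linear_combination (p 0 * v 0 + p 1 * v 1 + p 2 * v 2) * hv
  have hm : 0 < p 2 ^ 2 - p 0 ^ 2 - p 1 ^ 2 := by nlinarith
  constructor
  · by_contra hneg
    push Not at hneg
    have h1 : p 2 ^ 2 * (v 0 * v 0 + v 1 * v 1 - v 2 * v 2) < 0 := mul_neg_of_pos_of_neg hp2 hneg
    have h2 : 0 ≤ (v 0 ^ 2 + v 1 ^ 2) * (p 2 ^ 2 - p 0 ^ 2 - p 1 ^ 2) := by positivity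
    nlinarith [sq_nonneg (p 0 * v 1 - p 1 * v 0)]
  · intro h
    rw [h, mul_zero] at key
    have h2 : (v 0 ^ 2 + v 1 ^ 2) * (p 2 ^ 2 - p 0 ^ 2 - p 1 ^ 2) = 0 := by
      have : 0 ≤ (v 0 ^ 2 + v 1 ^ 2) * (p 2 ^ 2 - p 0 ^ 2 - p 1 ^ 2) := by positivity
      nlinarith [sq_nonneg (p 0 * v 1 - p 1 * v 0)]
    have h3 : v 0 ^ 2 + v 1 ^ 2 = 0 := (mul_eq_zero.mp h2).resolve_right hm.ne'
    have h0 : v 0 = 0 := by nlinarith [sq_nonneg (v 0), sq_nonneg (v 1)]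
    have h1 : v 1 = 0 := by nlinarith [sq_nonneg (v 0), sq_nonneg (v 1)]
    have h4 : v 2 = 0 := by nlinarith
    exact ext_E4 h0 h1 h4 rfl

theorem metric_self_eq_zero {p v : E4} (hp : lorentz p p < 0) (hv : lorentz p v = 0)
    (h : metric v v = 0) : v = 0 := by
  obtain ⟨h1, h2⟩ := lorentz_self_pos hp hv
  simp only [metric] at h
  have h3 : v 3 = 0 := by nlinarith [mul_self_nonneg (v 3)]
  have h4 := h2 (by nlinarith [mul_self_nonneg (v 3)])
  rw [← hypPart_add_dt v, h4, h3]; simp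

theorem contDiff_hypPart : ContDiff ℝ ∞ hypPart := by
  rw [contDiff_pi]
  intro i
  fin_cases i
  · exact contDiff_apply ℝ ℝ (0 : Fin 4)
  · exact contDiff_apply ℝ ℝ (1 : Fin 4)
  · exact contDiff_apply ℝ ℝ (2 : Fin 4)
  · exact contDiff_const

end Algebra

/-! ### Directional derivatives, Christoffel symbols and the Gauss equation -/

section DirDeriv

variable {E G : Type*} [NormedAddCommGroup E] [NormedSpace ℝ E] [NormedAddCommGroup G]
  [NormedSpace ℝ G] {U : Set E} {u v : E} {q : E}

/-- The derivative of `f` in the direction `u`. -/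
noncomputable def dirDeriv (u : E) (f : E → G) (q : E) : G := fderiv ℝ f q u

theorem _root_.ContDiffOn.dirDeriv {f : E → G} (hf : ContDiffOn ℝ ∞ f U) (hU : IsOpen U) (u : E) :
    ContDiffOn ℝ ∞ (dirDeriv u f) U :=
  (hf.fderiv_of_isOpen hU (m := ∞) (by simp)).clm_apply contDiffOn_const

theorem _root_.ContDiffOn.diffAt {f : E → G} (hf : ContDiffOn ℝ ∞ f U) (hU : IsOpen U)
    (hq : q ∈ U) : DifferentiableAt ℝ f q :=
  (hf.contDiffAt (hU.mem_nhds hq)).differentiableAt (by simp)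

theorem dirDeriv_congr {f g : E → G} (hU : IsOpen U) (h : Set.EqOn f g U) (hq : q ∈ U) (u : E) :
    dirDeriv u f q = dirDeriv u g q := by
  have : f =ᶠ[nhds q] g := Filter.eventuallyEq_of_mem (hU.mem_nhds hq) h
  simp only [dirDeriv, this.fderiv_eq]

theorem dirDeriv_comm {f : E → G} (hU : IsOpen U) (hf : ContDiffOn ℝ ∞ f U) (hq : q ∈ U)
    (u v : E) : dirDeriv u (dirDeriv v f) q = dirDeriv v (dirDeriv u f) q := by
  have hs : IsSymmSndFDerivAt ℝ f q :=
    (hf.contDiffAt (hU.mem_nhds hq)).isSymmSndFDerivAt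
      (by rw [minSmoothness_of_isRCLikeNormedField]; exact WithTop.coe_le_coe.2 (le_top : (2 : ℕ∞) ≤ ⊤))
  have hd : DifferentiableAt ℝ (fderiv ℝ f) q :=
    (hf.fderiv_of_isOpen hU (m := ∞) (by simp)).diffAt hU hq
  have key : ∀ u v : E, dirDeriv u (dirDeriv v f) q = fderiv ℝ (fderiv ℝ f) q u v := by
    intro u v
    change fderiv ℝ (fun x => fderiv ℝ f x v) q u = _
    rw [fderiv_clm_apply hd (by fun_prop)]
    simp
  rw [key, key, hs.eq]

theorem dirDeriv_const (c : G) (u q : E) : dirDeriv u (fun _ => c) q = 0 := by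
  simp [dirDeriv]

theorem dirDeriv_mul {f g : E → ℝ} (hf : DifferentiableAt ℝ f q) (hg : DifferentiableAt ℝ g q)
    (u : E) : dirDeriv u (fun x => f x * g x) q = dirDeriv u f q * g q + f q * dirDeriv u g q := by
  simp only [dirDeriv]
  rw [fderiv_fun_mul hf hg]
  simp; ring

theorem dirDeriv_add {f g : E → G} (hf : DifferentiableAt ℝ f q) (hg : DifferentiableAt ℝ g q)
    (u : E) : dirDeriv u (fun x => f x + g x) q = dirDeriv u f q + dirDeriv u g q := by
  simp only [dirDeriv]
  rw [fderiv_fun_add hf hg]; rfl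

theorem dirDeriv_sub {f g : E → G} (hf : DifferentiableAt ℝ f q) (hg : DifferentiableAt ℝ g q)
    (u : E) : dirDeriv u (fun x => f x - g x) q = dirDeriv u f q - dirDeriv u g q := by
  simp only [dirDeriv]
  rw [fderiv_fun_sub hf hg]; rfl

theorem dirDeriv_smul {f : E → ℝ} {g : E → G} (hf : DifferentiableAt ℝ f q)
    (hg : DifferentiableAt ℝ g q) (u : E) :
    dirDeriv u (fun x => f x • g x) q = dirDeriv u f q • g q + f q • dirDeriv u g q := by
  simp only [dirDeriv]
  rw [fderiv_fun_smul hf hg]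
  simp [add_comm]

theorem dirDeriv_apply {f : E → E4} (hf : DifferentiableAt ℝ f q) (i : Fin 4) (u : E) :
    dirDeriv u (fun x => f x i) q = dirDeriv u f q i := by
  simp only [dirDeriv]
  rw [fderiv_apply hf]; rfl

theorem diffAt_apply {f : E → E4} (hf : DifferentiableAt ℝ f q) (i : Fin 4) :
    DifferentiableAt ℝ (fun x => f x i) q := differentiableAt_pi.1 hf i

theorem dirDeriv_lorentz {f g : E → E4} (hf : DifferentiableAt ℝ f q)
    (hg : DifferentiableAt ℝ g q) (u : E) :
    dirDeriv u (fun x => lorentz (f x) (g x)) q =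
      lorentz (dirDeriv u f q) (g q) + lorentz (f q) (dirDeriv u g q) := by
  have hf' := diffAt_apply hf
  have hg' := diffAt_apply hg
  simp only [lorentz]
  rw [dirDeriv_sub (((hf' 0).fun_mul (hg' 0)).fun_add ((hf' 1).fun_mul (hg' 1)))
      ((hf' 2).fun_mul (hg' 2)), dirDeriv_add ((hf' 0).fun_mul (hg' 0)) ((hf' 1).fun_mul (hg' 1)),
    dirDeriv_mul (hf' 0) (hg' 0), dirDeriv_mul (hf' 1) (hg' 1), dirDeriv_mul (hf' 2) (hg' 2)]
  simp only [dirDeriv_apply hf, dirDeriv_apply hg]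
  ring

theorem diffAt_lorentz {f g : E → E4} (hf : DifferentiableAt ℝ f q)
    (hg : DifferentiableAt ℝ g q) : DifferentiableAt ℝ (fun x => lorentz (f x) (g x)) q := by
  have hf' := diffAt_apply hf
  have hg' := diffAt_apply hg
  exact (((hf' 0).mul (hg' 0)).add ((hf' 1).mul (hg' 1))).sub ((hf' 2).mul (hg' 2))

theorem dirDeriv_metric {f g : E → E4} (hf : DifferentiableAt ℝ f q)
    (hg : DifferentiableAt ℝ g q) (u : E) :
    dirDeriv u (fun x => metric (f x) (g x)) q =
      metric (dirDeriv u f q) (g q) + metric (f q) (dirDeriv u g q) := by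
  have hf' := diffAt_apply hf
  have hg' := diffAt_apply hg
  simp only [metric]
  rw [dirDeriv_add (diffAt_lorentz hf hg) ((hf' 3).fun_mul (hg' 3)), dirDeriv_lorentz hf hg,
    dirDeriv_mul (hf' 3) (hg' 3)]
  simp only [dirDeriv_apply hf, dirDeriv_apply hg]
  ring

theorem _root_.ContDiffOn.lorentz {f g : E → E4} (hf : ContDiffOn ℝ ∞ f U)
    (hg : ContDiffOn ℝ ∞ g U) : ContDiffOn ℝ ∞ (fun x => lorentz (f x) (g x)) U := by
  have hf' := contDiffOn_pi.1 hf
  have hg' := contDiffOn_pi.1 hg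
  exact (((hf' 0).mul (hg' 0)).add ((hf' 1).mul (hg' 1))).sub ((hf' 2).mul (hg' 2))

theorem _root_.ContDiffOn.hypPart {f : E → E4} (hf : ContDiffOn ℝ ∞ f U) :
    ContDiffOn ℝ ∞ (fun x => hypPart (f x)) U := contDiff_hypPart.comp_contDiffOn hf

theorem diffAt_hypPart {f : E → E4} (hf : DifferentiableAt ℝ f q) :
    DifferentiableAt ℝ (fun x => hypPart (f x)) q :=
  ((contDiff_hypPart.differentiable (by simp)) (f q)).comp q hf

theorem dirDeriv_hypPart {f : E → E4} (hf : DifferentiableAt ℝ f q) (u : E) :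
    dirDeriv u (fun x => hypPart (f x)) q = hypPart (dirDeriv u f q) := by
  have h := diffAt_hypPart hf
  apply ext_E4
  · rw [← dirDeriv_apply h, hypPart_zero, ← dirDeriv_apply hf]; rfl
  · rw [← dirDeriv_apply h, hypPart_one, ← dirDeriv_apply hf]; rfl
  · rw [← dirDeriv_apply h, hypPart_two, ← dirDeriv_apply hf]; rfl
  · rw [← dirDeriv_apply h]; simp [dirDeriv_const]

/-- A function whose directional derivatives vanish on an open convex set is constant there. -/
theorem eq_of_dirDeriv_eq_zero {f : E → G} (hU : IsOpen U) (hc : Convex ℝ U)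
    (hf : ContDiffOn ℝ ∞ f U) (h : ∀ x ∈ U, ∀ u, dirDeriv u f x = 0) {x y : E} (hx : x ∈ U)
    (hy : y ∈ U) : f x = f y := by
  refine hc.is_const_of_fderivWithin_eq_zero (𝕜 := ℝ) (hf.differentiableOn (by simp))
    (fun z hz => ?_) hx hy
  rw [fderivWithin_of_isOpen hU hz]
  ext u
  exact h z hz u

/-- Maps with the same first fundamental form have the same Christoffel symbols of the first
kind. -/
theorem metric_snd_dirDeriv {f g : E → E4} (hU : IsOpen U) (hf : ContDiffOn ℝ ∞ f U)
    (hg : ContDiffOn ℝ ∞ g U)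
    (h : ∀ x ∈ U, ∀ u v, metric (dirDeriv u f x) (dirDeriv v f x) =
      metric (dirDeriv u g x) (dirDeriv v g x)) (hq : q ∈ U) (u v w : E) :
    metric (dirDeriv u (dirDeriv v f) q) (dirDeriv w f q) =
      metric (dirDeriv u (dirDeriv v g) q) (dirDeriv w g q) := by
  -- The derivative of the first fundamental form. Its three cyclic instances combine as in the
  -- Koszul formula, using symmetry of second derivatives.
  have key : ∀ u v w, metric (dirDeriv w (dirDeriv u f) q) (dirDeriv v f q) +
      metric (dirDeriv u f q) (dirDeriv w (dirDeriv v f) q) =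
      metric (dirDeriv w (dirDeriv u g) q) (dirDeriv v g q) +
      metric (dirDeriv u g q) (dirDeriv w (dirDeriv v g) q) := by
    intro u v w
    rw [← dirDeriv_metric ((hf.dirDeriv hU u).diffAt hU hq) ((hf.dirDeriv hU v).diffAt hU hq),
      ← dirDeriv_metric ((hg.dirDeriv hU u).diffAt hU hq) ((hg.dirDeriv hU v).diffAt hU hq)]
    exact dirDeriv_congr hU (fun x hx => h x hx u v) hq w
  have h1 := key u v w
  have h2 := key v w u
  have h3 := key w u v
  rw [dirDeriv_comm hU hf hq w u, dirDeriv_comm hU hg hq w u,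
    dirDeriv_comm hU hf hq w v, dirDeriv_comm hU hg hq w v] at h1
  rw [dirDeriv_comm hU hf hq v u, dirDeriv_comm hU hg hq v u] at h3
  rw [metric_comm (dirDeriv u f q), metric_comm (dirDeriv u g q)] at h1
  rw [metric_comm (dirDeriv v f q), metric_comm (dirDeriv v g q)] at h2
  rw [metric_comm (dirDeriv w f q), metric_comm (dirDeriv w g q)] at h3
  linarith

/-- The Gauss equation: the antisymmetrized products of second derivatives depend only on the
first fundamental form. -/
theorem metric_snd_dirDeriv_antisymm {f g : E → E4} (hU : IsOpen U) (hf : ContDiffOn ℝ ∞ f U)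
    (hg : ContDiffOn ℝ ∞ g U)
    (h : ∀ x ∈ U, ∀ u v, metric (dirDeriv u f x) (dirDeriv v f x) =
      metric (dirDeriv u g x) (dirDeriv v g x)) (hq : q ∈ U) (u v w z : E) :
    metric (dirDeriv u (dirDeriv v f) q) (dirDeriv z (dirDeriv w f) q) -
      metric (dirDeriv u (dirDeriv z f) q) (dirDeriv v (dirDeriv w f) q) =
    metric (dirDeriv u (dirDeriv v g) q) (dirDeriv z (dirDeriv w g) q) -
      metric (dirDeriv u (dirDeriv z g) q) (dirDeriv v (dirDeriv w g) q) := by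
  -- Differentiating the Christoffel identity produces third derivatives; by this symmetry they
  -- cancel under antisymmetrization in v and z.
  have swap : ∀ k : E → E4, ContDiffOn ℝ ∞ k U →
      dirDeriv z (dirDeriv u (dirDeriv v k)) q = dirDeriv v (dirDeriv u (dirDeriv z k)) q := by
    intro k hk
    rw [dirDeriv_comm hU (hk.dirDeriv hU v) hq z u, dirDeriv_comm hU (hk.dirDeriv hU z) hq v u]
    exact dirDeriv_congr hU (fun x hx => dirDeriv_comm hU hk hx z v) hq u
  have key : ∀ u v w z, metric (dirDeriv z (dirDeriv u (dirDeriv v f)) q) (dirDeriv w f q) +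
      metric (dirDeriv u (dirDeriv v f) q) (dirDeriv z (dirDeriv w f) q) =
      metric (dirDeriv z (dirDeriv u (dirDeriv v g)) q) (dirDeriv w g q) +
      metric (dirDeriv u (dirDeriv v g) q) (dirDeriv z (dirDeriv w g) q) := by
    intro u v w z
    rw [← dirDeriv_metric (((hf.dirDeriv hU v).dirDeriv hU u).diffAt hU hq)
      ((hf.dirDeriv hU w).diffAt hU hq),
      ← dirDeriv_metric (((hg.dirDeriv hU v).dirDeriv hU u).diffAt hU hq)
      ((hg.dirDeriv hU w).diffAt hU hq)]
    exact dirDeriv_congr hU (fun x hx => metric_snd_dirDeriv hU hf hg h hx u v w) hq z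
  have h1 := key u v w z
  have h2 := key u z w v
  rw [swap f hf, swap g hg] at h1
  linarith

theorem lorentz_dirDeriv_self {f : E → E4} {c : ℝ} (hU : IsOpen U) (hf : ContDiffOn ℝ ∞ f U)
    (h : ∀ x ∈ U, lorentz (f x) (f x) = c) (hq : q ∈ U) (u : E) :
    lorentz (f q) (dirDeriv u f q) = 0 := by
  have h1 := dirDeriv_lorentz (hf.diffAt hU hq) (hf.diffAt hU hq) u
  rw [dirDeriv_congr hU (g := fun _ => c) (fun x hx => h x hx) hq, dirDeriv_const,
    lorentz_comm (dirDeriv u f q)] at h1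
  linarith

/-- Differentiating ⟨f, ∂f⟩ = 0 once more: the component of a second derivative along the position
vector is fixed by first derivatives. -/
theorem lorentz_snd_dirDeriv {f : E → E4} {c : ℝ} (hU : IsOpen U) (hf : ContDiffOn ℝ ∞ f U)
    (h : ∀ x ∈ U, lorentz (f x) (f x) = c) (hq : q ∈ U) (u v : E) :
    lorentz (dirDeriv u (dirDeriv v f) q) (f q) = -lorentz (dirDeriv u f q) (dirDeriv v f q) := by
  have h1 := dirDeriv_lorentz (hf.diffAt hU hq) ((hf.dirDeriv hU v).diffAt hU hq) u
  rw [dirDeriv_congr hU (g := fun _ => 0) (fun x hx => lorentz_dirDeriv_self hU hf h hx v) hq,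
    dirDeriv_const, lorentz_comm (f q)] at h1
  linarith

end DirDeriv

/-! ### The open future cone and its radial projection onto `ambient` -/

section Cone

/-- Nondegeneracy makes such a map injective, hence bijective in dimension four. Later, vectors are
identified by pairing them with the images of such a map. -/
theorem surjective_of_metric_preserving (L : E4 →ₗ[ℝ] E4)
    (h : ∀ v w, metric (L v) (L w) = metric v w) : Function.Surjective L := by
  rw [← LinearMap.injective_iff_surjective, injective_iff_map_eq_zero]
  intro v hv
  refine metric_nondegenerate fun w => ?_
  rw [← h, hv]
  simp [metric, lorentz]

/-- The vectors of `ℝ³₁ × ℝ` whose component in `ℝ³₁` is timelike and directed to the future. -/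
def cone : Set E4 := {q | lorentz q q < 0 ∧ 0 < q 2}

theorem ambient_subset_cone : ambient ⊆ cone := fun p hp => ⟨by rw [hp.1]; norm_num, hp.2⟩

theorem continuous_lorentz_self : Continuous fun q : E4 => lorentz q q := by
  unfold lorentz; fun_prop

theorem isOpen_cone : IsOpen cone :=
  (isOpen_lt continuous_lorentz_self continuous_const).inter
    (isOpen_lt continuous_const (continuous_apply 2))

/-- Cauchy–Schwarz in the first two coordinates is dominated by p₂q₂ because both vectors are
timelike. -/
theorem lorentz_neg_of_mem_cone {p q : E4} (hp : p ∈ cone) (hq : q ∈ cone) : lorentz p q < 0 := by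
  obtain ⟨h1, h2⟩ := hp
  obtain ⟨h3, h4⟩ := hq
  simp only [lorentz] at *
  by_contra! hneg
  have h5 : 0 < p 2 * q 2 := mul_pos h2 h4
  have h6 : (p 2 * q 2) ^ 2 ≤ (p 0 * q 0 + p 1 * q 1) ^ 2 :=
    pow_le_pow_left₀ h5.le (by linarith) 2
  have h7 : (p 0 * q 0 + p 1 * q 1) ^ 2 ≤ (p 0 * p 0 + p 1 * p 1) * (q 0 * q 0 + q 1 * q 1) := by
    nlinarith [sq_nonneg (p 0 * q 1 - p 1 * q 0)]
  have h8 : (p 0 * p 0 + p 1 * p 1) * (q 0 * q 0 + q 1 * q 1) < (p 2 * p 2) * (q 2 * q 2) :=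
    mul_lt_mul'' (by linarith) (by linarith) (by nlinarith [sq_nonneg (p 0), sq_nonneg (p 1)])
      (by nlinarith [sq_nonneg (q 0), sq_nonneg (q 1)])
  nlinarith

theorem mem_cone_of_lorentz_neg {p q : E4} (hp : p ∈ cone) (hq : lorentz q q < 0)
    (h : lorentz p q < 0) : q ∈ cone := by
  refine ⟨hq, ?_⟩
  by_contra! hneg
  rcases hneg.lt_or_eq with h2 | h2
  · have h3 : (-1 : ℝ) • q ∈ cone := by
      refine ⟨?_, by simpa using h2⟩
      rw [lorentz_smul_left, lorentz_smul_right]; linarith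
    have h4 := lorentz_neg_of_mem_cone hp h3
    rw [lorentz_smul_right] at h4
    linarith
  · simp only [lorentz, h2] at hq
    nlinarith [sq_nonneg (q 0), sq_nonneg (q 1)]

theorem add_mem_cone {p q : E4} (hp : p ∈ cone) (hq : q ∈ cone) : p + q ∈ cone := by
  refine ⟨?_, add_pos hp.2 hq.2⟩
  have := lorentz_neg_of_mem_cone hp hq
  rw [lorentz_add_left, lorentz_add_right, lorentz_add_right, lorentz_comm q p]
  linarith [hp.1, hq.1]

theorem smul_mem_cone {q : E4} (hq : q ∈ cone) {r : ℝ} (hr : 0 < r) : r • q ∈ cone := by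
  refine ⟨?_, mul_pos hr hq.2⟩
  rw [lorentz_smul_left, lorentz_smul_right]
  exact mul_neg_of_pos_of_neg hr (mul_neg_of_pos_of_neg hr hq.1)

/-- Convexity is what lets a vanishing derivative on the cone be integrated to constancy. -/
theorem convex_cone : Convex ℝ cone := by
  rw [convex_iff_forall_pos]
  intro p hp q hq a b ha hb _
  exact add_mem_cone (smul_mem_cone hp ha) (smul_mem_cone hq hb)

theorem hypPart_mem_cone {q : E4} (hq : q ∈ cone) : hypPart q ∈ cone := hq

/-- The Lorentzian length of the component in `ℝ³₁`. -/
noncomputable def coneLength (q : E4) : ℝ := Real.sqrt (-lorentz q q)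

/-- The radial projection of the cone onto `ℍ² × ℝ`. -/
noncomputable def radial (q : E4) : E4 := (coneLength q)⁻¹ • hypPart q + q 3 • dt

theorem coneLength_pos {q : E4} (hq : q ∈ cone) : 0 < coneLength q :=
  Real.sqrt_pos.2 (by linarith [hq.1])

theorem coneLength_sq {q : E4} (hq : q ∈ cone) : coneLength q * coneLength q = -lorentz q q :=
  Real.mul_self_sqrt (by linarith [hq.1])

theorem coneLength_ambient {p : E4} (hp : p ∈ ambient) : coneLength p = 1 := by
  simp [coneLength, hp.1]

theorem contDiffOn_coneLength : ContDiffOn ℝ ∞ coneLength cone := by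
  intro q hq
  refine ContDiffWithinAt.sqrt ?_ (by linarith [hq.1])
  exact ((contDiffOn_id.lorentz contDiffOn_id).neg) q hq

theorem contDiffOn_radial : ContDiffOn ℝ ∞ radial cone := by
  have h1 : ContDiffOn ℝ ∞ (fun q : E4 => (coneLength q)⁻¹ • hypPart q) cone :=
    (contDiffOn_coneLength.inv fun q hq => (coneLength_pos hq).ne').smul contDiffOn_id.hypPart
  have h2 : ContDiffOn ℝ ∞ (fun q : E4 => q 3 • dt) cone :=
    (contDiff_apply ℝ ℝ (3 : Fin 4)).contDiffOn.smul contDiffOn_const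
  exact h1.add h2

theorem radial_three (q : E4) : radial q 3 = q 3 := by simp [radial]

theorem hypPart_radial (q : E4) : hypPart (radial q) = (coneLength q)⁻¹ • hypPart q := by
  apply ext_E4 <;> simp [radial]

theorem radial_mem {q : E4} (hq : q ∈ cone) : radial q ∈ ambient := by
  have hl := coneLength_pos hq
  have hs := coneLength_sq hq
  refine ⟨?_, ?_⟩
  · rw [← lorentz_hypPart_left, ← lorentz_hypPart_right, hypPart_radial, lorentz_smul_left,
      lorentz_smul_right, lorentz_hypPart_left, lorentz_hypPart_right]
    have : lorentz q q = -(coneLength q * coneLength q) := by linarith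
    rw [this]; field_simp
  · rw [← hypPart_two (radial q), hypPart_radial]
    exact mul_pos (inv_pos.2 hl) hq.2

theorem radial_of_mem {p : E4} (hp : p ∈ ambient) : radial p = p := by
  rw [radial, coneLength_ambient hp, inv_one, one_smul, hypPart_add_dt]

theorem coneLength_smul_radial {q : E4} (hq : q ∈ cone) :
    coneLength q • hypPart (radial q) + q 3 • dt = q := by
  rw [hypPart_radial, smul_smul, mul_inv_cancel₀ (coneLength_pos hq).ne', one_smul, hypPart_add_dt]

theorem dirDeriv_coneLength {q : E4} (hq : q ∈ cone) (u : E4) :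
    coneLength q * dirDeriv u coneLength q = -lorentz q u := by
  have hd := contDiffOn_coneLength.diffAt isOpen_cone hq
  have hi : DifferentiableAt ℝ (fun x : E4 => x) q := differentiableAt_id
  have h1 := dirDeriv_mul hd hd u
  have h2 := dirDeriv_lorentz hi hi u
  have h3 : dirDeriv u (fun x : E4 => x) q = u := by simp [dirDeriv]
  have h4 : dirDeriv u (fun x => coneLength x * coneLength x) q =
      dirDeriv u (fun x => (0 : ℝ) - lorentz x x) q :=
    dirDeriv_congr isOpen_cone (fun x hx => by simpa using coneLength_sq hx) hq u
  rw [dirDeriv_sub (differentiableAt_const _) (diffAt_lorentz hi hi), dirDeriv_const, h2, h3] at h4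
  rw [lorentz_comm u q] at h4
  linarith

theorem dirDeriv_radial_three {q : E4} (hq : q ∈ cone) (u : E4) :
    dirDeriv u radial q 3 = u 3 := by
  rw [← dirDeriv_apply (contDiffOn_radial.diffAt isOpen_cone hq)]
  simp only [radial_three]
  rw [dirDeriv_apply (f := fun x : E4 => x) differentiableAt_id]
  simp [dirDeriv]

/-- The radial map is a retraction, so it is the identity to first order along `ambient`. The
computation differentiates the polar decomposition, whose length factor is stationary in tangent
directions. -/
theorem dirDeriv_radial_of_tangent {p u : E4} (hp : p ∈ ambient) (hu : IsAmbientTangent p u) :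
    dirDeriv u radial p = u := by
  have hc := ambient_subset_cone hp
  have hl := coneLength_ambient hp
  have h0 : dirDeriv u coneLength p = 0 := by
    have := dirDeriv_coneLength hc u
    rw [hl, one_mul] at this
    rw [this, show lorentz p u = 0 from hu, neg_zero]
  have hrd := contDiffOn_radial.diffAt isOpen_cone hc
  have hld := contDiffOn_coneLength.diffAt isOpen_cone hc
  have h1 : dirDeriv u (fun q => coneLength q • hypPart (radial q)) p = hypPart u := by
    rw [← dirDeriv_congr isOpen_cone (f := fun q => hypPart q) _ hc]
    · have hi : DifferentiableAt ℝ (fun x : E4 => x) p := differentiableAt_id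
      rw [dirDeriv_hypPart hi]
      simp [dirDeriv]
    · intro q hq
      have := congrArg hypPart (coneLength_smul_radial hq)
      refine this.symm.trans ?_
      apply ext_E4 <;> simp
  rw [dirDeriv_smul hld (diffAt_hypPart hrd), h0, hl, zero_smul, one_smul, zero_add,
    dirDeriv_hypPart hrd] at h1
  rw [← hypPart_add_dt (dirDeriv u radial p), h1, dirDeriv_radial_three hc, hypPart_add_dt]

theorem dirDeriv_radial_tangent {q : E4} (hq : q ∈ cone) (u : E4) :
    IsAmbientTangent (radial q) (dirDeriv u radial q) :=
  lorentz_dirDeriv_self isOpen_cone contDiffOn_radial (fun _ hx => (radial_mem hx).1) hq u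

end Cone

/-! ### Isometries of ℍ² × ℝ split: ±t + c on ℝ and a Lorentz map on ℍ² -/

section Isometry

variable {Φ : E4 → E4}

/-- Off `ambient` the values of Φ carry no information. Composing with the radial projection gives a
map on an open set that depends only on the restriction of Φ, so that second derivatives can be
used. -/
theorem IsAmbientIsometry.contDiffOn_comp_radial (hΦ : IsAmbientIsometry Φ) :
    ContDiffOn ℝ ∞ (fun q => Φ (radial q)) cone := by
  intro q hq
  exact (hΦ.smooth _ (radial_mem hq)).comp_contDiffWithinAt q (contDiffOn_radial q hq)

theorem IsAmbientIsometry.comp_radial_mem (hΦ : IsAmbientIsometry Φ) {q : E4} (hq : q ∈ cone) :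
    Φ (radial q) ∈ ambient := hΦ.bijOn.mapsTo (radial_mem hq)

theorem IsAmbientIsometry.dirDeriv_comp_radial (hΦ : IsAmbientIsometry Φ) {q : E4}
    (hq : q ∈ cone) (u : E4) :
    dirDeriv u (fun q => Φ (radial q)) q = fderiv ℝ Φ (radial q) (dirDeriv u radial q) := by
  simp only [dirDeriv]
  rw [fderiv_fun_comp q ((hΦ.smooth _ (radial_mem hq)).differentiableAt (by simp))
    (contDiffOn_radial.diffAt isOpen_cone hq)]
  rfl

theorem IsAmbientIsometry.metric_dirDeriv (hΦ : IsAmbientIsometry Φ) {q : E4} (hq : q ∈ cone)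
    (u v : E4) :
    metric (dirDeriv u (fun q => Φ (radial q)) q) (dirDeriv v (fun q => Φ (radial q)) q) =
      metric (dirDeriv u radial q) (dirDeriv v radial q) := by
  rw [hΦ.dirDeriv_comp_radial hq, hΦ.dirDeriv_comp_radial hq]
  exact hΦ.preserves _ (radial_mem hq) _ _ (dirDeriv_radial_tangent hq u)
    (dirDeriv_radial_tangent hq v)

theorem tangentProj_eq (p v : E4) : tangentProj p v = v + lorentz p v • hypPart p := by
  rw [tangentProj, metric_hypPart_right, lorentz_comm]

theorem isAmbientTangent_tangentProj {p : E4} (hp : p ∈ ambient) (v : E4) :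
    IsAmbientTangent p (tangentProj p v) := by
  rw [IsAmbientTangent, tangentProj_eq, lorentz_add_right, lorentz_smul_right,
    lorentz_hypPart_right, hp.1]
  ring

/-- The Gauss equation compares the pullbacks of the metric of `ℍ²` by `Φ` and by the identity. -/
theorem IsAmbientIsometry.gauss (hΦ : IsAmbientIsometry Φ) {p : E4} (hp : p ∈ ambient)
    {u v w z : E4} (hu : IsAmbientTangent p u) (hv : IsAmbientTangent p v)
    (hw : IsAmbientTangent p w) (hz : IsAmbientTangent p z) :
    let D := fun u => dirDeriv u (fun q => Φ (radial q)) p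
    lorentz (D u) (D v) * lorentz (D z) (D w) - lorentz (D u) (D z) * lorentz (D v) (D w) =
      lorentz u v * lorentz z w - lorentz u z * lorentz v w := by
  intro D
  set f : E4 → E4 := fun q => Φ (radial q) with hf
  have hc := ambient_subset_cone hp
  have hfs : ContDiffOn ℝ ∞ f cone := hΦ.contDiffOn_comp_radial
  have hff : ∀ x ∈ cone, lorentz (f x) (f x) = -1 := fun x hx => (hΦ.comp_radial_mem hx).1
  have hrr : ∀ x ∈ cone, lorentz (radial x) (radial x) = -1 := fun x hx => (radial_mem hx).1
  set N := hypPart (f p) with hN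
  let DΦ : E4 →ₗ[ℝ] E4 := (fderiv ℝ Φ p).toLinearMap
  let P : E4 →ₗ[ℝ] E4 :=
    { toFun := tangentProj p
      map_add' := fun x y => by
        simp only [tangentProj_eq, lorentz_add_right]; module
      map_smul' := fun r x => by
        simp only [tangentProj_eq, lorentz_smul_right, RingHom.id_apply]; module }
  let Q : E4 →ₗ[ℝ] E4 :=
    { toFun := fun x => lorentz p x • N
      map_add' := fun x y => by simp only [lorentz_add_right, add_smul]
      map_smul' := fun r x => by
        simp only [lorentz_smul_right, RingHom.id_apply, mul_smul] }
  -- The extension of the differential of Φ on tangent vectors that sends the normal `hypPart p` to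
  -- the normal N at the image point; it preserves the whole form of signature (3, 1).
  let L : E4 →ₗ[ℝ] E4 := DΦ ∘ₗ P - Q
  have hDP : ∀ x, DΦ (P x) = dirDeriv (tangentProj p x) f p := by
    intro x
    rw [hf, hΦ.dirDeriv_comp_radial hc, dirDeriv_radial_of_tangent hp
      (isAmbientTangent_tangentProj hp x), radial_of_mem hp]
    rfl
  have hLx : ∀ x, L x = dirDeriv (tangentProj p x) f p - lorentz p x • N := fun x => by
    rw [← hDP]; rfl
  have hNf : ∀ x, metric (dirDeriv x f p) N = 0 := fun x => by
    rw [hN, metric_hypPart_right, lorentz_comm]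
    exact lorentz_dirDeriv_self isOpen_cone hfs hff hc x
  have hNN : metric N N = -1 := by
    rw [hN, metric_hypPart_right, lorentz_hypPart_left]; exact hff p hc
  have hLL : ∀ x y, metric (L x) (L y) = metric x y := by
    intro x y
    have h1 : metric (dirDeriv (tangentProj p x) f p) (dirDeriv (tangentProj p y) f p) =
        metric (tangentProj p x) (tangentProj p y) := by
      rw [hf, hΦ.metric_dirDeriv hc, dirDeriv_radial_of_tangent hp
        (isAmbientTangent_tangentProj hp x), dirDeriv_radial_of_tangent hp
        (isAmbientTangent_tangentProj hp y)]
    rw [hLx, hLx, metric_sub_left, metric_sub_right, metric_sub_right, h1, metric_smul_right,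
      metric_smul_left, metric_smul_left, metric_smul_right, hNN, hNf, metric_comm N, hNf,
      tangentProj_eq, tangentProj_eq, metric_add_left, metric_add_right, metric_add_right,
      metric_smul_left, metric_smul_right, metric_smul_right, metric_smul_left,
      metric_hypPart_left, metric_hypPart_right, metric_hypPart_right, lorentz_hypPart_left,
      hp.1, lorentz_comm x p]
    ring
  -- Tangential components of second derivatives agree under L by equality of Christoffel symbols.
  -- Only the component along N differs, and it is known from ⟨f, f⟩ = -1.
  have hsnd : ∀ x y, IsAmbientTangent p x → IsAmbientTangent p y →
      dirDeriv x (dirDeriv y f) p = L (dirDeriv x (dirDeriv y radial) p) +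
        (lorentz (D x) (D y) - lorentz x y) • N := by
    intro x y hx hy
    have hNL : N = L (hypPart p) := by
      have h0 : tangentProj p (hypPart p) = 0 := by
        rw [tangentProj_eq, lorentz_hypPart_right, hp.1]; module
      rw [hLx, h0, lorentz_hypPart_right, hp.1]
      simp [dirDeriv]
    rw [← sub_eq_zero]
    refine metric_nondegenerate fun y' => ?_
    obtain ⟨w', rfl⟩ := surjective_of_metric_preserving L hLL y'
    have e1 : metric (dirDeriv x (dirDeriv y f) p) (L w') =
        metric (dirDeriv x (dirDeriv y radial) p) (tangentProj p w') +
          lorentz p w' * lorentz (D x) (D y) := by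
      rw [hLx, metric_sub_right, metric_smul_right, hN, metric_hypPart_right,
        lorentz_snd_dirDeriv isOpen_cone hfs hff hc,
        metric_snd_dirDeriv isOpen_cone hfs contDiffOn_radial
          (fun q hq u v => hΦ.metric_dirDeriv hq u v) hc,
        dirDeriv_radial_of_tangent hp (isAmbientTangent_tangentProj hp w')]
      ring
    have e2 : lorentz (dirDeriv x (dirDeriv y radial) p) p = -lorentz x y := by
      have := lorentz_snd_dirDeriv isOpen_cone contDiffOn_radial hrr hc x y
      rw [radial_of_mem hp, dirDeriv_radial_of_tangent hp hx,
        dirDeriv_radial_of_tangent hp hy] at this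
      exact this
    rw [metric_sub_left, metric_add_left, metric_smul_left, e1]
    rw [show metric N (L w') = metric (L (hypPart p)) (L w') by rw [← hNL]]
    rw [hLL, hLL, tangentProj_eq, metric_add_right, metric_smul_right, metric_hypPart_right,
      e2, metric_hypPart_left]
    ring
  have hmain := metric_snd_dirDeriv_antisymm isOpen_cone hfs contDiffOn_radial
    (fun q hq u v => hΦ.metric_dirDeriv hq u v) hc u v w z
  have hLN : ∀ x y, IsAmbientTangent p x → IsAmbientTangent p y →
      metric (L (dirDeriv x (dirDeriv y radial) p)) N = -lorentz x y := by
    intro x y hx hy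
    have h1 : metric (dirDeriv x (dirDeriv y f) p) N = -lorentz (D x) (D y) := by
      rw [hN, metric_hypPart_right]
      exact lorentz_snd_dirDeriv isOpen_cone hfs hff hc x y
    rw [hsnd x y hx hy, metric_add_left, metric_smul_left, hNN] at h1
    linarith
  have hprod : ∀ x y x' y', IsAmbientTangent p x → IsAmbientTangent p y →
      IsAmbientTangent p x' → IsAmbientTangent p y' →
      metric (dirDeriv x (dirDeriv y f) p) (dirDeriv x' (dirDeriv y' f) p) =
        metric (dirDeriv x (dirDeriv y radial) p) (dirDeriv x' (dirDeriv y' radial) p)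
          - lorentz (D x) (D y) * lorentz (D x') (D y') + lorentz x y * lorentz x' y' := by
    intro x y x' y' hx hy hx' hy'
    rw [hsnd x y hx hy, hsnd x' y' hx' hy', metric_add_left, metric_add_right, metric_add_right,
      metric_smul_left, metric_smul_left, metric_smul_right, metric_smul_right, hNN, hLL,
      hLN x y hx hy, metric_comm N, hLN x' y' hx' hy']
    ring
  rw [hprod u v z w hu hv hz hw, hprod u z v w hu hz hv hw] at hmain
  linarith

theorem isAmbientTangent_dt (p : E4) : IsAmbientTangent p dt := by
  simp [IsAmbientTangent, lorentz]

theorem lorentz_dt_right (p : E4) : lorentz p dt = 0 := isAmbientTangent_dt p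

/-- The differential of an isometry of `ℍ² × ℝ` maps `∂_t` to `± ∂_t`. -/
theorem IsAmbientIsometry.hypPart_dirDeriv_dt (hΦ : IsAmbientIsometry Φ) {p : E4}
    (hp : p ∈ ambient) : hypPart (dirDeriv dt (fun q => Φ (radial q)) p) = 0 := by
  have hc := ambient_subset_cone hp
  set D : E4 → E4 := fun u => dirDeriv u (fun q => Φ (radial q)) p with hD
  have hpp := hp.1
  have hp2 := hp.2
  have hff : ∀ x ∈ cone, lorentz (Φ (radial x)) (Φ (radial x)) = -1 :=
    fun x hx => (hΦ.comp_radial_mem hx).1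
  obtain ⟨-, hpos⟩ := lorentz_self_pos (by rw [hff p hc]; norm_num)
    (lorentz_dirDeriv_self isOpen_cone hΦ.contDiffOn_comp_radial hff hc dt)
  refine hpos ?_
  by_contra hne
  -- A basis e₁, e₂ of the tangent plane of ℍ², with Gram determinant p₂².
  set e₁ : E4 := ![p 2, 0, p 0, 0] with he₁
  set e₂ : E4 := ![0, p 2, p 1, 0] with he₂
  have h₁ : IsAmbientTangent p e₁ := by simp [IsAmbientTangent, lorentz, he₁]; ring
  have h₂ : IsAmbientTangent p e₂ := by simp [IsAmbientTangent, lorentz, he₂]; ring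
  have ht := isAmbientTangent_dt p
  -- Curvature terms involving ∂_t vanish. If ⟨D∂_t, D∂_t⟩ ≠ 0, the Gram matrix of the images of
  -- ∂_t, e₁, e₂ would then have rank one, contradicting the nonzero minor of e₁, e₂.
  have g0 := hΦ.gauss hp h₁ h₁ h₂ h₂
  have g1 := hΦ.gauss hp ht ht h₁ h₁
  have g2 := hΦ.gauss hp ht ht h₂ h₂
  have g3 := hΦ.gauss hp ht ht h₁ h₂
  have z1 : ∀ x, lorentz dt x = 0 := fun x => by rw [lorentz_comm, lorentz_dt_right]
  simp only [z1, zero_mul, sub_zero] at g0 g1 g2 g3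
  change lorentz (D e₁) (D e₁) * lorentz (D e₂) (D e₂) -
    lorentz (D e₁) (D e₂) * lorentz (D e₁) (D e₂) = _ at g0
  change lorentz (D dt) (D dt) * lorentz (D e₁) (D e₁) -
    lorentz (D dt) (D e₁) * lorentz (D dt) (D e₁) = _ at g1
  change lorentz (D dt) (D dt) * lorentz (D e₂) (D e₂) -
    lorentz (D dt) (D e₂) * lorentz (D dt) (D e₂) = _ at g2
  change lorentz (D dt) (D dt) * lorentz (D e₂) (D e₁) -
    lorentz (D dt) (D e₂) * lorentz (D dt) (D e₁) = _ at g3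
  change ¬ lorentz (D dt) (D dt) = 0 at hne
  rw [lorentz_comm (D e₂) (D e₁)] at g3
  have hdet : lorentz e₁ e₁ * lorentz e₂ e₂ - lorentz e₁ e₂ * lorentz e₁ e₂ = p 2 ^ 2 := by
    simp only [lorentz, he₁, he₂] at hpp ⊢
    simp
    linear_combination -(p 2 ^ 2) * hpp
  rw [hdet] at g0
  have : lorentz (D dt) (D dt) ^ 2 * p 2 ^ 2 = 0 := by
    rw [← g0]
    linear_combination (lorentz (D dt) (D dt) * lorentz (D e₂) (D e₂)) * g1 +
      lorentz (D dt) (D e₁) ^ 2 * g2 -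
      (lorentz (D dt) (D dt) * lorentz (D e₁) (D e₂) +
        lorentz (D dt) (D e₂) * lorentz (D dt) (D e₁)) * g3
  have h3 : lorentz (D dt) (D dt) ^ 2 * p 2 ^ 2 ≠ 0 := by positivity
  exact h3 this

theorem dirDeriv_dt_radial {p : E4} (hp : p ∈ cone) : dirDeriv dt radial p = dt := by
  have hrd := contDiffOn_radial.diffAt isOpen_cone hp
  have h1 : dirDeriv dt (fun q => hypPart (radial q)) p = 0 := by
    have : (fun q => hypPart (radial q)) = fun q => (coneLength q)⁻¹ • hypPart q := by
      ext1 q; exact hypPart_radial q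
    rw [this, dirDeriv_smul (f := fun q => (coneLength q)⁻¹) ((contDiffOn_coneLength.inv
      fun q hq => (coneLength_pos hq).ne').diffAt isOpen_cone hp)
      (diffAt_hypPart (f := fun x : E4 => x) differentiableAt_id),
      dirDeriv_hypPart (f := fun x : E4 => x) differentiableAt_id]
    have h2 : dirDeriv dt (fun q => (coneLength q)⁻¹) p = 0 := by
      have h3 := dirDeriv_coneLength hp dt
      rw [lorentz_dt_right, neg_zero] at h3
      have h4 : dirDeriv dt coneLength p = 0 := (mul_eq_zero.1 h3).resolve_left (coneLength_pos hp).ne'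
      have hld := contDiffOn_coneLength.diffAt isOpen_cone hp
      have h6 := dirDeriv_mul (f := fun q => (coneLength q)⁻¹)
        (hld.fun_inv (coneLength_pos hp).ne') hld dt
      rw [dirDeriv_congr isOpen_cone (g := fun _ => (1 : ℝ))
        (fun q hq => inv_mul_cancel₀ (coneLength_pos hq).ne') hp, dirDeriv_const, h4, mul_zero,
        add_zero] at h6
      exact (mul_eq_zero.1 h6.symm).resolve_right (coneLength_pos hp).ne'
    have h5 : hypPart (dirDeriv dt (fun x : E4 => x) p) = 0 := by
      apply ext_E4 <;> simp [dirDeriv]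
    rw [h2, h5]; simp
  rw [dirDeriv_hypPart hrd] at h1
  rw [← hypPart_add_dt (dirDeriv dt radial p), h1, dirDeriv_radial_three hp]
  simp

/-- The image of ∂_t is vertical, so pairing with it reads off only the last component; preservation
of the metric does the rest. -/
theorem IsAmbientIsometry.dirDeriv_comp_radial_three (hΦ : IsAmbientIsometry Φ) {q : E4}
    (hq : q ∈ cone) (u : E4) :
    dirDeriv u (fun q => Φ (radial q)) q 3 * dirDeriv dt (fun q => Φ (radial q)) q 3 = u 3 := by
  have hp := radial_mem hq
  have hc := ambient_subset_cone hp
  have h0 := hΦ.hypPart_dirDeriv_dt hp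
  rw [hΦ.dirDeriv_comp_radial hc, dirDeriv_dt_radial hc, radial_of_mem hp] at h0
  rw [hΦ.dirDeriv_comp_radial hq, hΦ.dirDeriv_comp_radial hq, dirDeriv_dt_radial hq]
  have h1 := hΦ.preserves _ hp _ _ (dirDeriv_radial_tangent hq u) (isAmbientTangent_dt _)
  rw [metric_dt_right, dirDeriv_radial_three hq, ← hypPart_add_dt (fderiv ℝ Φ (radial q) dt), h0,
    zero_add, metric_smul_right, metric_dt_right] at h1
  linarith

/-- An isometry of `ℍ² × ℝ` acts on the factor `ℝ` as `t ↦ ± t + c`. -/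
theorem IsAmbientIsometry.exists_height (hΦ : IsAmbientIsometry Φ) :
    ∃ ε c : ℝ, ε * ε = 1 ∧ ∀ q ∈ cone, Φ (radial q) 3 = ε * q 3 + c := by
  set f : E4 → E4 := fun q => Φ (radial q) with hf
  have hfs : ContDiffOn ℝ ∞ f cone := hΦ.contDiffOn_comp_radial
  have hfd := hfs.dirDeriv isOpen_cone dt
  have hη : ContDiffOn ℝ ∞ (fun q => dirDeriv dt f q 3) cone := contDiffOn_pi.1 hfd 3
  have hsq : ∀ q ∈ cone, dirDeriv dt f q 3 * dirDeriv dt f q 3 = 1 := fun q hq => by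
    simpa using hΦ.dirDeriv_comp_radial_three hq dt
  set p₀ : E4 := ![0, 0, 1, 0] with hp₀
  have hc₀ : p₀ ∈ cone := by constructor <;> simp [lorentz, hp₀]
  set ε := dirDeriv dt f p₀ 3
  have hconst : ∀ q ∈ cone, dirDeriv dt f q 3 = ε := by
    intro q hq
    refine eq_of_dirDeriv_eq_zero isOpen_cone convex_cone hη (fun x hx u => ?_) hq hc₀
    have hd := hη.diffAt isOpen_cone hx
    have h1 := dirDeriv_mul hd hd u
    rw [dirDeriv_congr isOpen_cone (g := fun _ => (1 : ℝ)) hsq hx, dirDeriv_const] at h1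
    have h2 : dirDeriv dt f x 3 ≠ 0 := fun h => by simpa [h] using hsq x hx
    have h3 : dirDeriv dt f x 3 * dirDeriv u (fun q => dirDeriv dt f q 3) x = 0 := by linarith
    exact (mul_eq_zero.1 h3).resolve_left h2
  refine ⟨ε, f p₀ 3 - ε * p₀ 3, hsq p₀ hc₀, fun q hq => ?_⟩
  have h3 : ContDiffOn ℝ ∞ (fun q : E4 => q 3) cone :=
    (contDiff_apply ℝ ℝ (3 : Fin 4)).contDiffOn
  have hk : ContDiffOn ℝ ∞ (fun q => f q 3 - ε * q 3) cone :=
    (contDiffOn_pi.1 hfs 3).sub (contDiffOn_const.mul h3)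
  have := eq_of_dirDeriv_eq_zero isOpen_cone convex_cone hk (fun x hx u => ?_) hq hc₀
  · change f q 3 = _
    linarith
  · have hd := hfs.diffAt isOpen_cone hx
    rw [dirDeriv_sub (diffAt_apply hd 3)
      ((differentiableAt_const _).fun_mul (h3.diffAt isOpen_cone hx)),
      dirDeriv_mul (differentiableAt_const _) (h3.diffAt isOpen_cone hx), dirDeriv_const,
      dirDeriv_apply hd, dirDeriv_apply (f := fun x : E4 => x) differentiableAt_id]
    have h4 := hΦ.dirDeriv_comp_radial_three hx u
    change dirDeriv u f x 3 * dirDeriv dt f x 3 = u 3 at h4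
    have h5 := hsq p₀ hc₀
    rw [hconst x hx] at h4
    have h6 : dirDeriv u (fun x : E4 => x) x 3 = u 3 := by simp [dirDeriv]
    rw [h6, ← h4]
    linear_combination -(dirDeriv u f x 3) * h5

/-- On horizontal components, isometries of `ℍ² × ℝ` are Lorentz transformations. -/
theorem IsAmbientIsometry.exists_adjoint (hΦ : IsAmbientIsometry Φ) (W : E4) :
    ∃ V, lorentz V V = lorentz W W ∧ ∀ p ∈ ambient, lorentz (Φ p) W = lorentz p V := by
  set f : E4 → E4 := fun q => Φ (radial q) with hf
  have hfs : ContDiffOn ℝ ∞ f cone := hΦ.contDiffOn_comp_radial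
  have hff : ∀ x ∈ cone, lorentz (f x) (f x) = -1 := fun x hx => (hΦ.comp_radial_mem hx).1
  have hrr : ∀ x ∈ cone, lorentz (radial x) (radial x) = -1 := fun x hx => (radial_mem hx).1
  have h3 : ContDiffOn ℝ ∞ (fun q : E4 => q 3) cone :=
    (contDiff_apply ℝ ℝ (3 : Fin 4)).contDiffOn
  -- The homogeneous extension of degree one of the horizontal part of g has the polar form -dρ² +
  -- ρ²⟨dg, dg⟩ + dt². For g = `radial` it is the identity, which identifies this form with the flat
  -- one.
  have hext : ∀ g : E4 → E4, ContDiffOn ℝ ∞ g cone → (∀ x ∈ cone, lorentz (g x) (g x) = -1) →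
      ContDiffOn ℝ ∞ (fun q => coneLength q • hypPart (g q) + q 3 • dt) cone ∧
      ∀ q ∈ cone, ∀ u v, metric (dirDeriv u (fun q => coneLength q • hypPart (g q) + q 3 • dt) q)
          (dirDeriv v (fun q => coneLength q • hypPart (g q) + q 3 • dt) q) =
        -(dirDeriv u coneLength q * dirDeriv v coneLength q) +
          coneLength q ^ 2 * lorentz (dirDeriv u g q) (dirDeriv v g q) + u 3 * v 3 := by
    intro g hg hgg
    have s1 : ContDiffOn ℝ ∞ (fun q => coneLength q • hypPart (g q)) cone :=
      contDiffOn_coneLength.smul hg.hypPart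
    have s2 : ContDiffOn ℝ ∞ (fun q : E4 => q 3 • dt) cone := h3.smul contDiffOn_const
    refine ⟨s1.add s2, fun q hq u v => ?_⟩
    have hD : ∀ u, dirDeriv u (fun q => coneLength q • hypPart (g q) + q 3 • dt) q =
        dirDeriv u coneLength q • hypPart (g q) + coneLength q • hypPart (dirDeriv u g q) +
          u 3 • dt := by
      intro u
      have hd := hg.diffAt isOpen_cone hq
      have h6 : dirDeriv u (fun x : E4 => x) q 3 = u 3 := by simp [dirDeriv]
      rw [dirDeriv_add (s1.diffAt isOpen_cone hq) (s2.diffAt isOpen_cone hq),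
        dirDeriv_smul (contDiffOn_coneLength.diffAt isOpen_cone hq) (diffAt_hypPart hd),
        dirDeriv_smul (h3.diffAt isOpen_cone hq) (differentiableAt_const _), dirDeriv_const,
        dirDeriv_apply (f := fun x : E4 => x) differentiableAt_id, dirDeriv_hypPart hd, h6]
      simp
    rw [hD, hD]
    simp only [metric_add_left, metric_add_right, metric_smul_left, metric_smul_right,
      metric_hypPart_left, lorentz_hypPart_right, metric_dt_left, metric_dt_right, hgg q hq,
      lorentz_dirDeriv_self isOpen_cone hg hgg hq, lorentz_comm _ (g q), hypPart_three,
      Pi.add_apply, Pi.smul_apply, smul_eq_mul, dt_three]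
    ring
  obtain ⟨hψ, hψm⟩ := hext f hfs hff
  obtain ⟨-, hrm⟩ := hext radial contDiffOn_radial hrr
  set ψ : E4 → E4 := fun q => coneLength q • hypPart (f q) + q 3 • dt with hψdef
  have hid : ∀ q ∈ cone, ∀ u, dirDeriv u (fun x : E4 => x) q = u := by
    intro q hq u; simp [dirDeriv]
  have hflat : ∀ q ∈ cone, ∀ u v, metric (dirDeriv u ψ q) (dirDeriv v ψ q) =
      metric (dirDeriv u (fun x : E4 => x) q) (dirDeriv v (fun x : E4 => x) q) := by
    intro q hq u v
    have hr : ∀ u, dirDeriv u (fun q => coneLength q • hypPart (radial q) + q 3 • dt) q =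
        dirDeriv u (fun x : E4 => x) q := fun u =>
      dirDeriv_congr isOpen_cone (fun x hx => coneLength_smul_radial hx) hq u
    have hm1 := hrm q hq u v
    rw [hr, hr] at hm1
    rw [hψm q hq, hm1]
    have hm2 := hΦ.metric_dirDeriv hq u v
    change metric (dirDeriv u f q) (dirDeriv v f q) = _ at hm2
    simp only [metric, dirDeriv_radial_three hq] at hm2
    have e1 := hΦ.dirDeriv_comp_radial_three hq u
    have e2 := hΦ.dirDeriv_comp_radial_three hq v
    have e3 := hΦ.dirDeriv_comp_radial_three hq dt
    change dirDeriv u f q 3 * dirDeriv dt f q 3 = _ at e1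
    change dirDeriv v f q 3 * dirDeriv dt f q 3 = _ at e2
    change dirDeriv dt f q 3 * dirDeriv dt f q 3 = 1 at e3
    have e4 : dirDeriv u f q 3 * dirDeriv v f q 3 = u 3 * v 3 := by
      rw [← e1, ← e2]; linear_combination -(dirDeriv u f q 3 * dirDeriv v f q 3) * e3
    have e5 : lorentz (dirDeriv u f q) (dirDeriv v f q) =
      lorentz (dirDeriv u radial q) (dirDeriv v radial q) := by linarith
    rw [e5]
  set p₀ : E4 := ![0, 0, 1, 0] with hp₀
  have hc₀ : p₀ ∈ cone := by constructor <;> simp [lorentz, hp₀]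
  have hLL : ∀ q ∈ cone, ∀ v w, metric (fderiv ℝ ψ q v) (fderiv ℝ ψ q w) = metric v w := by
    intro q hq v w
    have := hflat q hq v w
    rwa [hid q hq, hid q hq] at this
  -- A map preserving the flat form has the vanishing Christoffel symbols of the identity; since its
  -- differential is onto, its second derivatives vanish and it is affine.
  have hsnd : ∀ q ∈ cone, ∀ u v, dirDeriv u (dirDeriv v ψ) q = 0 := by
    intro q hq u v
    refine metric_nondegenerate fun y => ?_
    obtain ⟨w, rfl⟩ := surjective_of_metric_preserving (fderiv ℝ ψ q).toLinearMap (hLL q hq) y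
    have := metric_snd_dirDeriv isOpen_cone hψ contDiffOn_id hflat hq u v w
    refine this.trans ?_
    have h7 : dirDeriv u (dirDeriv v (fun x : E4 => x)) q = 0 := by
      rw [dirDeriv_congr isOpen_cone (g := fun _ => v) (fun x hx => hid x hx v) hq,
        dirDeriv_const]
    change metric (dirDeriv u (dirDeriv v (fun x : E4 => x)) q) _ = 0
    rw [h7]; simp [metric, lorentz]
  set L := fderiv ℝ ψ p₀ with hL
  have hDψ : ∀ q ∈ cone, ∀ v, dirDeriv v ψ q = L v := fun q hq v =>
    eq_of_dirDeriv_eq_zero isOpen_cone convex_cone (hψ.dirDeriv isOpen_cone v)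
      (fun x hx u => hsnd x hx u v) hq hc₀
  have haff : ∀ p ∈ cone, ∀ q ∈ cone, ψ p - L p = ψ q - L q := by
    intro p hp q hq
    refine eq_of_dirDeriv_eq_zero isOpen_cone convex_cone (f := fun x => ψ x - L x)
      (hψ.sub L.contDiff.contDiffOn) (fun x hx u => ?_) hp hq
    rw [dirDeriv_sub (hψ.diffAt isOpen_cone hx) L.differentiableAt, hDψ x hx]
    simp [dirDeriv]
  obtain ⟨V, hV⟩ := surjective_of_metric_preserving L.toLinearMap (hLL p₀ hc₀) (hypPart W)
  change L V = hypPart W at hV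
  have hL3 : ∀ v, (L v) 3 = v 3 := by
    intro v
    rw [← hDψ p₀ hc₀ v, ← dirDeriv_apply (hψ.diffAt isOpen_cone hc₀)]
    have : (fun x => ψ x 3) = fun x => x 3 := by ext x; simp [hψdef]
    rw [this, dirDeriv_apply (f := fun x : E4 => x) differentiableAt_id, hid p₀ hc₀]
  have hV3 : V 3 = 0 := by rw [← hL3 V, hV, hypPart_three]
  refine ⟨V, ?_, fun p hp => ?_⟩
  · have := hLL p₀ hc₀ V V
    rw [← hL, hV, metric_hypPart_left, lorentz_hypPart_right] at this
    rw [this, metric, hV3]; ring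
  · have hc := ambient_subset_cone hp
    -- This point has the same radial projection as p and twice its length. Comparing ψ at the two
    -- points removes the additive constant.
    have hq : p + hypPart p ∈ cone := add_mem_cone hc (hypPart_mem_cone hc)
    have hl2 : coneLength (p + hypPart p) = 2 := by
      rw [coneLength, show -lorentz (p + hypPart p) (p + hypPart p) = 2 ^ 2 by
        simp only [lorentz_add_left, lorentz_add_right, lorentz_hypPart_left,
          lorentz_hypPart_right, hp.1]; norm_num]
      exact Real.sqrt_sq (by norm_num)
    have hrad : radial (p + hypPart p) = p := by
      apply ext_E4 <;> simp [radial, hl2] <;> ring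
    have h8 := haff _ hq p hc
    simp only [hψdef, hf, hl2, coneLength_ambient hp, hrad, radial_of_mem hp, map_add] at h8
    have h9 : hypPart (Φ p) = L (hypPart p) := by
      have h10 : (p + hypPart p) 3 = p 3 := by simp
      rw [h10] at h8
      have : hypPart (Φ p) - L (hypPart p) = ((2 : ℝ) • hypPart (Φ p) + p 3 • dt -
        (L p + L (hypPart p))) - ((1 : ℝ) • hypPart (Φ p) + p 3 • dt - L p) := by module
      rw [h8, sub_self] at this
      exact sub_eq_zero.1 this
    rw [← lorentz_hypPart_left, ← metric_hypPart_right, ← hV, h9, hLL p₀ hc₀,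
      metric_hypPart_left]

end Isometry

/-! ### The shape operator at a point -/

section LinearAlgebra

variable {V : Type*} [AddCommGroup V] [Module ℝ V]

/-- The range of the differential of an immersed surface is the orthogonal complement of the
normal vector. -/
theorem mem_range_of_normal (hV : Module.finrank ℝ V = 2) {p ξ : E4} (hp : p ∈ ambient)
    (D : V →ₗ[ℝ] E4) (hD : Function.Injective D) (hpD : ∀ v, lorentz p (D v) = 0)
    (hpξ : lorentz p ξ = 0) (hξ : metric ξ ξ = 1) (hξD : ∀ v, metric ξ (D v) = 0) {w : E4}
    (hw : lorentz p w = 0) (hξw : metric ξ w = 0) : ∃ v, D v = w := by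
  let φ : E4 →ₗ[ℝ] ℝ × ℝ :=
    { toFun := fun w => (lorentz p w, metric ξ w)
      map_add' := fun x y => by simp only [lorentz_add_right, metric_add_right]; rfl
      map_smul' := fun r x => by simp only [lorentz_smul_right, metric_smul_right]; rfl }
  have hφ : Function.Surjective φ := by
    rintro ⟨x, y⟩
    refine ⟨(-x) • hypPart p + y • ξ, ?_⟩
    change (lorentz p _, metric ξ _) = _
    rw [lorentz_add_right, lorentz_smul_right, lorentz_smul_right, lorentz_hypPart_right, hp.1, hpξ,
      metric_add_right, metric_smul_right, metric_smul_right, metric_hypPart_right, lorentz_comm ξ,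
      hpξ, hξ]
    simp
  have h1 := φ.finrank_range_add_finrank_ker
  rw [LinearMap.range_eq_top.2 hφ, finrank_top] at h1
  have h2 : Module.finrank ℝ (LinearMap.range D) = 2 := by
    rw [LinearMap.finrank_range_of_inj hD, hV]
  have h3 : LinearMap.range D ≤ LinearMap.ker φ := by
    rintro _ ⟨v, rfl⟩
    rw [LinearMap.mem_ker]
    change (lorentz p _, metric ξ _) = _
    rw [hpD, hξD]; rfl
  have h4 : Module.finrank ℝ (LinearMap.ker φ) = 2 := by
    simp at h1; omega
  have h5 := Submodule.eq_of_le_of_finrank_eq h3 (by rw [h2, h4])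
  have h6 : w ∈ LinearMap.ker φ := by
    rw [LinearMap.mem_ker]
    change (lorentz p _, metric ξ _) = _
    rw [hw, hξw]; rfl
  rw [← h5] at h6
  exact h6

variable [FiniteDimensional ℝ V]

/-- A trace-free endomorphism of a plane with nontrivial kernel has square zero. -/
theorem comp_self_eq_zero_of_trace_eq_zero (hV : Module.finrank ℝ V = 2) (B : Module.End ℝ V)
    (htr : LinearMap.trace ℝ V B = 0) {τ : V} (hτ : τ ≠ 0) (hB : B τ = 0) (v : V) :
    B (B v) = 0 := by
  let bs := Module.finBasisOfFinrankEq ℝ V hV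
  set m := LinearMap.toMatrix bs bs B with hm
  have h1 : m.trace = 0 := by rw [← htr, hm, LinearMap.trace_eq_matrix_trace ℝ bs]
  have h2 : m.det = 0 := by
    rw [← Matrix.exists_mulVec_eq_zero_iff]
    refine ⟨bs.repr τ, ?_, ?_⟩
    · intro h
      exact hτ (by simpa using h)
    · rw [hm, LinearMap.toMatrix_mulVec_repr, hB]; simp
  -- Cayley–Hamilton for a 2 × 2 matrix with zero trace and zero determinant.
  have h3 : m * m = 0 := by
    rw [Matrix.trace_fin_two] at h1
    rw [Matrix.det_fin_two] at h2
    ext i j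
    fin_cases i <;> fin_cases j <;> simp [Matrix.mul_apply, Fin.sum_univ_two]
    · linear_combination m 0 0 * h1 - h2
    · linear_combination m 0 1 * h1
    · linear_combination m 1 0 * h1
    · linear_combination m 1 1 * h1 - h2
  have h4 : B ∘ₗ B = 0 := by
    apply (LinearMap.toMatrix bs bs).injective
    rw [LinearMap.toMatrix_comp bs bs bs, ← hm, h3, map_zero]
  exact LinearMap.congr_fun h4 v

/-- The derivative `Dξ` of the unit normal of a surface with differential `D`, when the shape
operator has eigenvalues `κ` in the direction of `T` and `-κ` in the orthogonal direction. -/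
def IsMinimalPrincipal (p ξ : E4) (D Dξ : V → E4) (κ : ℝ) : Prop :=
  ∀ v, Dξ v = κ • D v - (2 * κ * D v 3 / (1 - ξ 3 ^ 2)) • (dt - ξ 3 • ξ) -
    (ξ 3 * D v 3) • hypPart p

/-- Subtract from A the expected operator, with eigenvalue κ on T and -κ on its complement. The
difference is symmetric, trace-free and kills T, hence has square zero; positivity of the induced
metric makes it zero. -/
theorem isMinimalPrincipal_of_shape (hV : Module.finrank ℝ V = 2) {p ξ : E4} (hp : p ∈ ambient)
    (D Dξ : V →ₗ[ℝ] E4) (hD : Function.Injective D) (hpD : ∀ v, lorentz p (D v) = 0)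
    (hξD : ∀ v, metric ξ (D v) = 0)
    (hpDξ : ∀ v, lorentz p (Dξ v) = -lorentz ξ (D v))
    (hsymm : ∀ v w, metric (Dξ v) (D w) = metric (Dξ w) (D v))
    (A : Module.End ℝ V) (hA : ∀ v, tangentProj p (Dξ v) = -D (A v))
    (htr : LinearMap.trace ℝ V A = 0) {τ : V} (hτ0 : τ ≠ 0) (hτ : dt = D τ + ξ 3 • ξ) {κ : ℝ}
    (hκ : A τ = κ • τ) : ξ 3 ^ 2 < 1 ∧ IsMinimalPrincipal p ξ D Dξ κ := by
  have hDτ : D τ = dt - ξ 3 • ξ := by rw [hτ]; abel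
  have hDτ3 : D τ 3 = 1 - ξ 3 ^ 2 := by rw [hDτ]; simp; ring
  -- T is the gradient of the height, so `D v 3` is the inner product with T and 1 - ν² = |T|².
  have hτv : ∀ v, metric (D τ) (D v) = D v 3 := fun v => by
    rw [hDτ, metric_sub_left, metric_smul_left, hξD, metric_dt_left]; ring
  have hpp : lorentz p p < 0 := by rw [hp.1]; norm_num
  have hpos : 0 < 1 - ξ 3 ^ 2 := by
    have h1 : metric (D τ) (D τ) = 1 - ξ 3 ^ 2 := by rw [hτv, hDτ3]
    have h2 : 0 ≤ metric (D τ) (D τ) :=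
      add_nonneg (lorentz_self_pos hpp (hpD τ)).1 (mul_self_nonneg _)
    rcases h2.lt_or_eq with h | h
    · rwa [h1] at h
    · have := metric_self_eq_zero hpp (hpD τ) h.symm
      rw [← D.map_zero] at this
      exact absurd (hD this) hτ0
  refine ⟨by linarith, ?_⟩
  have hAsymm : ∀ v w, metric (D (A v)) (D w) = metric (D v) (D (A w)) := by
    have h : ∀ v w, metric (D (A v)) (D w) = -metric (Dξ v) (D w) := by
      intro v w
      have h1 : D (A v) = -tangentProj p (Dξ v) := by rw [hA]; simp
      rw [h1, metric_neg_left, tangentProj_eq, metric_add_left, metric_smul_left,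
        metric_hypPart_left, hpD]
      ring
    intro v w
    rw [h, hsymm, ← h, metric_comm]
  -- The expected operator is φ ⊗ T - κ id, where φ is 2κ times the coordinate along T; B is the
  -- difference.
  let φ : V →ₗ[ℝ] ℝ := (2 * κ / (1 - ξ 3 ^ 2)) • (LinearMap.proj 3 ∘ₗ D)
  have hφ : ∀ v, φ v = 2 * κ * D v 3 / (1 - ξ 3 ^ 2) := fun v => by
    change 2 * κ / (1 - ξ 3 ^ 2) * D v 3 = _; ring
  let B : Module.End ℝ V := A + κ • LinearMap.id - φ.smulRight τ
  have hB : ∀ v, B v = A v + κ • v - φ v • τ := fun v => rfl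
  have hBτ : B τ = 0 := by
    have : φ τ = 2 * κ := by rw [hφ, hDτ3]; field_simp
    rw [hB, hκ, this]; module
  have hBtr : LinearMap.trace ℝ V B = 0 := by
    have : φ τ = 2 * κ := by rw [hφ, hDτ3]; field_simp
    simp only [B]
    rw [map_sub, map_add, map_smul, htr, LinearMap.trace_id, hV, LinearMap.trace_smulRight, this]
    simp; ring
  have hBsymm : ∀ v w, metric (D (B v)) (D w) = metric (D v) (D (B w)) := by
    intro v w
    rw [hB, hB]
    simp only [map_add, map_sub, map_smul, metric_add_left, metric_sub_left, metric_smul_left,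
      metric_add_right, metric_sub_right, metric_smul_right, hAsymm, hτv, metric_comm _ (D τ), hφ]
    ring
  have hB0 : ∀ v, B v = 0 := by
    intro v
    have h1 : metric (D (B v)) (D (B v)) = 0 := by
      rw [hBsymm, comp_self_eq_zero_of_trace_eq_zero hV B hBtr hτ0 hBτ, map_zero]
      simp [metric, lorentz]
    have := metric_self_eq_zero hpp (hpD _) h1
    rw [← D.map_zero] at this
    exact hD this
  intro v
  have h1 := hA v
  have h2 : A v = φ v • τ - κ • v := by
    have := hB0 v
    rw [hB] at this
    rw [← sub_eq_zero, ← this]; abel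
  have h3 : lorentz ξ (D v) = -(ξ 3 * D v 3) := by
    have := hξD v
    simp only [metric] at this; linarith
  rw [tangentProj_eq, hpDξ, h3, h2, map_sub, map_smul, map_smul, hDτ, hφ] at h1
  rw [← sub_eq_zero] at h1 ⊢
  rw [← h1]; module

theorem shape_of_isMinimalPrincipal (hV : Module.finrank ℝ V = 2) {p ξ : E4} (hp : p ∈ ambient)
    (D Dξ : V →ₗ[ℝ] E4) (hD : Function.Injective D) (hpD : ∀ v, lorentz p (D v) = 0)
    (hpξ : lorentz p ξ = 0) (hξ : metric ξ ξ = 1) (hξD : ∀ v, metric ξ (D v) = 0)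
    (h1 : ξ 3 ^ 2 < 1) {κ : ℝ} (h : IsMinimalPrincipal p ξ D Dξ κ) :
    ∃ A : Module.End ℝ V, (∀ v, tangentProj p (Dξ v) = -D (A v)) ∧ LinearMap.trace ℝ V A = 0 ∧
      ∃ τ : V, dt = D τ + ξ 3 • ξ ∧ τ ≠ 0 ∧ A τ = κ • τ := by
  have hne : 1 - ξ 3 ^ 2 ≠ 0 := by linarith
  obtain ⟨τ, hτ⟩ := mem_range_of_normal hV hp D hD hpD hpξ hξ hξD (w := dt - ξ 3 • ξ)
    (by simp only [lorentz, Pi.sub_apply, Pi.smul_apply, dt_zero, dt_one, dt_two, smul_eq_mul]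
        simp only [lorentz] at hpξ
        linear_combination (-ξ 3) * hpξ)
    (by rw [metric_sub_right, metric_smul_right, hξ, metric_dt_right]; ring)
  have hτ3 : D τ 3 = 1 - ξ 3 ^ 2 := by rw [hτ]; simp; ring
  let φ : V →ₗ[ℝ] ℝ := (2 * κ / (1 - ξ 3 ^ 2)) • (LinearMap.proj 3 ∘ₗ D)
  have hφ : ∀ v, φ v = 2 * κ * D v 3 / (1 - ξ 3 ^ 2) := fun v => by
    change 2 * κ / (1 - ξ 3 ^ 2) * D v 3 = _; ring
  have hφτ : φ τ = 2 * κ := by rw [hφ, hτ3]; field_simp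
  refine ⟨φ.smulRight τ - κ • LinearMap.id, fun v => ?_, ?_, τ, by rw [hτ]; abel, ?_, ?_⟩
  · have h2 : lorentz p (Dξ v) = ξ 3 * D v 3 := by
      have h4 : lorentz p (dt - ξ 3 • ξ) = 0 := by rw [← hτ, hpD]
      have e : Dξ v = κ • D v + (-(2 * κ * D v 3 / (1 - ξ 3 ^ 2))) • (dt - ξ 3 • ξ) +
          (-(ξ 3 * D v 3)) • hypPart p := by rw [h v]; module
      rw [e, lorentz_add_right, lorentz_add_right, lorentz_smul_right, lorentz_smul_right,
        lorentz_smul_right, h4, hpD, lorentz_hypPart_right, hp.1]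
      ring
    have h5 : (φ.smulRight τ - κ • LinearMap.id : Module.End ℝ V) v = φ v • τ - κ • v := rfl
    rw [tangentProj_eq, h2, h v, h5, map_sub, map_smul, map_smul, hτ, hφ]
    module
  · rw [map_sub, map_smul, LinearMap.trace_id, hV, LinearMap.trace_smulRight, hφτ]
    simp; ring
  · rintro rfl
    rw [map_zero] at hτ3
    exact hne hτ3.symm
  · change φ τ • τ - κ • τ = _
    rw [hφτ]; module

end LinearAlgebra

/-! ### Immersed surfaces in local coordinates -/

section Chart

/-- An immersed surface with unit normal field, in local coordinates. -/
structure IsPatch (U : Set E2) (f ξ : E2 → E4) : Prop where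
  isOpen : IsOpen U
  smooth : ContDiffOn ℝ ∞ f U
  smooth_normal : ContDiffOn ℝ ∞ ξ U
  mem : ∀ z ∈ U, f z ∈ ambient
  immersion : ∀ z ∈ U, ∀ w, dirDeriv w f z = 0 → w = 0
  tangent : ∀ z ∈ U, lorentz (f z) (ξ z) = 0
  unit : ∀ z ∈ U, metric (ξ z) (ξ z) = 1
  normal : ∀ z ∈ U, ∀ w, metric (ξ z) (dirDeriv w f z) = 0

theorem IsPatch.mono {U U' : Set E2} {f ξ : E2 → E4} (h : IsPatch U f ξ) (hU' : IsOpen U')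
    (hsub : U' ⊆ U) : IsPatch U' f ξ where
  isOpen := hU'
  smooth := h.smooth.mono hsub
  smooth_normal := h.smooth_normal.mono hsub
  mem z hz := h.mem z (hsub hz)
  immersion z hz := h.immersion z (hsub hz)
  tangent z hz := h.tangent z (hsub hz)
  unit z hz := h.unit z (hsub hz)
  normal z hz := h.normal z (hsub hz)

theorem IsPatch.lorentz_dirDeriv {U : Set E2} {f ξ : E2 → E4} (h : IsPatch U f ξ) {z : E2}
    (hz : z ∈ U) (w : E2) : lorentz (f z) (dirDeriv w f z) = 0 :=
  lorentz_dirDeriv_self h.isOpen h.smooth (fun x hx => (h.mem x hx).1) hz w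

theorem IsPatch.lorentz_dirDeriv_normal {U : Set E2} {f ξ : E2 → E4} (h : IsPatch U f ξ) {z : E2}
    (hz : z ∈ U) (w : E2) :
    lorentz (f z) (dirDeriv w ξ z) = -lorentz (ξ z) (dirDeriv w f z) := by
  have h1 := dirDeriv_lorentz (h.smooth.diffAt h.isOpen hz) (h.smooth_normal.diffAt h.isOpen hz) w
  rw [dirDeriv_congr h.isOpen (g := fun _ => (0 : ℝ)) h.tangent hz, dirDeriv_const,
    lorentz_comm _ (ξ z)] at h1
  linarith

/-- Differentiating ⟨ξ, ∂f⟩ = 0 expresses both sides through mixed second derivatives of f. -/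
theorem IsPatch.symm {U : Set E2} {f ξ : E2 → E4} (h : IsPatch U f ξ) {z : E2}
    (hz : z ∈ U) (v w : E2) :
    metric (dirDeriv v ξ z) (dirDeriv w f z) = metric (dirDeriv w ξ z) (dirDeriv v f z) := by
  have key : ∀ v w, metric (dirDeriv v ξ z) (dirDeriv w f z) +
      metric (ξ z) (dirDeriv v (dirDeriv w f) z) = 0 := by
    intro v w
    rw [← dirDeriv_metric (h.smooth_normal.diffAt h.isOpen hz)
      ((h.smooth.dirDeriv h.isOpen w).diffAt h.isOpen hz),
      dirDeriv_congr h.isOpen (g := fun _ => (0 : ℝ)) (fun x hx => h.normal x hx w) hz,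
      dirDeriv_const]
  have h1 := key v w
  have h2 := key w v
  rw [dirDeriv_comm h.isOpen h.smooth hz] at h1
  linarith

/-- The bound that makes `Real.cos` invert `Real.arccos` at ν, so that cos θ = ν. -/
theorem IsPatch.sq_le {U : Set E2} {f ξ : E2 → E4} (h : IsPatch U f ξ) {z : E2}
    (hz : z ∈ U) : ξ z 3 ^ 2 ≤ 1 := by
  have h1 := (lorentz_self_pos (by rw [(h.mem z hz).1]; norm_num) (h.tangent z hz)).1
  have h2 := h.unit z hz
  rw [metric] at h2
  nlinarith

end Chart

/-! ### Passage from the manifold to a chart -/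

section Surface

variable {M : Type*} [TopologicalSpace M] [ChartedSpace E2 M] [IsManifold 𝓘(ℝ, E2) ∞ M]

theorem contDiffOn_comp_chart_symm {V : M → E4} (hV : ContMDiff 𝓘(ℝ, E2) 𝓘(ℝ, E4) ∞ V) (p : M) :
    ContDiffOn ℝ ∞ (fun z => V ((chartAt E2 p).symm z)) (chartAt E2 p).target := by
  rw [← contMDiffOn_iff_contDiffOn]
  exact hV.comp_contMDiffOn contMDiffOn_chart_symm

/-- The isomorphism is chosen before V, so the differentials of F and ξ are transported by the same
one. -/
theorem exists_dirDeriv_eq_diff (p : M) {z : E2} (hz : z ∈ (chartAt E2 p).target) :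
    ∃ B : E2 ≃ₗ[ℝ] TangentSpace 𝓘(ℝ, E2) ((chartAt E2 p).symm z), ∀ V : M → E4,
      ContMDiff 𝓘(ℝ, E2) 𝓘(ℝ, E4) ∞ V → ∀ w,
        dirDeriv w (fun z => V ((chartAt E2 p).symm z)) z =
          diff V ((chartAt E2 p).symm z) (B w) := by
  have : IsManifold 𝓘(ℝ, E2) 1 M := IsManifold.of_le (n := ∞) (by simp)
  have he := mdifferentiable_chart (I := 𝓘(ℝ, E2)) p
  refine ⟨(he.symm.mfderiv hz).toLinearEquiv, fun V hV w => ?_⟩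
  have h1 : fderiv ℝ (fun z => V ((chartAt E2 p).symm z)) z =
      mfderiv 𝓘(ℝ, E2) 𝓘(ℝ, E4) (V ∘ (chartAt E2 p).symm) z := by
    rw [mfderiv_eq_fderiv]; rfl
  rw [dirDeriv, h1, mfderiv_comp z ((hV.mdifferentiable (by simp)) _)
    (he.mdifferentiableAt_symm hz)]
  rfl

theorem IsImmersedSurface.isPatch {F ξ : M → E4} (hF : IsImmersedSurface F)
    (hξ : IsUnitNormal F ξ) (p : M) :
    IsPatch (chartAt E2 p).target (fun z => F ((chartAt E2 p).symm z))
      (fun z => ξ ((chartAt E2 p).symm z)) where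
  isOpen := (chartAt E2 p).open_target
  smooth := contDiffOn_comp_chart_symm hF.smooth p
  smooth_normal := contDiffOn_comp_chart_symm hξ.smooth p
  mem z _ := hF.mem _
  immersion z hz w hw := by
    obtain ⟨B, hB⟩ := exists_dirDeriv_eq_diff p hz
    rw [hB F hF.smooth] at hw
    exact B.map_eq_zero_iff.1 (hF.immersion _ (hw.trans (map_zero _).symm))
  tangent z _ := hξ.tangent _
  unit z _ := hξ.unit _
  normal z hz w := by
    obtain ⟨B, hB⟩ := exists_dirDeriv_eq_diff p hz
    rw [hB F hF.smooth]
    exact hξ.normal _ _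

theorem IsUnitNormal.cos_angle {F ξ : M → E4} (hF : IsImmersedSurface F) (hξ : IsUnitNormal F ξ)
    (p : M) : Real.cos (angle ξ p) = ξ p 3 := by
  have h := (hF.isPatch hξ p).sq_le (mem_chart_target E2 p)
  simp only [(chartAt E2 p).left_inv (mem_chart_source E2 p)] at h
  rw [angle, metric_dt_left, Real.cos_arccos] <;> nlinarith

/-- Minimality and principality of `T`, in local coordinates. -/
theorem isMinimal_and_isPrincipalT_iff {F ξ : M → E4} (hF : IsImmersedSurface F)
    (hξ : IsUnitNormal F ξ) (p₀ : M) {z : E2} (hz : z ∈ (chartAt E2 p₀).target) :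
    let q := (chartAt E2 p₀).symm z
    ((∃ A, IsShapeOperator F ξ q A ∧ LinearMap.trace ℝ (TangentSpace 𝓘(ℝ, E2) q) A = 0) ∧
      ∃ A, IsShapeOperator F ξ q A ∧
        ∃ t, IsTangentPart F ξ q t ∧ ∃ κ : ℝ, Module.End.HasEigenvector A κ t) ↔
    (ξ q 3 ^ 2 < 1 ∧ ∃ κ, IsMinimalPrincipal (F q) (ξ q)
      (fun w => dirDeriv w (fun z => F ((chartAt E2 p₀).symm z)) z)
      (fun w => dirDeriv w (fun z => ξ ((chartAt E2 p₀).symm z)) z) κ) := by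
  intro q
  obtain ⟨B, hB⟩ := exists_dirDeriv_eq_diff p₀ hz
  have hP := hF.isPatch hξ p₀
  have hBF := hB F hF.smooth
  have hBξ := hB ξ hξ.smooth
  have hV : Module.finrank ℝ (TangentSpace 𝓘(ℝ, E2) q) = 2 := by
    rw [← B.finrank_eq]; simp
  have hfd : FiniteDimensional ℝ (TangentSpace 𝓘(ℝ, E2) q) :=
    Module.finite_of_finrank_pos (by rw [hV]; norm_num)
  have hpD : ∀ v, lorentz (F q) (diff F q v) = 0 := by
    intro v
    obtain ⟨w, rfl⟩ := B.surjective v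
    rw [← hBF]; exact hP.lorentz_dirDeriv hz w
  have hpDξ : ∀ v, lorentz (F q) (diff ξ q v) = -lorentz (ξ q) (diff F q v) := by
    intro v
    obtain ⟨w, rfl⟩ := B.surjective v
    rw [← hBF, ← hBξ]; exact hP.lorentz_dirDeriv_normal hz w
  have hsymm : ∀ v w, metric (diff ξ q v) (diff F q w) = metric (diff ξ q w) (diff F q v) := by
    intro v w
    obtain ⟨v, rfl⟩ := B.surjective v
    obtain ⟨w, rfl⟩ := B.surjective w
    rw [← hBF, ← hBξ, ← hBF, ← hBξ]; exact hP.symm hz v w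
  have hiff : ∀ κ, IsMinimalPrincipal (F q) (ξ q)
      (fun w => dirDeriv w (fun z => F ((chartAt E2 p₀).symm z)) z)
      (fun w => dirDeriv w (fun z => ξ ((chartAt E2 p₀).symm z)) z) κ ↔
      IsMinimalPrincipal (F q) (ξ q) (diff F q) (diff ξ q) κ := by
    intro κ
    simp only [IsMinimalPrincipal, hBF, hBξ]
    exact B.surjective.forall (p := fun v => diff ξ q v = κ • diff F q v -
      (2 * κ * diff F q v 3 / (1 - ξ q 3 ^ 2)) • (dt - ξ q 3 • ξ q) -
      (ξ q 3 * diff F q v 3) • hypPart (F q)) |>.symm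
  simp only [hiff]
  have hcos := hξ.cos_angle hF q
  constructor
  · rintro ⟨⟨A, hA, htr⟩, A', hA', τ, hτ, κ, hκ⟩
    have hAA : A' = A := by
      ext1 v
      exact hF.immersion q (neg_injective ((hA' v).symm.trans (hA v)))
    subst hAA
    rw [IsTangentPart, hcos] at hτ
    obtain ⟨h1, h2⟩ := isMinimalPrincipal_of_shape hV (hF.mem q) (diff F q).toLinearMap
      (diff ξ q).toLinearMap (hF.immersion q) hpD (hξ.normal q) hpDξ hsymm A' hA htr
      hκ.2 hτ hκ.apply_eq_smul
    exact ⟨h1, κ, h2⟩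
  · rintro ⟨h1, κ, h2⟩
    obtain ⟨A, hA, htr, τ, hτ, hτ0, hκ⟩ := shape_of_isMinimalPrincipal hV (hF.mem q)
      (diff F q).toLinearMap (diff ξ q).toLinearMap (hF.immersion q) hpD (hξ.tangent q)
      (hξ.unit q) (hξ.normal q) h1 h2
    refine ⟨⟨A, hA, htr⟩, A, hA, τ, ?_, κ, ?_⟩
    · rw [IsTangentPart, hcos]; exact hτ
    · exact ⟨Module.End.mem_eigenspace_iff.2 hκ, hτ0⟩

end Surface

/-! ### The profile functions a, b, χ -/

section Profile

variable (c₁ c₂ x : ℝ)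

theorem hasDerivAt_a : HasDerivAt (a c₁ c₂) (c₁ * Real.sinh x + c₂ * Real.cosh x) x :=
  ((Real.hasDerivAt_cosh x).const_mul c₁).add ((Real.hasDerivAt_sinh x).const_mul c₂)

theorem b_eq : b c₁ c₂ x = c₁ * Real.sinh x + c₂ * Real.cosh x := (hasDerivAt_a c₁ c₂ x).deriv

theorem hasDerivAt_a_b : HasDerivAt (a c₁ c₂) (b c₁ c₂ x) x := by
  rw [b_eq]; exact hasDerivAt_a c₁ c₂ x

theorem hasDerivAt_b : HasDerivAt (b c₁ c₂) (a c₁ c₂ x) x := by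
  have h : b c₁ c₂ = fun x => c₁ * Real.sinh x + c₂ * Real.cosh x := funext (b_eq c₁ c₂)
  rw [h]
  exact ((Real.hasDerivAt_sinh x).const_mul c₁).add ((Real.hasDerivAt_cosh x).const_mul c₂)

theorem a_sq_sub_b_sq : a c₁ c₂ x ^ 2 - b c₁ c₂ x ^ 2 = c₁ ^ 2 - c₂ ^ 2 := by
  rw [a, b_eq]
  linear_combination (c₁ ^ 2 - c₂ ^ 2) * Real.cosh_sq_sub_sinh_sq x

theorem contDiff_a : ContDiff ℝ ∞ (a c₁ c₂) := by
  unfold a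
  exact (contDiff_const.mul Real.contDiff_cosh).add (contDiff_const.mul Real.contDiff_sinh)

theorem contDiff_b : ContDiff ℝ ∞ (b c₁ c₂) := by
  rw [show b c₁ c₂ = fun x => c₁ * Real.sinh x + c₂ * Real.cosh x from funext (b_eq c₁ c₂)]
  exact (contDiff_const.mul Real.contDiff_sinh).add (contDiff_const.mul Real.contDiff_cosh)

theorem hasDerivAt_chi : HasDerivAt (chi c₁ c₂) (1 / Real.sqrt (a c₁ c₂ x ^ 2 + 1)) x := by
  have hc : Continuous fun τ => 1 / Real.sqrt (a c₁ c₂ τ ^ 2 + 1) := by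
    refine continuous_const.div ?_ fun τ => by positivity
    exact (((contDiff_a c₁ c₂).continuous.pow 2).add continuous_const).sqrt
  exact intervalIntegral.integral_hasDerivAt_right (hc.intervalIntegrable _ _)
    hc.aestronglyMeasurable.stronglyMeasurableAtFilter hc.continuousAt

/-- In the three models the coordinate `x` is determined by a linear functional. -/
theorem exists_lorentz_model {c₁ c₂ : ℝ} {S : Set E2} {g : E2 → E4}
    (h : (0 < 1 + c₁ ^ 2 - c₂ ^ 2 ∧ ∀ q ∈ S, g q = modelPos c₁ c₂ (q 0) (q 1)) ∨
      (1 + c₁ ^ 2 - c₂ ^ 2 < 0 ∧ ∀ q ∈ S, g q = modelNeg c₁ c₂ (q 0) (q 1)) ∨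
      (1 + c₁ ^ 2 - c₂ ^ 2 = 0 ∧ ∀ q ∈ S, g q = modelZero c₁ c₂ (q 0) (q 1))) :
    ∃ W, lorentz W W = 1 + c₁ ^ 2 - c₂ ^ 2 ∧
      ∀ q ∈ S, lorentz (g q) W = b c₁ c₂ (q 0) ∧ g q 3 = chi c₁ c₂ (q 0) := by
  rcases h with ⟨h, hg⟩ | ⟨h, hg⟩ | ⟨h, hg⟩
  · have hk := Real.sqrt_pos.2 h
    refine ⟨![Real.sqrt (1 + c₁ ^ 2 - c₂ ^ 2), 0, 0, 0], ?_, fun q hq => ?_⟩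
    · simp [lorentz, Real.mul_self_sqrt h.le]
    · rw [hg q hq]
      simp [lorentz, modelPos]
      field_simp
  · have hk : 0 < Real.sqrt (c₂ ^ 2 - c₁ ^ 2 - 1) := Real.sqrt_pos.2 (by linarith)
    refine ⟨![0, 0, -Real.sqrt (c₂ ^ 2 - c₁ ^ 2 - 1), 0], ?_, fun q hq => ?_⟩
    · simp [lorentz]
      rw [Real.mul_self_sqrt (by linarith)]; ring
    · rw [hg q hq]
      simp [lorentz, modelNeg]
      field_simp
  · refine ⟨![0, 1, -1, 0], by simp [lorentz, h], fun q hq => ?_⟩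
    rw [hg q hq]
    simp [lorentz, modelZero]
    ring

end Profile

theorem dirDeriv_comp {E : Type*} [NormedAddCommGroup E] [NormedSpace ℝ E] {g : ℝ → ℝ} {g' : ℝ}
    {x : E → ℝ} {z : E} (hg : HasDerivAt g g' (x z)) (hx : DifferentiableAt ℝ x z) (u : E) :
    dirDeriv u (fun z => g (x z)) z = g' * dirDeriv u x z := by
  have := (hg.comp_hasFDerivAt z hx.hasFDerivAt).fderiv
  simp only [dirDeriv]
  change fderiv ℝ (g ∘ x) z u = _
  rw [this]; simp

/-! ### From the linear relation with W to the shape operator -/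

section Patch

variable {U : Set E2} {f ξ : E2 → E4}

/-- Removing the ξ-component of n leaves a vector that is both tangent to the surface and orthogonal
to it, hence zero. -/
theorem IsPatch.eq_smul_normal (h : IsPatch U f ξ) {z : E2} (hz : z ∈ U) {n : E4}
    (hn : lorentz (f z) n = 0) (hn' : ∀ w, metric n (dirDeriv w f z) = 0) :
    n = metric n (ξ z) • ξ z := by
  have hV : Module.finrank ℝ E2 = 2 := by simp
  set m := n - metric n (ξ z) • ξ z with hm
  have h1 : lorentz (f z) m = 0 := by
    have e : m = n + (-metric n (ξ z)) • ξ z := by rw [hm]; module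
    rw [e, lorentz_add_right, lorentz_smul_right, hn, h.tangent z hz]; ring
  have h2 : metric (ξ z) m = 0 := by
    rw [hm, metric_sub_right, metric_smul_right, h.unit z hz, metric_comm]; ring
  obtain ⟨v, hv⟩ := mem_range_of_normal hV (h.mem z hz) (fderiv ℝ f z).toLinearMap
    ((injective_iff_map_eq_zero _).2 fun w hw => h.immersion z hz w hw) (h.lorentz_dirDeriv hz)
    (h.tangent z hz) (h.unit z hz) (h.normal z hz) h1 h2
  have h3 : metric m m = 0 := by
    nth_rw 2 [← hv]
    change metric m (dirDeriv v f z) = 0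
    rw [hm, metric_sub_left, metric_smul_left, hn', h.normal z hz]; ring
  have h4 := metric_self_eq_zero (by rw [(h.mem z hz).1]; norm_num) h1 h3
  rw [hm] at h4
  exact sub_eq_zero.1 h4

/-- The coordinate y plays no role. With s = √(a² + 1), the hypotheses give d⟨f, W⟩ = a dx and ε dt
= dx/s, so ε a s ∂_t - (W + b f), horizontal parts understood, is normal. Its square is s⁴ because
⟨W, W⟩ = s² - b². Dividing by s² gives a unit normal n; ξ = σn with σ² = 1 and dσ = 0, and
differentiating n gives κ = -σb/s². -/
theorem IsPatch.of_model (h : IsPatch U f ξ) {x : E2 → ℝ} (hx : ContDiffOn ℝ ∞ x U)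
    {c₁ c₂ ε c : ℝ} (hε : ε = 1 ∨ ε = -1) {W : E4} (hW : lorentz W W = 1 + c₁ ^ 2 - c₂ ^ 2)
    (hfW : ∀ z ∈ U, lorentz (f z) W = b c₁ c₂ (x z))
    (ht : ∀ z ∈ U, ε * f z 3 + c = chi c₁ c₂ (x z)) {z : E2} (hz : z ∈ U) :
    (∃ σ : ℝ, (σ = 1 ∨ σ = -1) ∧
      ξ z 3 = σ * (a c₁ c₂ (x z) / Real.sqrt (a c₁ c₂ (x z) ^ 2 + 1))) ∧
    ∃ κ, IsMinimalPrincipal (f z) (ξ z) (fun w => dirDeriv w f z) (fun w => dirDeriv w ξ z) κ := by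
  set A : E2 → ℝ := fun z => a c₁ c₂ (x z) with hA
  set B : E2 → ℝ := fun z => b c₁ c₂ (x z) with hB
  set s : E2 → ℝ := fun z => Real.sqrt (A z ^ 2 + 1) with hs
  have hs2 : ∀ z, s z ^ 2 = A z ^ 2 + 1 := fun z => Real.sq_sqrt (by positivity)
  have hs0 : ∀ z, 0 < s z := fun z => Real.sqrt_pos.2 (by positivity)
  have hAs : ContDiffOn ℝ ∞ A U := (contDiff_a c₁ c₂).comp_contDiffOn hx
  have hBs : ContDiffOn ℝ ∞ B U := (contDiff_b c₁ c₂).comp_contDiffOn hx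
  have hss : ContDiffOn ℝ ∞ s U :=
    ((hAs.pow 2).add contDiffOn_const).sqrt fun z _ => by positivity
  have hUo := h.isOpen
  have hdA : ∀ z ∈ U, ∀ w, dirDeriv w A z = B z * dirDeriv w x z := fun z hz w =>
    dirDeriv_comp (hasDerivAt_a_b c₁ c₂ (x z)) (hx.diffAt hUo hz) w
  have hdB : ∀ z ∈ U, ∀ w, dirDeriv w B z = A z * dirDeriv w x z := fun z hz w =>
    dirDeriv_comp (hasDerivAt_b c₁ c₂ (x z)) (hx.diffAt hUo hz) w
  have hds : ∀ z ∈ U, ∀ w, s z * dirDeriv w s z = A z * B z * dirDeriv w x z := by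
    intro z hz w
    have h1 := dirDeriv_mul (hss.diffAt hUo hz) (hss.diffAt hUo hz) w
    have h2 : (fun z => s z * s z) = fun z => A z * A z + 1 := by
      ext1 y; have := hs2 y; linear_combination this
    rw [h2, dirDeriv_add ((hAs.diffAt hUo hz).fun_mul (hAs.diffAt hUo hz))
      (differentiableAt_const _), dirDeriv_mul (hAs.diffAt hUo hz) (hAs.diffAt hUo hz),
      dirDeriv_const, hdA z hz] at h1
    linarith
  have hεε : ε * ε = 1 := by rcases hε with rfl | rfl <;> norm_num
  have hdf3 : ∀ z ∈ U, ∀ w, dirDeriv w f z 3 = ε * (dirDeriv w x z / s z) := by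
    intro z hz w
    have hd := diffAt_apply (h.smooth.diffAt hUo hz) 3
    have h1 := dirDeriv_congr hUo ht hz w
    rw [dirDeriv_comp (hasDerivAt_chi c₁ c₂ (x z)) (hx.diffAt hUo hz),
      dirDeriv_add ((differentiableAt_const _).fun_mul hd) (differentiableAt_const _),
      dirDeriv_mul (differentiableAt_const _) hd, dirDeriv_const, dirDeriv_const,
      dirDeriv_apply (h.smooth.diffAt hUo hz)] at h1
    change _ = 1 / s z * _ at h1
    linear_combination ε * h1 - dirDeriv w f z 3 * hεε
  have hdfW : ∀ z ∈ U, ∀ w, lorentz (dirDeriv w f z) W = A z * dirDeriv w x z := by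
    intro z hz w
    have h1 := dirDeriv_lorentz (h.smooth.diffAt hUo hz) (differentiableAt_const W) w
    rw [dirDeriv_congr hUo (g := B) hfW hz, hdB z hz, dirDeriv_const] at h1
    rw [h1]; simp [lorentz]
  -- the explicit unit normal
  set n : E2 → E4 := fun z => (ε * (A z / s z)) • dt -
    (1 / s z ^ 2) • (hypPart W + B z • hypPart (f z)) with hn
  have hn1 : ContDiffOn ℝ ∞ (fun z => ε * (A z / s z)) U :=
    contDiffOn_const.mul (hAs.div hss fun z _ => (hs0 z).ne')
  have hn2 : ContDiffOn ℝ ∞ (fun z => 1 / s z ^ 2) U :=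
    contDiffOn_const.div (hss.pow 2) fun z _ => (pow_pos (hs0 z) 2).ne'
  have hn3 : ContDiffOn ℝ ∞ (fun z => B z • hypPart (f z)) U := hBs.smul h.smooth.hypPart
  have hn4 : ContDiffOn ℝ ∞ (fun z => hypPart W + B z • hypPart (f z)) U :=
    contDiffOn_const.add hn3
  have hn5 : ContDiffOn ℝ ∞ (fun z => (ε * (A z / s z)) • dt) U := hn1.smul contDiffOn_const
  have hn6 : ContDiffOn ℝ ∞ (fun z => (1 / s z ^ 2) • (hypPart W + B z • hypPart (f z))) U :=
    hn2.smul hn4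
  have hns : ContDiffOn ℝ ∞ n U := hn5.sub hn6
  have hn_three : ∀ z, n z 3 = ε * (A z / s z) := fun z => by simp [hn]
  have hdn : ∀ z ∈ U, ∀ w, dirDeriv w n z = (ε * (B z / s z ^ 3 * dirDeriv w x z)) • dt +
      (2 * A z * B z / s z ^ 4 * dirDeriv w x z) • (hypPart W + B z • hypPart (f z)) -
      (1 / s z ^ 2) • ((A z * dirDeriv w x z) • hypPart (f z) +
        B z • hypPart (dirDeriv w f z)) := by
    intro z hz w
    have d1 : dirDeriv w (fun z => A z / s z) z = B z / s z ^ 3 * dirDeriv w x z := by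
      have e1 : ContDiffOn ℝ ∞ (fun z => A z / s z) U := hAs.div hss fun z _ => (hs0 z).ne'
      have e2 := dirDeriv_mul (e1.diffAt hUo hz) (hss.diffAt hUo hz) w
      have e3 : (fun z => A z / s z * s z) = A := by
        ext1 y; exact div_mul_cancel₀ _ (hs0 y).ne'
      rw [e3, hdA z hz] at e2
      have e4 := hds z hz w
      have e5 := hs0 z
      have e6 : dirDeriv w s z = A z * B z * dirDeriv w x z / s z := by
        rw [← e4]; field_simp
      have e7 : dirDeriv w (fun z => A z / s z) z =
          (B z * dirDeriv w x z - A z / s z * dirDeriv w s z) / s z := by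
        rw [e2]; field_simp; ring
      rw [e7, e6]
      field_simp
      linear_combination (B z * dirDeriv w x z) * hs2 z
    have d2 : dirDeriv w (fun z => 1 / s z ^ 2) z =
        -(2 * A z * B z / s z ^ 4 * dirDeriv w x z) := by
      have e2 := dirDeriv_mul (hn2.diffAt hUo hz) ((hss.mul hss).diffAt hUo hz) w
      have e3 : (fun z => 1 / s z ^ 2 * (s z * s z)) = fun _ => (1 : ℝ) := by
        ext1 y
        have := (hs0 y).ne'
        field_simp
      have e5 : dirDeriv w (fun z => s z * s z) z = 2 * (A z * B z * dirDeriv w x z) := by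
        rw [← hds z hz w]
        have := dirDeriv_mul (hss.diffAt hUo hz) (hss.diffAt hUo hz) w
        refine Eq.trans this ?_
        ring
      rw [e3, dirDeriv_const, e5] at e2
      have e6 := (hs0 z).ne'
      field_simp at e2 ⊢
      linarith
    have d3 : dirDeriv w (fun z => ε * (A z / s z)) z =
        ε * (B z / s z ^ 3 * dirDeriv w x z) := by
      rw [dirDeriv_mul (f := fun _ => ε) (g := fun z => A z / s z) (differentiableAt_const _)
        ((hAs.div hss fun z _ => (hs0 z).ne').diffAt hUo hz), dirDeriv_const]
      rw [d1]; ring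
    rw [hn, dirDeriv_sub (hn5.diffAt hUo hz) (hn6.diffAt hUo hz),
      dirDeriv_smul (hn1.diffAt hUo hz) (differentiableAt_const _), dirDeriv_const, d3,
      dirDeriv_smul (hn2.diffAt hUo hz) (hn4.diffAt hUo hz), d2,
      dirDeriv_add (differentiableAt_const _) (hn3.diffAt hUo hz), dirDeriv_const,
      dirDeriv_smul (hBs.diffAt hUo hz) (diffAt_hypPart (h.smooth.diffAt hUo hz)), hdB z hz,
      dirDeriv_hypPart (h.smooth.diffAt hUo hz)]
    module
  have hWW : ∀ z, lorentz W W = s z ^ 2 - B z ^ 2 := fun z => by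
    rw [hW, hs2]; have := a_sq_sub_b_sq c₁ c₂ (x z); linarith
  have hnm : ∀ (z : E2) (v : E4), metric (n z) v = ε * (A z / s z) * v 3 -
      1 / s z ^ 2 * (lorentz v W + B z * lorentz (f z) v) := by
    intro z v
    simp only [hn, metric_sub_left, metric_smul_left, metric_add_left, metric_dt_left,
      metric_hypPart_left, lorentz_comm v W]
  have hn_tangent : ∀ z ∈ U, lorentz (f z) (n z) = 0 := by
    intro z hz
    rw [lorentz_comm, ← metric_hypPart_right, hnm, hypPart_three,
      lorentz_hypPart_left, lorentz_hypPart_right, hfW z hz, (h.mem z hz).1]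
    simp only [hB]; ring
  have hn_normal : ∀ z ∈ U, ∀ w, metric (n z) (dirDeriv w f z) = 0 := by
    intro z hz w
    have hs0' := (hs0 z).ne'
    rw [hnm, hdf3 z hz, hdfW z hz, h.lorentz_dirDeriv hz]
    field_simp
    linear_combination (A z * dirDeriv w x z) * hεε
  have hn_unit : ∀ z ∈ U, metric (n z) (n z) = 1 := by
    intro z hz
    have hs0' := (hs0 z).ne'
    have h1 : lorentz (n z) W = -(1 / s z ^ 2) * s z ^ 2 := by
      rw [← metric_hypPart_right, hnm, hypPart_three, lorentz_hypPart_left, lorentz_hypPart_right,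
        hWW z, hfW z hz]
      simp only [hB]; ring
    rw [hnm, hn_three, hn_tangent z hz, h1]
    field_simp
    linear_combination A z ^ 2 * hεε - hs2 z
  set σ : E2 → ℝ := fun z => metric (n z) (ξ z) with hσ
  have hnξ : ∀ z ∈ U, n z = σ z • ξ z := fun z hz =>
    h.eq_smul_normal hz (hn_tangent z hz) (hn_normal z hz)
  have hσσ : ∀ z ∈ U, σ z * σ z = 1 := by
    intro z hz
    have h1 := hn_unit z hz
    rw [hnξ z hz, metric_smul_left, metric_smul_right, h.unit z hz] at h1
    linarith
  have hξn : ∀ z ∈ U, ξ z = σ z • n z := fun z hz => by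
    rw [hnξ z hz, smul_smul, hσσ z hz, one_smul]
  have hσd : DifferentiableAt ℝ σ z := by
    have h1 := hns.diffAt hUo hz
    have h2 := h.smooth_normal.diffAt hUo hz
    exact (diffAt_lorentz h1 h2).add ((diffAt_apply h1 3).mul (diffAt_apply h2 3))
  -- The sign has constant square one and is differentiable, so dξ = σ dn.
  have hdσ : ∀ w, dirDeriv w σ z = 0 := by
    intro w
    have h1 := dirDeriv_mul hσd hσd w
    rw [dirDeriv_congr hUo (g := fun _ => (1 : ℝ)) hσσ hz, dirDeriv_const] at h1
    have h2 : σ z ≠ 0 := fun h0 => by simpa [h0] using hσσ z hz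
    have h3 : σ z * dirDeriv w σ z = 0 := by linarith
    exact (mul_eq_zero.1 h3).resolve_left h2
  have hξ3 : ξ z 3 = σ z * (ε * (A z / s z)) := by
    rw [hξn z hz, Pi.smul_apply, hn_three]; rfl
  refine ⟨⟨σ z * ε, ?_, by rw [hξ3]; ring⟩, -(σ z * (B z / s z ^ 2)), fun w => ?_⟩
  · exact mul_self_eq_one_iff.1 (by linear_combination (ε * ε) * hσσ z hz + hεε)
  have hs0' := (hs0 z).ne'
  have hν : 1 - ξ z 3 ^ 2 = 1 / s z ^ 2 := by
    rw [hξ3]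
    field_simp
    linear_combination hs2 z - A z ^ 2 * hεε - A z ^ 2 * (ε * ε) * hσσ z hz
  have hDξ : dirDeriv w ξ z = σ z • dirDeriv w n z := by
    rw [dirDeriv_congr hUo hξn hz, dirDeriv_smul hσd (hns.diffAt hUo hz), hdσ]
    module
  have hνξ : ξ z 3 • ξ z = (ε * (A z / s z)) • n z := by
    rw [hξ3, hξn z hz, smul_smul]
    congr 1
    linear_combination (ε * (A z / s z)) * hσσ z hz
  have hsplit : hypPart (dirDeriv w f z) =
      dirDeriv w f z - (ε * (dirDeriv w x z / s z)) • dt := by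
    rw [← hdf3 z hz, eq_sub_iff_add_eq, hypPart_add_dt]
  simp only
  rw [hν, hDξ, hνξ, hξ3, hdf3 z hz, hdn z hz, hsplit, hn]
  simp only
  generalize hypPart W + B z • hypPart (f z) = Y
  generalize hypPart (f z) = P
  generalize dirDeriv w f z = Q
  generalize dirDeriv w x z = X
  -- The formula is now an identity between combinations of vectors that may be treated as
  -- independent; the coefficients match by s² = A² + 1 and ε² = 1.
  match_scalars
  · field_simp
    linear_combination (-2 * ε * σ z * B z * X) * hs2 z + (2 * σ z * ε * B z * X * A z ^ 2) * hεε
  · field_simp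
    linear_combination (-σ z * A z * B z * X) * hεε
  · field_simp
    linear_combination (σ z * A z * X) * hεε
  · ring

end Patch

theorem tan_arccos_of_sign {A σ : ℝ} (hσ : σ = 1 ∨ σ = -1) (hA : A ≠ 0) :
    Real.tan (Real.arccos (σ * (A / Real.sqrt (A ^ 2 + 1)))) = σ * (1 / A) := by
  have hs : 0 < Real.sqrt (A ^ 2 + 1) := Real.sqrt_pos.2 (by positivity)
  have hs2 : Real.sqrt (A ^ 2 + 1) ^ 2 = A ^ 2 + 1 := Real.sq_sqrt (by positivity)
  have hσσ : σ * σ = 1 := by rcases hσ with rfl | rfl <;> norm_num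
  have hσ0 : σ ≠ 0 := fun h => by simp [h] at hσσ
  have h1 : 1 - (σ * (A / Real.sqrt (A ^ 2 + 1))) ^ 2 = (1 / Real.sqrt (A ^ 2 + 1)) ^ 2 := by
    field_simp
    linear_combination hs2 - A ^ 2 * hσσ
  rw [Real.tan_arccos, h1, Real.sqrt_sq (by positivity)]
  field_simp
  linear_combination -hσσ

/-! ### Local models satisfy the shape-operator formula -/

section Surface

variable {M : Type*} [TopologicalSpace M] [ChartedSpace E2 M] [IsManifold 𝓘(ℝ, E2) ∞ M]

/-- The isometry is absorbed into the vector W and the constants ε, c. The relations then hold for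
F, so neither the normal nor the shape operator has to be carried through Φ. -/
theorem IsLocallyModel.normal_and_shape {F ξ : M → E4} (hF : IsImmersedSurface F)
    (hξ : IsUnitNormal F ξ) {Φ : E4 → E4} {e : OpenPartialHomeomorph M E2} {c₁ c₂ : ℝ}
    (h : IsLocallyModel F Φ e c₁ c₂) {q : M} (hq : q ∈ e.source) :
    (∃ σ : ℝ, (σ = 1 ∨ σ = -1) ∧
      ξ q 3 = σ * (a c₁ c₂ (e q 0) / Real.sqrt (a c₁ c₂ (e q 0) ^ 2 + 1))) ∧
    ∃ κ, IsMinimalPrincipal (F q) (ξ q)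
      (fun w => dirDeriv w (fun z => F ((chartAt E2 q).symm z)) (chartAt E2 q q))
      (fun w => dirDeriv w (fun z => ξ ((chartAt E2 q).symm z)) (chartAt E2 q q)) κ := by
  set φ := chartAt E2 q with hφ
  obtain ⟨W₀, hW₀, hmodel⟩ := exists_lorentz_model (S := e.target)
    (g := fun y => Φ (F (e.symm y))) (c₁ := c₁) (c₂ := c₂) (by
      refine h.param.imp (fun h => ⟨h.1, fun y hy => ?_⟩) (Or.imp (fun h => ⟨h.1, fun y hy => ?_⟩)
        fun h => ⟨h.1, fun y hy => ?_⟩)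
      all_goals
        rw [h.2 _ (e.map_target hy), e.right_inv hy])
  obtain ⟨W, hW, hWΦ⟩ := h.isometry.exists_adjoint W₀
  obtain ⟨ε, c, hε, hεc⟩ := h.isometry.exists_height
  have hkey : ∀ p ∈ e.source, lorentz (F p) W = b c₁ c₂ (e p 0) ∧
      ε * F p 3 + c = chi c₁ c₂ (e p 0) := by
    intro p hp
    obtain ⟨h1, h2⟩ := hmodel _ (e.map_source hp)
    simp only [e.left_inv hp] at h1 h2
    rw [hWΦ _ (hF.mem p)] at h1
    have h3 := hεc _ (ambient_subset_cone (hF.mem p))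
    rw [radial_of_mem (hF.mem p), h2] at h3
    exact ⟨h1, h3.symm⟩
  have hUo : IsOpen (φ.target ∩ φ.symm ⁻¹' e.source) :=
    φ.symm.isOpen_inter_preimage e.open_source
  have hP := (hF.isPatch hξ q).mono hUo Set.inter_subset_left
  have hx : ContDiffOn ℝ ∞ (fun z => e (φ.symm z) 0) (φ.target ∩ φ.symm ⁻¹' e.source) := by
    have h1 : ContDiffOn ℝ ∞ (fun z => e (φ.symm z)) (φ.target ∩ φ.symm ⁻¹' e.source) := by
      rw [← contMDiffOn_iff_contDiffOn]
      exact (contMDiffOn_of_mem_maximalAtlas h.chart).comp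
        ((contMDiffOn_chart_symm (I := 𝓘(ℝ, E2)) (n := ∞) (x := q)).mono Set.inter_subset_left)
        fun z hz => hz.2
    exact (contDiffOn_euclidean.1 h1) 0
  have hsymm : φ.symm (φ q) = q := φ.left_inv (mem_chart_source E2 q)
  have hz : φ q ∈ φ.target ∩ φ.symm ⁻¹' e.source :=
    ⟨mem_chart_target E2 q, by rw [Set.mem_preimage, hsymm]; exact hq⟩
  have := hP.of_model hx (mul_self_eq_one_iff.1 hε) (hW.trans hW₀)
    (fun z hz => (hkey _ hz.2).1) (fun z hz => (hkey _ hz.2).2) hz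
  rwa [hsymm] at this

end Surface

/-! ### The constant vector attached to a minimal surface with principal T -/

section Potential

variable {U : Set E2} {f ξ : E2 → E4}

theorem IsPatch.lorentz_normal_dirDeriv (h : IsPatch U f ξ) {z : E2} (hz : z ∈ U) (w : E2) :
    lorentz (ξ z) (dirDeriv w f z) = -(ξ z 3 * dirDeriv w f z 3) := by
  have := h.normal z hz w
  simp only [metric] at this; linarith

/-- If ν ≠ 0 the tangent plane does not contain ∂_t, so the surface projects to ℍ² with differential
of rank two. -/
theorem IsPatch.eq_zero_of_hypPart (h : IsPatch U f ξ) {z : E2} (hz : z ∈ U)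
    (hν : ξ z 3 ≠ 0) {w : E2} (hw : hypPart (dirDeriv w f z) = 0) : w = 0 := by
  refine h.immersion z hz w ?_
  have h1 := h.lorentz_normal_dirDeriv hz w
  rw [← lorentz_hypPart_right, hw] at h1
  have h2 : dirDeriv w f z 3 = 0 := by
    simpa [lorentz, hν] using h1
  rw [← hypPart_add_dt (dirDeriv w f z), hw, h2]
  simp

/-- A differential form `λ` such that `λ f` is closed on `ℍ²` vanishes. -/
theorem IsPatch.coefficient_eq_zero (h : IsPatch U f ξ) (hν : ∀ z ∈ U, ξ z 3 ≠ 0) {W : E2 → E4}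
    (hW : ContDiffOn ℝ ∞ W U) {l : E2 → E2 → ℝ}
    (hl : ∀ z ∈ U, ∀ w, dirDeriv w W z = l w z • hypPart (f z)) {z : E2} (hz : z ∈ U) (w : E2) :
    l w z = 0 := by
  have hl' : ∀ w, ∀ z ∈ U, l w z = 0 - lorentz (dirDeriv w W z) (f z) := by
    intro w z hz
    rw [hl z hz, lorentz_smul_left, lorentz_hypPart_left, (h.mem z hz).1]; ring
  have hls : ∀ w, ContDiffOn ℝ ∞ (l w) U := fun w =>
    ((contDiffOn_const (c := (0 : ℝ))).sub ((hW.dirDeriv h.isOpen w).lorentz h.smooth)).congr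
      (hl' w)
  have hfd := h.smooth.diffAt h.isOpen hz
  have hsnd : ∀ u w, dirDeriv u (dirDeriv w W) z =
      dirDeriv u (l w) z • hypPart (f z) + l w z • hypPart (dirDeriv u f z) := by
    intro u w
    rw [dirDeriv_congr h.isOpen (fun z hz => hl z hz w) hz,
      dirDeriv_smul ((hls w).diffAt h.isOpen hz) (diffAt_hypPart hfd), dirDeriv_hypPart hfd]
  -- Symmetry of the second derivatives of W. The component along f says that l is closed; what
  -- remains is l ∧ df = 0.
  have hsymm : ∀ u w, l w z • hypPart (dirDeriv u f z) = l u z • hypPart (dirDeriv w f z) := by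
    intro u w
    have h1 := dirDeriv_comm h.isOpen hW hz u w
    rw [hsnd, hsnd] at h1
    have h2 : dirDeriv u (l w) z = dirDeriv w (l u) z := by
      have h3 := congrArg (lorentz (f z)) h1
      simp only [lorentz_add_right, lorentz_smul_right, lorentz_hypPart_right,
        h.lorentz_dirDeriv hz, (h.mem z hz).1] at h3
      linarith
    rw [h2] at h1
    exact add_left_cancel h1
  by_contra hne
  -- A nonzero value of l would make every vector of the plane a multiple of w.
  have hprop : ∀ u : E2, u = (l u z / l w z) • w := by
    intro u
    rw [← sub_eq_zero]
    refine h.eq_zero_of_hypPart hz (hν z hz) ?_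
    have h1 : dirDeriv (u - (l u z / l w z) • w) f z =
        dirDeriv u f z - (l u z / l w z) • dirDeriv w f z := by
      simp [dirDeriv]
    have h2 : hypPart (dirDeriv u f z - (l u z / l w z) • dirDeriv w f z) =
        hypPart (dirDeriv u f z) - (l u z / l w z) • hypPart (dirDeriv w f z) := by
      apply ext_E4 <;> simp
    have h3 := congrArg (fun v => (l w z)⁻¹ • v) (hsymm u w)
    simp only [smul_smul, inv_mul_cancel₀ hne, one_smul] at h3
    rw [h1, h2, h3, sub_eq_zero]
    congr 1
    field_simp
  have h0 := hprop (EuclideanSpace.single 0 1)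
  have h1 := hprop (EuclideanSpace.single 1 1)
  have e1 := congrArg (fun v : E2 => v 0) h0
  have e2 := congrArg (fun v : E2 => v 1) h0
  have e3 := congrArg (fun v : E2 => v 1) h1
  simp at e1 e2 e3
  rcases e2 with h4 | h4
  · rcases h4 with h4 | h4
    · rw [h4] at e1; simp at e1
    · exact hne h4
  · rw [h4] at e3; simp at e3

/-- A minimal surface with `T` as a principal direction is invariant under the isometries that fix
a vector `W` of `ℝ³₁`. -/
theorem IsPatch.exists_axis (h : IsPatch U f ξ) (hUc : Convex ℝ U) {z₀ : E2} (hz₀ : z₀ ∈ U)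
    (hν : ∀ z ∈ U, ξ z 3 ≠ 0)
    (hmp : ∀ z ∈ U, ξ z 3 ^ 2 < 1 ∧ ∃ κ, IsMinimalPrincipal (f z) (ξ z) (fun w => dirDeriv w f z)
      (fun w => dirDeriv w ξ z) κ) {u : E2} (hu : ∀ z ∈ U, dirDeriv u f z 3 ≠ 0) :
    ∃ (W : E4) (A : E2 → ℝ), ContDiffOn ℝ ∞ A U ∧
      (∀ z ∈ U, A z = ξ z 3 / Real.sqrt (1 - ξ z 3 ^ 2)) ∧
      (∀ z ∈ U, lorentz W W = 1 + A z ^ 2 - lorentz (f z) W ^ 2) ∧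
      (∀ z ∈ U, ∀ w, dirDeriv w A z =
        lorentz (f z) W * Real.sqrt (A z ^ 2 + 1) * dirDeriv w f z 3) ∧
      ∀ z ∈ U, ∀ w, lorentz (dirDeriv w f z) W =
        A z * Real.sqrt (A z ^ 2 + 1) * dirDeriv w f z 3 := by
  have hUo := h.isOpen
  have hf := h.smooth
  have hξ := h.smooth_normal
  have hνs : ContDiffOn ℝ ∞ (fun z => ξ z 3) U := contDiffOn_pi.1 hξ 3
  -- The last component of the formula for dξ is dν = -κ dt. Dividing in a direction along which t
  -- varies shows that the pointwise eigenvalue is smooth.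
  set κ : E2 → ℝ := fun z => -(dirDeriv u ξ z 3) / dirDeriv u f z 3 with hκdef
  have hκs : ContDiffOn ℝ ∞ κ U :=
    (contDiffOn_pi.1 (hξ.dirDeriv hUo u) 3).neg.div (contDiffOn_pi.1 (hf.dirDeriv hUo u) 3) hu
  have hpos : ∀ z ∈ U, 0 < 1 - ξ z 3 ^ 2 := fun z hz => by linarith [(hmp z hz).1]
  have hκ : ∀ z ∈ U, IsMinimalPrincipal (f z) (ξ z) (fun w => dirDeriv w f z)
      (fun w => dirDeriv w ξ z) (κ z) ∧ ∀ w, dirDeriv w ξ z 3 = -(κ z * dirDeriv w f z 3) := by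
    intro z hz
    obtain ⟨κ', hκ'⟩ := (hmp z hz).2
    have h3 : ∀ w, dirDeriv w ξ z 3 = -(κ' * dirDeriv w f z 3) := by
      intro w
      have h1 := congrFun (hκ' w) 3
      have h2 := (hpos z hz).ne'
      simp at h1
      rw [h1]
      field_simp
      ring
    have h4 : κ z = κ' := by
      simp only [hκdef]
      rw [h3 u]
      have := hu z hz
      field_simp
    rw [h4]
    exact ⟨hκ', h3⟩
  set μ : E2 → ℝ := fun z => 1 / (1 - ξ z 3 ^ 2) with hμdef
  have hμs : ContDiffOn ℝ ∞ μ U :=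
    contDiffOn_const.div (contDiffOn_const.sub (hνs.pow 2)) fun z hz => (hpos z hz).ne'
  have hμ1 : ∀ z ∈ U, μ z * (1 - ξ z 3 ^ 2) = 1 := fun z hz =>
    one_div_mul_cancel (hpos z hz).ne'
  have hdμ : ∀ z ∈ U, ∀ w, dirDeriv w μ z =
      -(2 * ξ z 3 * κ z * dirDeriv w f z 3 * μ z ^ 2) := by
    intro z hz w
    have hd := hνs.diffAt hUo hz
    have h1 := dirDeriv_mul (hμs.diffAt hUo hz)
      ((differentiableAt_const (1 : ℝ)).fun_sub (hd.fun_mul hd)) w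
    rw [dirDeriv_congr hUo (g := fun _ => (1 : ℝ))
      (fun z hz => by have := hμ1 z hz; rwa [sq] at this) hz, dirDeriv_const,
      dirDeriv_sub (differentiableAt_const (1 : ℝ)) (hd.fun_mul hd), dirDeriv_const,
      dirDeriv_mul hd hd, dirDeriv_apply (hξ.diffAt hUo hz), (hκ z hz).2 w] at h1
    have h2 := hμ1 z hz
    linear_combination (-μ z) * h1 - dirDeriv w μ z * h2
  -- With μ = 1/(1 - ν²), the df terms and the ξ terms cancel in dW, leaving a multiple of f.
  set W : E2 → E4 := fun z => μ z • (κ z • hypPart (f z) - hypPart (ξ z)) with hWdef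
  have hW1 : ContDiffOn ℝ ∞ (fun z => κ z • hypPart (f z)) U := hκs.smul hf.hypPart
  have hW2 : ContDiffOn ℝ ∞ (fun z => κ z • hypPart (f z) - hypPart (ξ z)) U :=
    hW1.sub hξ.hypPart
  have hWs : ContDiffOn ℝ ∞ W U := hμs.smul hW2
  have hdW : ∀ z ∈ U, ∀ w, dirDeriv w W z = (-(2 * ξ z 3 * κ z ^ 2 * dirDeriv w f z 3 * μ z ^ 2) +
      μ z * dirDeriv w κ z + μ z * ξ z 3 * dirDeriv w f z 3) • hypPart (f z) := by
    intro z hz w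
    have hfd := hf.diffAt hUo hz
    have hξd := hξ.diffAt hUo hz
    have hS : hypPart (dirDeriv w ξ z) = κ z • hypPart (dirDeriv w f z) +
        (2 * κ z * dirDeriv w f z 3 * μ z * ξ z 3) • hypPart (ξ z) -
        (ξ z 3 * dirDeriv w f z 3) • hypPart (f z) := by
      have h1 := (hκ z hz).1 w
      simp only at h1
      rw [h1]
      apply ext_E4 <;> simp [hμdef] <;> ring
    rw [hWdef, dirDeriv_smul (hμs.diffAt hUo hz) (hW2.diffAt hUo hz),
      dirDeriv_sub (hW1.diffAt hUo hz) (diffAt_hypPart hξd),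
      dirDeriv_smul (hκs.diffAt hUo hz) (diffAt_hypPart hfd), dirDeriv_hypPart hfd,
      dirDeriv_hypPart hξd, hS, hdμ z hz]
    module
  have hW0 : ∀ z ∈ U, ∀ w, dirDeriv w W z = 0 := by
    intro z hz w
    rw [hdW z hz, h.coefficient_eq_zero hν hWs (l := fun w z =>
      (-(2 * ξ z 3 * κ z ^ 2 * dirDeriv w f z 3 * μ z ^ 2) +
      μ z * dirDeriv w κ z + μ z * ξ z 3 * dirDeriv w f z 3)) hdW hz w, zero_smul]
  have hWc : ∀ z ∈ U, W z₀ = μ z • (κ z • hypPart (f z) - hypPart (ξ z)) := fun z hz =>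
    eq_of_dirDeriv_eq_zero hUo hUc hWs hW0 hz₀ hz
  have hlW : ∀ z ∈ U, ∀ v, lorentz v (W z₀) = μ z * (κ z * lorentz v (f z) - lorentz v (ξ z)) := by
    intro z hz v
    rw [hWc z hz, lorentz_smul_right]
    congr 1
    simp only [lorentz, Pi.sub_apply, Pi.smul_apply, smul_eq_mul, hypPart_zero, hypPart_one,
      hypPart_two]
    ring
  have hB : ∀ z ∈ U, lorentz (f z) (W z₀) = -(μ z * κ z) := by
    intro z hz
    rw [hlW z hz, (h.mem z hz).1, h.tangent z hz]; ring
  have hξξ : ∀ z ∈ U, lorentz (ξ z) (ξ z) = 1 - ξ z 3 ^ 2 := by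
    intro z hz
    have := h.unit z hz
    rw [metric] at this; linarith
  -- This is the normalization behind the choice of μ; with ⟨f, W⟩ = -μκ it gives ⟨W, W⟩ = μ - ⟨f,
  -- W⟩².
  have hξW : ∀ z ∈ U, lorentz (ξ z) (W z₀) = -1 := by
    intro z hz
    rw [hlW z hz, lorentz_comm, h.tangent z hz, hξξ z hz]
    linear_combination -hμ1 z hz
  set A : E2 → ℝ := fun z => ξ z 3 / Real.sqrt (1 - ξ z 3 ^ 2) with hAdef
  have hr0 : ∀ z ∈ U, 0 < Real.sqrt (1 - ξ z 3 ^ 2) := fun z hz => Real.sqrt_pos.2 (hpos z hz)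
  have hr2 : ∀ z ∈ U, Real.sqrt (1 - ξ z 3 ^ 2) ^ 2 = 1 - ξ z 3 ^ 2 := fun z hz =>
    Real.sq_sqrt (hpos z hz).le
  have hrs : ContDiffOn ℝ ∞ (fun z => Real.sqrt (1 - ξ z 3 ^ 2)) U :=
    (contDiffOn_const.sub (hνs.pow 2)).sqrt fun z hz => (hpos z hz).ne'
  have hAs : ContDiffOn ℝ ∞ A U := hνs.div hrs fun z hz => (hr0 z hz).ne'
  -- A is cot θ and μ is 1/sin² θ.
  have hA2 : ∀ z ∈ U, A z ^ 2 + 1 = μ z := by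
    intro z hz
    have h1 := (hpos z hz).ne'
    have h2 := (hr0 z hz).ne'
    simp only [hAdef, hμdef]
    rw [div_pow, hr2 z hz]
    field_simp
    ring
  have hs : ∀ z ∈ U, Real.sqrt (A z ^ 2 + 1) = 1 / Real.sqrt (1 - ξ z 3 ^ 2) := by
    intro z hz
    rw [hA2 z hz, Real.sqrt_div zero_le_one, Real.sqrt_one]
  refine ⟨W z₀, A, hAs, fun _ _ => rfl, fun z hz => ?_, fun z hz w => ?_, fun z hz w => ?_⟩
  · rw [hB z hz, hlW z hz, lorentz_comm _ (f z), lorentz_comm _ (ξ z), hB z hz, hξW z hz,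
      ← hA2 z hz]
    ring
  · have h1 := dirDeriv_mul (hAs.diffAt hUo hz) (hrs.diffAt hUo hz) w
    have h2 := dirDeriv_mul (hrs.diffAt hUo hz) (hrs.diffAt hUo hz) w
    have hd := hνs.diffAt hUo hz
    rw [dirDeriv_congr hUo (g := fun z => 1 - ξ z 3 * ξ z 3)
      (fun z hz => by simp only; rw [← sq, hr2 z hz, sq]) hz,
      dirDeriv_sub (differentiableAt_const (1 : ℝ)) (hd.fun_mul hd), dirDeriv_const,
      dirDeriv_mul hd hd, dirDeriv_apply (hξ.diffAt hUo hz), (hκ z hz).2 w] at h2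
    rw [dirDeriv_congr hUo (g := fun z => ξ z 3)
      (fun z hz => div_mul_cancel₀ _ (hr0 z hz).ne') hz,
      dirDeriv_apply (hξ.diffAt hUo hz), (hκ z hz).2 w] at h1
    rw [hB z hz, hs z hz]
    have h3 := hr2 z hz
    have h4 := (hr0 z hz).ne'
    have h5 : μ z = 1 / Real.sqrt (1 - ξ z 3 ^ 2) ^ 2 := by rw [h3]
    have h6 : A z = ξ z 3 / Real.sqrt (1 - ξ z 3 ^ 2) := rfl
    rw [h5]
    rw [h6] at h1
    generalize dirDeriv w A z = X at *
    generalize dirDeriv w (fun z => Real.sqrt (1 - ξ z 3 ^ 2)) z = Y at *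
    generalize Real.sqrt (1 - ξ z 3 ^ 2) = r at *
    field_simp at h1 ⊢
    linear_combination (-r) * h1 - κ z * dirDeriv w f z 3 * h3 + (ξ z 3 / 2) * h2
  · rw [hlW z hz, lorentz_comm _ (f z), h.lorentz_dirDeriv hz, lorentz_comm,
      h.lorentz_normal_dirDeriv hz, hs z hz]
    have h3 := hr2 z hz
    have h4 := (hr0 z hz).ne'
    have h5 : μ z = 1 / Real.sqrt (1 - ξ z 3 ^ 2) ^ 2 := by rw [h3]
    have h6 : A z = ξ z 3 / Real.sqrt (1 - ξ z 3 ^ 2) := rfl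
    rw [h5, h6]
    field_simp
    ring

end Potential

/-! ### Integrating the system for A, B and the height -/

section Coordinate

theorem contDiff_chi (c₁ c₂ : ℝ) : ContDiff ℝ ∞ (chi c₁ c₂) := by
  have hd : deriv (chi c₁ c₂) = fun t => 1 / Real.sqrt (a c₁ c₂ t ^ 2 + 1) :=
    funext fun t => (hasDerivAt_chi _ _ t).deriv
  rw [contDiff_infty_iff_deriv, hd]
  refine ⟨fun t => (hasDerivAt_chi _ _ t).differentiableAt, ?_⟩
  refine contDiff_const.div ?_ fun t => by positivity
  exact (((contDiff_a _ _).pow 2).add contDiff_const).sqrt fun t => by positivity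

variable {E : Type*} [NormedAddCommGroup E] [NormedSpace ℝ E]

/-- A primitive of l is read off as the logarithm of G, without a Poincaré lemma. `Real.log` has
derivative 1/t on negative reals too, so the sign of G is immaterial. -/
theorem exists_log_coordinate {U : Set E} (hU : IsOpen U) {z₀ : E} (hz₀ : z₀ ∈ U) {G : E → ℝ}
    (hG : ContDiffOn ℝ ∞ G U) (hG₀ : G z₀ ≠ 0) {δ : ℝ} (hδ : δ * δ = 1) {l : E → E → ℝ}
    (hdG : ∀ z ∈ U, ∀ w, dirDeriv w G z = δ * G z * l w z) :
    ∃ (U' : Set E) (x : E → ℝ), IsOpen U' ∧ z₀ ∈ U' ∧ U' ⊆ U ∧ ContDiffOn ℝ ∞ x U' ∧ x z₀ = 0 ∧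
      ∀ z ∈ U', ∀ w, dirDeriv w x z = l w z := by
  have hopen : IsOpen (U ∩ G ⁻¹' {0}ᶜ) :=
    hG.continuousOn.isOpen_inter_preimage hU isOpen_compl_singleton
  refine ⟨U ∩ G ⁻¹' {0}ᶜ, fun z => δ * (Real.log (G z) - Real.log (G z₀)), hopen, ⟨hz₀, hG₀⟩,
    Set.inter_subset_left, ?_, by simp, fun z hz w => ?_⟩
  · exact contDiffOn_const.mul (((hG.mono Set.inter_subset_left).log fun z hz => hz.2).sub
      contDiffOn_const)
  · have hd := hG.diffAt hU hz.1
    have hg : G z ≠ 0 := hz.2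
    have h1 : HasDerivAt (fun t => δ * (Real.log t - Real.log (G z₀))) (δ * (G z)⁻¹) (G z) :=
      ((Real.hasDerivAt_log hg).sub_const _).const_mul δ
    rw [dirDeriv_comp h1 hd, hdG z hz.1]
    field_simp
    linear_combination l w z * hδ

/-- The system `dA = B dx`, `dB = A dx`, `dx = √(A² + 1) dτ` defines a local coordinate `x`. -/
theorem exists_coordinate {U : Set E} (hU : IsOpen U) {z₀ : E} (hz₀ : z₀ ∈ U) {A B τ : E → ℝ}
    (hA : ContDiffOn ℝ ∞ A U) (hB : ContDiffOn ℝ ∞ B U) (hτ : ContDiffOn ℝ ∞ τ U)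
    (hdA : ∀ z ∈ U, ∀ w, dirDeriv w A z = B z * Real.sqrt (A z ^ 2 + 1) * dirDeriv w τ z)
    (hdB : ∀ z ∈ U, ∀ w, dirDeriv w B z = A z * Real.sqrt (A z ^ 2 + 1) * dirDeriv w τ z)
    (hA₀ : A z₀ ≠ 0) :
    ∃ (U' : Set E) (x : E → ℝ), IsOpen U' ∧ z₀ ∈ U' ∧ U' ⊆ U ∧ ContDiffOn ℝ ∞ x U' ∧
      ∀ z ∈ U', A z = a (A z₀) (B z₀) (x z) ∧ B z = b (A z₀) (B z₀) (x z) ∧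
        τ z - τ z₀ = chi (A z₀) (B z₀) (x z) := by
  have key : ∃ (U' : Set E) (x : E → ℝ), IsOpen U' ∧ z₀ ∈ U' ∧ U' ⊆ U ∧ ContDiffOn ℝ ∞ x U' ∧
      x z₀ = 0 ∧ ∀ z ∈ U', ∀ w, dirDeriv w x z = Real.sqrt (A z ^ 2 + 1) * dirDeriv w τ z := by
    -- The functions A ± B satisfy d(A ± B) = ±(A ± B)√(A² + 1) dτ, and they do not both vanish at
    -- z₀ because A z₀ ≠ 0.
    by_cases h : A z₀ + B z₀ = 0
    · refine exists_log_coordinate hU hz₀ (hA.sub hB) (δ := -1) (fun h' => hA₀ ?_) (by norm_num)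
        (fun z hz w => ?_)
      · change A z₀ - B z₀ = 0 at h'
        linarith
      · have := dirDeriv_sub (hA.diffAt hU hz) (hB.diffAt hU hz) w
        rw [hdA z hz, hdB z hz] at this
        refine this.trans ?_
        change _ = -1 * (A z - B z) * _
        ring
    · refine exists_log_coordinate hU hz₀ (hA.add hB) (δ := 1) h (by norm_num)
        (fun z hz w => ?_)
      have := dirDeriv_add (hA.diffAt hU hz) (hB.diffAt hU hz) w
      rw [hdA z hz, hdB z hz] at this
      refine this.trans ?_
      change _ = 1 * (A z + B z) * _
      ring
  obtain ⟨U₁, x, hU₁, hz₁, hsub, hx₁, hx₀, hdx₁⟩ := key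
  obtain ⟨r, hr, hball⟩ := Metric.isOpen_iff.1 hU₁ z₀ hz₁
  set V := Metric.ball z₀ r with hV
  have hVo : IsOpen V := Metric.isOpen_ball
  have hVc : Convex ℝ V := convex_ball z₀ r
  have hz : z₀ ∈ V := Metric.mem_ball_self hr
  have hVU : V ⊆ U := hball.trans hsub
  have hx := hx₁.mono hball
  replace hA := hA.mono hVU
  replace hB := hB.mono hVU
  replace hτ := hτ.mono hVU
  have hch : ContDiffOn ℝ ∞ (fun z => Real.cosh (x z)) V := Real.contDiff_cosh.comp_contDiffOn hx
  have hsh : ContDiffOn ℝ ∞ (fun z => Real.sinh (x z)) V := Real.contDiff_sinh.comp_contDiffOn hx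
  have hdch : ∀ z ∈ V, ∀ w, dirDeriv w (fun z => Real.cosh (x z)) z =
      Real.sinh (x z) * (Real.sqrt (A z ^ 2 + 1) * dirDeriv w τ z) := fun z hz w => by
    rw [dirDeriv_comp (Real.hasDerivAt_cosh _) (hx.diffAt hVo hz), hdx₁ z (hball hz)]
  have hdsh : ∀ z ∈ V, ∀ w, dirDeriv w (fun z => Real.sinh (x z)) z =
      Real.cosh (x z) * (Real.sqrt (A z ^ 2 + 1) * dirDeriv w τ z) := fun z hz w => by
    rw [dirDeriv_comp (Real.hasDerivAt_sinh _) (hx.diffAt hVo hz), hdx₁ z (hball hz)]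
  -- Undoing the hyperbolic rotation by x makes the solution constant. Used for (A, B) and for (B,
  -- A), it gives c₁ = A z₀ and c₂ = B z₀.
  have hconst : ∀ P Q : E → ℝ, ContDiffOn ℝ ∞ P V → ContDiffOn ℝ ∞ Q V →
      (∀ z ∈ V, ∀ w, dirDeriv w P z = Q z * Real.sqrt (A z ^ 2 + 1) * dirDeriv w τ z) →
      (∀ z ∈ V, ∀ w, dirDeriv w Q z = P z * Real.sqrt (A z ^ 2 + 1) * dirDeriv w τ z) →
      ∀ z ∈ V, P z * Real.cosh (x z) - Q z * Real.sinh (x z) = P z₀ := by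
    intro P Q hP hQ hdP hdQ z hzV
    have hs : ContDiffOn ℝ ∞ (fun z => P z * Real.cosh (x z) - Q z * Real.sinh (x z)) V :=
      (hP.mul hch).sub (hQ.mul hsh)
    rw [eq_of_dirDeriv_eq_zero hVo hVc hs (fun z hz w => ?_) hzV hz, hx₀]
    · simp
    · rw [dirDeriv_sub ((hP.mul hch).diffAt hVo hz) ((hQ.mul hsh).diffAt hVo hz),
        dirDeriv_mul (hP.diffAt hVo hz) (hch.diffAt hVo hz),
        dirDeriv_mul (hQ.diffAt hVo hz) (hsh.diffAt hVo hz), hdch z hz, hdsh z hz, hdP z hz,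
        hdQ z hz]
      ring
  have h1 := hconst A B hA hB (fun z hz => hdA z (hVU hz)) (fun z hz => hdB z (hVU hz))
  have h2 := hconst B A hB hA (fun z hz => hdB z (hVU hz)) (fun z hz => hdA z (hVU hz))
  have hAx : ∀ z ∈ V, A z = a (A z₀) (B z₀) (x z) := by
    intro z hz
    rw [a, ← h1 z hz, ← h2 z hz]
    linear_combination (-A z) * Real.cosh_sq_sub_sinh_sq (x z)
  refine ⟨V, x, hVo, hz, hVU, hx, fun z hzV => ⟨hAx z hzV, ?_, ?_⟩⟩
  · rw [b_eq, ← h1 z hzV, ← h2 z hzV]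
    linear_combination (-B z) * Real.cosh_sq_sub_sinh_sq (x z)
  · have hcx : ContDiffOn ℝ ∞ (fun z => chi (A z₀) (B z₀) (x z)) V :=
      (contDiff_chi _ _).comp_contDiffOn hx
    have hchi : ContDiffOn ℝ ∞ (fun z => τ z - chi (A z₀) (B z₀) (x z)) V := hτ.sub hcx
    have h3 := eq_of_dirDeriv_eq_zero hVo hVc hchi (fun z hz w => ?_) hzV hz
    · rw [hx₀] at h3
      have h4 : chi (A z₀) (B z₀) 0 = 0 := by simp [chi]
      rw [h4] at h3
      linarith
    · rw [dirDeriv_sub (hτ.diffAt hVo hz) (hcx.diffAt hVo hz),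
        dirDeriv_comp (hasDerivAt_chi _ _ (x z)) (hx.diffAt hVo hz), hdx₁ z (hball hz),
        ← hAx z hz]
      have : 0 < Real.sqrt (A z ^ 2 + 1) := Real.sqrt_pos.2 (by positivity)
      field_simp
      ring

end Coordinate

/-! ### Lorentz frames, the isometries they define, and frames adapted to W -/

section Frame

/-- A future-directed orthonormal frame of `ℝ³₁`. -/
structure IsFrame (g₀ g₁ g₂ : E4) : Prop where
  h00 : lorentz g₀ g₀ = 1
  h11 : lorentz g₁ g₁ = 1
  h22 : lorentz g₂ g₂ = -1
  h01 : lorentz g₀ g₁ = 0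
  h02 : lorentz g₀ g₂ = 0
  h12 : lorentz g₁ g₂ = 0
  future : 0 < g₂ 2

/-- The isometry of `ℍ² × ℝ` that takes coordinates with respect to a frame. -/
def frameMap (g₀ g₁ g₂ : E4) (ε c : ℝ) (q : E4) : E4 :=
  ![lorentz q g₀, lorentz q g₁, -lorentz q g₂, ε * q 3 + c]

/-- The Lorentzian cross product. -/
def lorentzCross (v w : E4) : E4 :=
  ![v 1 * w 2 - v 2 * w 1, v 2 * w 0 - v 0 * w 2, -(v 0 * w 1 - v 1 * w 0), 0]

theorem lorentz_cross_left (v w : E4) : lorentz (lorentzCross v w) v = 0 := by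
  simp [lorentz, lorentzCross]; ring

theorem lorentz_cross_right (v w : E4) : lorentz (lorentzCross v w) w = 0 := by
  simp [lorentz, lorentzCross]; ring

theorem lorentz_cross_self (v w : E4) : lorentz (lorentzCross v w) (lorentzCross v w) =
    lorentz v w ^ 2 - lorentz v v * lorentz w w := by
  simp [lorentz, lorentzCross]; ring

theorem isFrame_cross_left {v w : E4} (hv : lorentz v v = 1) (hw : lorentz w w = -1)
    (hvw : lorentz v w = 0) (h : 0 < w 2) : IsFrame (lorentzCross v w) v w where
  h00 := by rw [lorentz_cross_self, hv, hw, hvw]; norm_num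
  h11 := hv
  h22 := hw
  h01 := lorentz_cross_left v w
  h02 := lorentz_cross_right v w
  h12 := hvw
  future := h

theorem IsFrame.swap {g₀ g₁ g₂ : E4} (h : IsFrame g₀ g₁ g₂) : IsFrame g₁ g₀ g₂ where
  h00 := h.h11
  h11 := h.h00
  h22 := h.h22
  h01 := by rw [lorentz_comm, h.h01]
  h02 := h.h12
  h12 := h.h02
  future := h.future

variable {g₀ g₁ g₂ : E4}

/-- Orthonormality says that one matrix product is the identity; the product in the reverse order is
then the expansion in the frame. -/
theorem IsFrame.lorentz_eq (h : IsFrame g₀ g₁ g₂) (v w : E4) :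
    lorentz v w = lorentz v g₀ * lorentz w g₀ + lorentz v g₁ * lorentz w g₁ -
      lorentz v g₂ * lorentz w g₂ := by
  obtain ⟨h00, h11, h22, h01, h02, h12, -⟩ := h
  simp only [lorentz] at h00 h11 h22 h01 h02 h12
  have hM : !![g₀ 0, g₀ 1, -g₀ 2; g₁ 0, g₁ 1, -g₁ 2; g₂ 0, g₂ 1, -g₂ 2] *
      !![g₀ 0, g₁ 0, -g₂ 0; g₀ 1, g₁ 1, -g₂ 1; g₀ 2, g₁ 2, -g₂ 2] =
      (1 : Matrix (Fin 3) (Fin 3) ℝ) := by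
    ext i j
    fin_cases i <;> fin_cases j <;> simp [Matrix.mul_apply, Fin.sum_univ_three] <;> linarith
  rw [mul_eq_one_comm] at hM
  have hE : ∀ i j : Fin 3, _ := fun i j => congrFun (congrFun hM i) j
  have e00 := hE 0 0
  have e01 := hE 0 1
  have e02 := hE 0 2
  have e11 := hE 1 1
  have e12 := hE 1 2
  have e22 := hE 2 2
  simp [Matrix.mul_apply, Fin.sum_univ_three] at e00 e01 e02 e11 e12 e22
  simp only [lorentz]
  linear_combination (-v 0 * w 0) * e00 - (v 0 * w 1 + v 1 * w 0) * e01 +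
    (-(v 0 * w 2 + v 2 * w 0)) * e02 - v 1 * w 1 * e11 - (v 1 * w 2 + v 2 * w 1) * e12 +
    v 2 * w 2 * e22

theorem lorentz_frameMap (h : IsFrame g₀ g₁ g₂) (ε ε' c c' : ℝ) (v w : E4) :
    lorentz (frameMap g₀ g₁ g₂ ε c v) (frameMap g₀ g₁ g₂ ε' c' w) = lorentz v w := by
  rw [h.lorentz_eq v w]
  simp [lorentz, frameMap]
  ring

theorem contDiff_frameMap (g₀ g₁ g₂ : E4) (ε c : ℝ) :
    ContDiff ℝ ∞ (frameMap g₀ g₁ g₂ ε c) := by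
  rw [contDiff_pi]
  intro i
  fin_cases i <;> simp [frameMap, lorentz] <;> fun_prop

theorem fderiv_frameMap (g₀ g₁ g₂ : E4) (ε c : ℝ) (p v : E4) :
    fderiv ℝ (frameMap g₀ g₁ g₂ ε c) p v = frameMap g₀ g₁ g₂ ε 0 v := by
  have hd : DifferentiableAt ℝ (frameMap g₀ g₁ g₂ ε c) p :=
    (contDiff_frameMap g₀ g₁ g₂ ε c).differentiable (by simp) p
  have hid : DifferentiableAt ℝ (fun q : E4 => q) p := differentiableAt_id
  have hl : ∀ g : E4, dirDeriv v (fun q => lorentz q g) p = lorentz v g := by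
    intro g
    rw [dirDeriv_lorentz (f := fun q : E4 => q) hid (differentiableAt_const g), dirDeriv_const]
    simp [dirDeriv, lorentz]
  change dirDeriv v (frameMap g₀ g₁ g₂ ε c) p = _
  apply ext_E4
  · rw [← dirDeriv_apply hd]; exact hl g₀
  · rw [← dirDeriv_apply hd]; exact hl g₁
  · rw [← dirDeriv_apply hd]
    change dirDeriv v (fun q => -lorentz q g₂) p = -lorentz v g₂
    have : (fun q => -lorentz q g₂) = fun q => 0 - lorentz q g₂ := by ext; simp
    rw [this, dirDeriv_sub (differentiableAt_const _)
      (diffAt_lorentz hid (differentiableAt_const g₂)), dirDeriv_const, hl]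
    simp
  · rw [← dirDeriv_apply hd]
    change dirDeriv v (fun q : E4 => ε * q 3 + c) p = ε * v 3 + 0
    rw [dirDeriv_add ((differentiableAt_const _).fun_mul (diffAt_apply hid 3))
      (differentiableAt_const _), dirDeriv_mul (differentiableAt_const _) (diffAt_apply hid 3),
      dirDeriv_const, dirDeriv_const, dirDeriv_apply hid]
    simp [dirDeriv]

theorem isAmbientIsometry_frameMap (h : IsFrame g₀ g₁ g₂) {ε : ℝ} (hε : ε * ε = 1) (c : ℝ) :
    IsAmbientIsometry (frameMap g₀ g₁ g₂ ε c) := by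
  have hg : g₂ ∈ cone := ⟨by rw [h.h22]; norm_num, h.future⟩
  refine ⟨⟨?_, ?_, ?_⟩, fun p _ => (contDiff_frameMap g₀ g₁ g₂ ε c).contDiffAt, ?_⟩
  · intro p hp
    refine ⟨by rw [lorentz_frameMap h, hp.1], ?_⟩
    have := lorentz_neg_of_mem_cone (ambient_subset_cone hp) hg
    change 0 < -lorentz p g₂
    linarith
  · intro p _ q _ hpq
    have e0 : lorentz p g₀ = lorentz q g₀ := congrFun hpq 0
    have e1 : lorentz p g₁ = lorentz q g₁ := congrFun hpq 1
    have e2 : lorentz p g₂ = lorentz q g₂ := neg_injective (congrFun hpq 2)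
    have e3 : ε * p 3 + c = ε * q 3 + c := congrFun hpq 3
    have h3 : p 3 = q 3 := by
      have : ε * (p 3 - q 3) = 0 := by linarith
      have hε0 : ε ≠ 0 := fun h => by simp [h] at hε
      linarith [(mul_eq_zero.1 this).resolve_left hε0]
    rw [← sub_eq_zero]
    refine metric_nondegenerate fun w => ?_
    have h4 : lorentz p w = lorentz q w := by
      rw [h.lorentz_eq p w, h.lorentz_eq q w, e0, e1, e2]
    rw [metric_sub_left, metric, metric, h4, h3]; ring
  · intro r hr
    -- Frame vectors may have a component along ∂_t, which the Lorentzian form ignores; the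
    -- coefficient of `dt` removes it and sets the height.
    set q : E4 := r 0 • g₀ + r 1 • g₁ + r 2 • g₂ +
      (ε * (r 3 - c) - (r 0 * g₀ 3 + r 1 * g₁ 3 + r 2 * g₂ 3)) • dt with hq
    have hl : ∀ v, lorentz q v = r 0 * lorentz g₀ v + r 1 * lorentz g₁ v + r 2 * lorentz g₂ v := by
      intro v
      rw [hq]
      simp only [lorentz_add_left, lorentz_smul_left, lorentz_comm dt, lorentz_dt_right]
      ring
    have e0 : lorentz q g₀ = r 0 := by
      rw [hl, h.h00, lorentz_comm g₁, h.h01, lorentz_comm g₂, h.h02]; ring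
    have e1 : lorentz q g₁ = r 1 := by
      rw [hl, h.h11, h.h01, lorentz_comm g₂, h.h12]; ring
    have e2 : lorentz q g₂ = -r 2 := by
      rw [hl, h.h22, h.h02, h.h12]; ring
    have hr1 := hr.1
    have hqq : lorentz q q = -1 := by
      rw [h.lorentz_eq, e0, e1, e2, ← hr1]
      simp only [lorentz]; ring
    refine ⟨q, ⟨hqq, ?_⟩, ?_⟩
    · refine (mem_cone_of_lorentz_neg hg (by rw [hqq]; norm_num) ?_).2
      rw [lorentz_comm, e2]
      linarith [hr.2]
    · have e3 : q 3 = ε * (r 3 - c) := by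
        rw [hq]; simp
      apply ext_E4
      · exact e0
      · exact e1
      · change -lorentz q g₂ = r 2
        rw [e2]; ring
      · change ε * q 3 + c = r 3
        rw [e3]; linear_combination (r 3 - c) * hε
  · intro p _ v w _ _
    rw [fderiv_frameMap, fderiv_frameMap, metric, lorentz_frameMap h, metric]
    change _ + (ε * v 3 + 0) * (ε * w 3 + 0) = _
    linear_combination (v 3 * w 3) * hε

/-- Gram–Schmidt on W and p, completed by the cross product. The part of p orthogonal to W is
timelike and stays in the future cone. -/
theorem exists_frame_spacelike {p W : E4} (hp : p ∈ ambient) (hW : 0 < lorentz W W) :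
    ∃ g₀ g₁ g₂, IsFrame g₀ g₁ g₂ ∧
      ∀ q, lorentz q g₀ = lorentz q W / Real.sqrt (lorentz W W) := by
  set k := Real.sqrt (lorentz W W) with hk
  have hk0 : 0 < k := Real.sqrt_pos.2 hW
  have hk2 : k * k = lorentz W W := Real.mul_self_sqrt hW.le
  set g : E4 := k⁻¹ • W with hg
  have hgq : ∀ q, lorentz q g = lorentz q W / k := fun q => by
    rw [hg, lorentz_smul_right]; field_simp
  have hgg : lorentz g g = 1 := by
    rw [hgq, lorentz_comm, hgq, ← hk2]; field_simp
  set m : E4 := p + (-lorentz p g) • g with hm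
  have hmg : lorentz m g = 0 := by
    rw [hm, lorentz_add_left, lorentz_smul_left, hgg]; ring
  have hmp : lorentz p m = -(1 + lorentz p g ^ 2) := by
    rw [hm, lorentz_add_right, lorentz_smul_right, hp.1]; ring
  have hmm : lorentz m m = -(1 + lorentz p g ^ 2) := by
    rw [← hmp]
    nth_rw 1 [hm]
    rw [lorentz_add_left, lorentz_smul_left, lorentz_comm g, hmg]; ring
  have hpos : 0 < 1 + lorentz p g ^ 2 := by positivity
  set r := Real.sqrt (1 + lorentz p g ^ 2) with hr
  have hr0 : 0 < r := Real.sqrt_pos.2 hpos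
  have hr2 : r * r = 1 + lorentz p g ^ 2 := Real.mul_self_sqrt hpos.le
  have hmc : m ∈ cone := mem_cone_of_lorentz_neg (ambient_subset_cone hp) (by linarith)
    (by linarith)
  refine ⟨g, lorentzCross g (r⁻¹ • m), r⁻¹ • m, (isFrame_cross_left hgg ?_ ?_ ?_).swap, hgq⟩
  · rw [lorentz_smul_left, lorentz_smul_right, hmm, ← hr2]; field_simp
  · rw [lorentz_smul_right, lorentz_comm, hmg, mul_zero]
  · exact (smul_mem_cone hmc (inv_pos.2 hr0)).2

/-- Here -W is future-directed since ⟨p, W⟩ > 0, and normalizes to g₂. The strict inequality says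
that p lies off the axis ℝW, so its component orthogonal to W normalizes to g₀. -/
theorem exists_frame_timelike {p W : E4} (hp : p ∈ ambient) (hW : lorentz W W < 0)
    (hpW : 0 < lorentz p W) (hpW' : -lorentz W W < lorentz p W ^ 2) :
    ∃ g₀ g₁ g₂, IsFrame g₀ g₁ g₂ ∧ 0 < lorentz p g₀ ∧
      ∀ q, -lorentz q g₂ = lorentz q W / Real.sqrt (-lorentz W W) := by
  set k := Real.sqrt (-lorentz W W) with hk
  have hk0 : 0 < k := Real.sqrt_pos.2 (by linarith)
  have hk2 : k * k = -lorentz W W := Real.mul_self_sqrt (by linarith)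
  set g : E4 := (-k⁻¹) • W with hg
  have hgq : ∀ q, lorentz q g = -(lorentz q W / k) := fun q => by
    rw [hg, lorentz_smul_right]; field_simp
  have hgg : lorentz g g = -1 := by
    rw [hgq, lorentz_comm, hgq, show lorentz W W = -(k * k) by linarith]; field_simp
  have hpg : lorentz p g < 0 := by
    rw [hgq]; have := div_pos hpW hk0; linarith
  have hpg' : 1 < lorentz p g ^ 2 := by
    rw [hgq, neg_sq, div_pow, lt_div_iff₀ (by positivity)]
    linarith
  have hgc : g ∈ cone := mem_cone_of_lorentz_neg (ambient_subset_cone hp) (by linarith) hpg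
  set m : E4 := p + lorentz p g • g with hm
  have hmg : lorentz m g = 0 := by
    rw [hm, lorentz_add_left, lorentz_smul_left, hgg]; ring
  have hmp : lorentz p m = lorentz p g ^ 2 - 1 := by
    rw [hm, lorentz_add_right, lorentz_smul_right, hp.1]; ring
  have hmm : lorentz m m = lorentz p g ^ 2 - 1 := by
    rw [← hmp]
    nth_rw 1 [hm]
    rw [lorentz_add_left, lorentz_smul_left, lorentz_comm g, hmg]; ring
  have hpos : 0 < lorentz p g ^ 2 - 1 := by linarith
  set r := Real.sqrt (lorentz p g ^ 2 - 1) with hr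
  have hr0 : 0 < r := Real.sqrt_pos.2 hpos
  have hr2 : r * r = lorentz p g ^ 2 - 1 := Real.mul_self_sqrt hpos.le
  refine ⟨r⁻¹ • m, lorentzCross (r⁻¹ • m) g, g, (isFrame_cross_left ?_ hgg ?_ hgc.2).swap, ?_,
    fun q => by rw [hgq]; ring⟩
  · rw [lorentz_smul_left, lorentz_smul_right, hmm, ← hr2]; field_simp
  · rw [lorentz_smul_left, hmg, mul_zero]
  · rw [lorentz_smul_right, hmp]; positivity

/-- In the span of p and W there is a second null vector N with ⟨N, W⟩ = 2; then g₁, g₂ = (N ± W)/2.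
-/
theorem exists_frame_null {p W : E4} (hp : p ∈ ambient) (hW : lorentz W W = 0)
    (hpW : 0 < lorentz p W) :
    ∃ g₀ g₁ g₂, IsFrame g₀ g₁ g₂ ∧ ∀ q, lorentz q g₁ - lorentz q g₂ = lorentz q W := by
  set β := lorentz p W with hβ
  set N : E4 := (2 / β) • p + (1 / β ^ 2) • W with hN
  have hNW : lorentz N W = 2 := by
    rw [hN, lorentz_add_left, lorentz_smul_left, lorentz_smul_left, hW, ← hβ]; field_simp; ring
  have hpN : lorentz p N = -(1 / β) := by
    rw [hN, lorentz_add_right, lorentz_smul_right, lorentz_smul_right, hp.1, ← hβ]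
    field_simp; ring
  have hNN : lorentz N N = 0 := by
    nth_rw 1 [hN]
    rw [lorentz_add_left, lorentz_smul_left, lorentz_smul_left, hpN, lorentz_comm W, hNW]
    field_simp; ring
  set g₁ : E4 := (1 / 2 : ℝ) • N + (1 / 2 : ℝ) • W with hg₁
  set g₂ : E4 := (1 / 2 : ℝ) • N + (-(1 / 2) : ℝ) • W with hg₂
  have h22 : lorentz g₂ g₂ = -1 := by
    simp only [hg₂, lorentz_add_left, lorentz_add_right, lorentz_smul_left, lorentz_smul_right,
      hNN, hNW, hW, lorentz_comm W N]; norm_num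
  refine ⟨lorentzCross g₁ g₂, g₁, g₂, isFrame_cross_left ?_ h22 ?_ ?_, fun q => ?_⟩
  · simp only [hg₁, lorentz_add_left, lorentz_add_right, lorentz_smul_left, lorentz_smul_right,
      hNN, hNW, hW, lorentz_comm W N]; norm_num
  · simp only [hg₁, hg₂, lorentz_add_left, lorentz_add_right, lorentz_smul_left,
      lorentz_smul_right, hNN, hNW, hW, lorentz_comm W N]; norm_num
  · refine (mem_cone_of_lorentz_neg (ambient_subset_cone hp) (by linarith) ?_).2
    rw [hg₂, lorentz_add_right, lorentz_smul_right, lorentz_smul_right, hpN, ← hβ]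
    have : 0 < 1 / β := by positivity
    linarith
  · rw [hg₁, hg₂]
    simp only [lorentz_add_right, lorentz_smul_right]; ring

end Frame

/-! ### Identification with one of the three parametrizations -/

section LocalModel

/-- The parametrization selected by the sign of `1 + c₁² - c₂²`. -/
def IsModelOn {X : Type*} (S : Set X) (c₁ c₂ : ℝ) (F : X → E4) (x y : X → ℝ) : Prop :=
  (0 < 1 + c₁ ^ 2 - c₂ ^ 2 ∧ ∀ q ∈ S, F q = modelPos c₁ c₂ (x q) (y q)) ∨
    (1 + c₁ ^ 2 - c₂ ^ 2 < 0 ∧ ∀ q ∈ S, F q = modelNeg c₁ c₂ (x q) (y q)) ∨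
    (1 + c₁ ^ 2 - c₂ ^ 2 = 0 ∧ ∀ q ∈ S, F q = modelZero c₁ c₂ (x q) (y q))

/-- Factoring through a differentiable function of (x, y) will show that (x, y) has injective
differential. In the null case b² = a² + 1 keeps the denominators nonzero. -/
theorem IsModelOn.differentiableAt {S : Set E2} {c₁ c₂ : ℝ} {F : E2 → E4}
    {x y : E2 → ℝ} (h : IsModelOn S c₁ c₂ F x y) :
    ∃ m : E2 → E4, (∀ q, DifferentiableAt ℝ m q) ∧
      ∀ q ∈ S, F q = m (WithLp.toLp 2 ![x q, y q]) := by
  have hx : ContDiff ℝ ∞ fun q : E2 => q 0 := by fun_prop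
  have hy : ContDiff ℝ ∞ fun q : E2 => q 1 := by fun_prop
  have ha : ContDiff ℝ ∞ fun q : E2 => a c₁ c₂ (q 0) := (contDiff_a c₁ c₂).comp hx
  have hb : ContDiff ℝ ∞ fun q : E2 => b c₁ c₂ (q 0) := (contDiff_b c₁ c₂).comp hx
  have hχ : ContDiff ℝ ∞ fun q : E2 => chi c₁ c₂ (q 0) := (contDiff_chi c₁ c₂).comp hx
  have hs : ContDiff ℝ ∞ fun q : E2 => Real.sqrt (a c₁ c₂ (q 0) ^ 2 + 1) :=
    ((ha.pow 2).add contDiff_const).sqrt fun q => by positivity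
  rcases h with ⟨h, hF⟩ | ⟨h, hF⟩ | ⟨h, hF⟩
  · refine ⟨fun q => modelPos c₁ c₂ (q 0) (q 1), fun q => ?_, fun q hq => hF q hq⟩
    have : ContDiff ℝ ∞ fun q : E2 => modelPos c₁ c₂ (q 0) (q 1) := by
      rw [contDiff_pi]
      intro i
      fin_cases i
      · exact hb.div_const _
      · exact (hs.div_const _).mul (Real.contDiff_sinh.comp hy)
      · exact (hs.div_const _).mul (Real.contDiff_cosh.comp hy)
      · exact hχ
    exact this.differentiable (by simp) q
  · refine ⟨fun q => modelNeg c₁ c₂ (q 0) (q 1), fun q => ?_, fun q hq => hF q hq⟩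
    have : ContDiff ℝ ∞ fun q : E2 => modelNeg c₁ c₂ (q 0) (q 1) := by
      rw [contDiff_pi]
      intro i
      fin_cases i
      · exact (hs.div_const _).mul (Real.contDiff_cos.comp hy)
      · exact (hs.div_const _).mul (Real.contDiff_sin.comp hy)
      · exact hb.div_const _
      · exact hχ
    exact this.differentiable (by simp) q
  · refine ⟨fun q => modelZero c₁ c₂ (q 0) (q 1), fun q => ?_, fun q hq => hF q hq⟩
    have hb0 : ∀ x, b c₁ c₂ x ≠ 0 := by
      intro x h0
      have := a_sq_sub_b_sq c₁ c₂ x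
      rw [h0] at this
      nlinarith [sq_nonneg (a c₁ c₂ x)]
    have hi : ContDiff ℝ ∞ fun q : E2 => 1 / (2 * b c₁ c₂ (q 0)) :=
      contDiff_const.div (contDiff_const.mul hb) fun q => mul_ne_zero two_ne_zero (hb0 _)
    have : ContDiff ℝ ∞ fun q : E2 => modelZero c₁ c₂ (q 0) (q 1) := by
      rw [contDiff_pi]
      intro i
      fin_cases i
      · exact hb.mul hy
      · exact ((hb.div_const _).mul (contDiff_const.sub (hy.pow 2))).sub hi
      · exact ((hb.div_const _).mul (contDiff_const.add (hy.pow 2))).add hi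
      · exact hχ
    exact this.differentiable (by simp) q

variable {U : Set E2} {f ξ : E2 → E4}

/-- A surface whose `x`-coordinate is given by a linear functional is, up to an isometry, one of
the three models. -/
theorem IsPatch.exists_isModelOn (h : IsPatch U f ξ) {z₀ : E2} (hz₀ : z₀ ∈ U) {x : E2 → ℝ}
    (hx : ContDiffOn ℝ ∞ x U) {c₁ c₂ ε c : ℝ} (hε : ε * ε = 1) {W : E4}
    (hW : lorentz W W = 1 + c₁ ^ 2 - c₂ ^ 2) (hpos : lorentz W W ≤ 0 → 0 < lorentz (f z₀) W)
    (hfW : ∀ z ∈ U, lorentz (f z) W = b c₁ c₂ (x z))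
    (ht : ∀ z ∈ U, ε * f z 3 + c = chi c₁ c₂ (x z)) :
    ∃ (Φ : E4 → E4) (U' : Set E2) (y : E2 → ℝ), IsAmbientIsometry Φ ∧ IsOpen U' ∧ z₀ ∈ U' ∧
      U' ⊆ U ∧ ContDiffOn ℝ ∞ y U' ∧ IsModelOn U' c₁ c₂ (fun z => Φ (f z)) x y := by
  have hab : ∀ z, 1 + c₁ ^ 2 - c₂ ^ 2 = a c₁ c₂ (x z) ^ 2 + 1 - b c₁ c₂ (x z) ^ 2 := fun z => by
    linarith [a_sq_sub_b_sq c₁ c₂ (x z)]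
  have has : ContDiffOn ℝ ∞ (fun z => a c₁ c₂ (x z)) U := (contDiff_a c₁ c₂).comp_contDiffOn hx
  have hbs : ContDiffOn ℝ ∞ (fun z => b c₁ c₂ (x z)) U := (contDiff_b c₁ c₂).comp_contDiffOn hx
  set s : E2 → ℝ := fun z => Real.sqrt (a c₁ c₂ (x z) ^ 2 + 1) with hs
  have hs0 : ∀ z, 0 < s z := fun z => Real.sqrt_pos.2 (by positivity)
  have hs2 : ∀ z, s z ^ 2 = a c₁ c₂ (x z) ^ 2 + 1 := fun z => Real.sq_sqrt (by positivity)
  have hss : ContDiffOn ℝ ∞ s U :=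
    ((has.pow 2).add contDiffOn_const).sqrt fun z _ => by positivity
  have hlg : ∀ g : E4, ContDiffOn ℝ ∞ (fun z => lorentz (f z) g) U := fun g =>
    h.smooth.lorentz contDiffOn_const
  have hiso : ∀ g₀ g₁ g₂, IsFrame g₀ g₁ g₂ → ∀ z ∈ U, lorentz (f z) g₀ ^ 2 +
      lorentz (f z) g₁ ^ 2 - lorentz (f z) g₂ ^ 2 = -1 := by
    intro g₀ g₁ g₂ hg z hz
    rw [← (h.mem z hz).1, hg.lorentz_eq (f z) (f z)]; ring
  have hfut : ∀ g₀ g₁ g₂, IsFrame g₀ g₁ g₂ → ∀ z ∈ U, 0 < -lorentz (f z) g₂ := by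
    intro g₀ g₁ g₂ hg z hz
    have := lorentz_neg_of_mem_cone (ambient_subset_cone (h.mem z hz))
      (q := g₂) ⟨by rw [hg.h22]; norm_num, hg.future⟩
    linarith
  rcases lt_trichotomy (lorentz W W) 0 with hlt | heq | hgt
  · obtain ⟨g₀, g₁, g₂, hg, hp₀, hgW⟩ := exists_frame_timelike (h.mem z₀ hz₀) hlt (hpos hlt.le)
      (by rw [hW, hab z₀, hfW z₀ hz₀]; nlinarith [sq_nonneg (a c₁ c₂ (x z₀))])
    have hk : -lorentz W W = c₂ ^ 2 - c₁ ^ 2 - 1 := by rw [hW]; ring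
    rw [hk] at hgW
    set k := Real.sqrt (c₂ ^ 2 - c₁ ^ 2 - 1) with hkdef
    have hk0 : 0 < k := Real.sqrt_pos.2 (by linarith)
    have hk2 : k ^ 2 = c₂ ^ 2 - c₁ ^ 2 - 1 := Real.sq_sqrt (by linarith)
    -- Positivity of the g₀-coordinate keeps the polar angle inside (-π/2, π/2), where arcsin is a
    -- smooth inverse and the cosine is the positive root.
    have hopen : IsOpen (U ∩ (fun z => lorentz (f z) g₀) ⁻¹' Set.Ioi 0) :=
      (hlg g₀).continuousOn.isOpen_inter_preimage h.isOpen isOpen_Ioi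
    have hsq : ∀ z ∈ U, lorentz (f z) g₀ ^ 2 + lorentz (f z) g₁ ^ 2 = (s z / k) ^ 2 := by
      intro z hz
      have h1 := hiso g₀ g₁ g₂ hg z hz
      have h2 := hgW (f z)
      rw [hfW z hz] at h2
      rw [← neg_sq (lorentz (f z) g₂), h2] at h1
      have h3 := hab z
      rw [div_pow] at h1 ⊢
      rw [show lorentz (f z) g₀ ^ 2 + lorentz (f z) g₁ ^ 2 = b c₁ c₂ (x z) ^ 2 / k ^ 2 - 1 by
        linarith, hs2]
      field_simp
      linarith
    have hlt1 : ∀ z ∈ U ∩ (fun z => lorentz (f z) g₀) ⁻¹' Set.Ioi 0,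
        (lorentz (f z) g₁ / (s z / k)) ^ 2 < 1 := by
      intro z hz
      have h0 : 0 < s z / k := div_pos (hs0 z) hk0
      rw [div_pow, div_lt_one (by positivity), ← hsq z hz.1]
      have h1 : 0 < lorentz (f z) g₀ := hz.2
      have h2 : 0 < lorentz (f z) g₀ ^ 2 := by positivity
      linarith
    refine ⟨frameMap g₀ g₁ g₂ ε c, _, fun z => Real.arcsin (lorentz (f z) g₁ / (s z / k)),
      isAmbientIsometry_frameMap hg hε c, hopen, ⟨hz₀, hp₀⟩, Set.inter_subset_left, ?_,
      Or.inr (Or.inl ⟨by rw [← hW]; exact hlt, fun z hz => ?_⟩)⟩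
    · have hd : ContDiffOn ℝ ∞ (fun z => lorentz (f z) g₁ / (s z / k)) U :=
        (hlg g₁).div (hss.div_const k) fun z _ => (div_pos (hs0 z) hk0).ne'
      intro z hz
      have h1 := hlt1 z hz
      refine (Real.contDiffAt_arcsin (fun h2 => ?_) (fun h2 => ?_)).comp_contDiffWithinAt z
        (hd.mono Set.inter_subset_left z hz) <;> norm_num [h2] at h1
    · have h0 : 0 < s z / k := div_pos (hs0 z) hk0
      have h1 := hlt1 z hz
      have h2 : -1 ≤ lorentz (f z) g₁ / (s z / k) := by nlinarith
      have h3 : lorentz (f z) g₁ / (s z / k) ≤ 1 := by nlinarith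
      have h4 : 0 < lorentz (f z) g₀ := hz.2
      apply ext_E4
      · change lorentz (f z) g₀ = s z / k * Real.cos (Real.arcsin _)
        rw [Real.cos_arcsin, show 1 - (lorentz (f z) g₁ / (s z / k)) ^ 2 =
          (lorentz (f z) g₀ / (s z / k)) ^ 2 by
            have := hsq z hz.1
            rw [div_pow (lorentz (f z) g₁), div_pow (lorentz (f z) g₀), ← this]
            have h5 : lorentz (f z) g₀ ^ 2 + lorentz (f z) g₁ ^ 2 ≠ 0 := by
              rw [this]; positivity
            field_simp
            ring, Real.sqrt_sq (by positivity), mul_div_cancel₀ _ h0.ne']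
      · change lorentz (f z) g₁ = s z / k * Real.sin (Real.arcsin _)
        rw [Real.sin_arcsin h2 h3, mul_div_cancel₀ _ h0.ne']
      · change -lorentz (f z) g₂ = b c₁ c₂ (x z) / k
        rw [hgW, hfW z hz.1]
      · exact ht z hz.1
  · obtain ⟨g₀, g₁, g₂, hg, hgW⟩ := exists_frame_null (h.mem z₀ hz₀) heq (hpos heq.le)
    have hb0 : ∀ z, b c₁ c₂ (x z) ≠ 0 := by
      intro z h0
      have := hab z
      rw [h0, ← hW, heq] at this
      nlinarith [sq_nonneg (a c₁ c₂ (x z))]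
    -- The difference of the g₁- and g₂-pairings is b(x), and the hyperboloid equation then
    -- determines each of them from y.
    refine ⟨frameMap g₀ g₁ g₂ ε c, U, fun z => lorentz (f z) g₀ / b c₁ c₂ (x z),
      isAmbientIsometry_frameMap hg hε c, h.isOpen, hz₀, le_rfl,
      (hlg g₀).div hbs fun z _ => hb0 z,
      Or.inr (Or.inr ⟨by rw [← hW]; exact heq, fun z hz => ?_⟩)⟩
    have h1 := hiso g₀ g₁ g₂ hg z hz
    have h2 := hgW (f z)
    rw [hfW z hz] at h2
    have h3 := hb0 z
    apply ext_E4
    · change lorentz (f z) g₀ = b c₁ c₂ (x z) * (lorentz (f z) g₀ / b c₁ c₂ (x z))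
      field_simp
    · change lorentz (f z) g₁ = b c₁ c₂ (x z) / 2 * (1 - (lorentz (f z) g₀ / b c₁ c₂ (x z)) ^ 2) -
        1 / (2 * b c₁ c₂ (x z))
      rw [← h2] at h3 ⊢
      field_simp
      linear_combination h1
    · change -lorentz (f z) g₂ = b c₁ c₂ (x z) / 2 * (1 + (lorentz (f z) g₀ / b c₁ c₂ (x z)) ^ 2) +
        1 / (2 * b c₁ c₂ (x z))
      rw [← h2] at h3 ⊢
      field_simp
      linear_combination -h1
    · exact ht z hz
  · obtain ⟨g₀, g₁, g₂, hg, hgW⟩ := exists_frame_spacelike (h.mem z₀ hz₀) hgt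
    rw [hW] at hgW hgt
    set k := Real.sqrt (1 + c₁ ^ 2 - c₂ ^ 2) with hkdef
    have hk0 : 0 < k := Real.sqrt_pos.2 hgt
    have hk2 : k ^ 2 = 1 + c₁ ^ 2 - c₂ ^ 2 := Real.sq_sqrt hgt.le
    have hd : ContDiffOn ℝ ∞ (fun z => lorentz (f z) g₁ / (s z / k)) U :=
      (hlg g₁).div (hss.div_const k) fun z _ => (div_pos (hs0 z) hk0).ne'
    -- At fixed x the remaining coordinates lie on one branch of a hyperbola, which arsinh
    -- parametrizes globally; no shrinking is needed.
    refine ⟨frameMap g₀ g₁ g₂ ε c, U, fun z => Real.arsinh (lorentz (f z) g₁ / (s z / k)),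
      isAmbientIsometry_frameMap hg hε c, h.isOpen, hz₀, le_rfl,
      Real.contDiff_arsinh.comp_contDiffOn hd, Or.inl ⟨hgt, fun z hz => ?_⟩⟩
    have h0 : 0 < s z / k := div_pos (hs0 z) hk0
    have h1 := hiso g₀ g₁ g₂ hg z hz
    have h2 := hgW (f z)
    rw [hfW z hz] at h2
    have h3 := hfut g₀ g₁ g₂ hg z hz
    apply ext_E4
    · exact h2
    · change lorentz (f z) g₁ = s z / k * Real.sinh (Real.arsinh _)
      rw [Real.sinh_arsinh, mul_div_cancel₀ _ h0.ne']
    · change -lorentz (f z) g₂ = s z / k * Real.cosh (Real.arsinh _)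
      rw [Real.cosh_arsinh, show 1 + (lorentz (f z) g₁ / (s z / k)) ^ 2 =
          (-lorentz (f z) g₂ / (s z / k)) ^ 2 by
            rw [div_pow (lorentz (f z) g₁), div_pow (-lorentz (f z) g₂), neg_sq, show lorentz (f z) g₂ ^ 2 =
              1 + (b c₁ c₂ (x z) / k) ^ 2 + lorentz (f z) g₁ ^ 2 by rw [← h2]; linarith]
            have h4 := hab z
            have h5 := (hs0 z).ne'
            field_simp
            rw [hs2]
            linear_combination -hk2 - h4, Real.sqrt_sq (by positivity), mul_div_cancel₀ _ h0.ne']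
    · exact ht z hz

/-- The local classification in coordinates. -/
theorem IsPatch.exists_model (h : IsPatch U f ξ) (hUc : Convex ℝ U) {z₀ : E2} (hz₀ : z₀ ∈ U)
    (hν : ∀ z ∈ U, ξ z 3 ≠ 0)
    (hmp : ∀ z ∈ U, ξ z 3 ^ 2 < 1 ∧ ∃ κ, IsMinimalPrincipal (f z) (ξ z) (fun w => dirDeriv w f z)
      (fun w => dirDeriv w ξ z) κ) {u : E2} (hu : ∀ z ∈ U, dirDeriv u f z 3 ≠ 0) :
    ∃ (Φ : E4 → E4) (U' : Set E2) (x y : E2 → ℝ) (c₁ c₂ : ℝ), IsAmbientIsometry Φ ∧ IsOpen U' ∧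
      z₀ ∈ U' ∧ U' ⊆ U ∧ ContDiffOn ℝ ∞ x U' ∧ ContDiffOn ℝ ∞ y U' ∧
      IsModelOn U' c₁ c₂ (fun z => Φ (f z)) x y ∧
      ∀ z ∈ U', ξ z 3 / Real.sqrt (1 - ξ z 3 ^ 2) = a c₁ c₂ (x z) := by
  obtain ⟨W, A, hAs, hA, hWW, hdA, hdB⟩ := h.exists_axis hUc hz₀ hν hmp hu
  have hA₀ : A z₀ ≠ 0 := by
    rw [hA z₀ hz₀]
    exact div_ne_zero (hν z₀ hz₀) (Real.sqrt_pos.2 (by linarith [(hmp z₀ hz₀).1])).ne'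
  -- Replacing (W, t) by (εW, εt) preserves the system and leaves A unchanged. So the sign of ⟨f, W⟩
  -- can be corrected where the frames require it, while a(x) = cot θ survives without a sign
  -- ambiguity.
  obtain ⟨ε, hε, hεpos⟩ : ∃ ε : ℝ, ε * ε = 1 ∧
      (lorentz W W ≤ 0 → 0 < ε * lorentz (f z₀) W) := by
    rcases lt_trichotomy (lorentz (f z₀) W) 0 with hlt | heq | hgt
    · exact ⟨-1, by norm_num, fun _ => by linarith⟩
    · refine ⟨1, by norm_num, fun hle => ?_⟩
      rw [hWW z₀ hz₀, heq] at hle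
      nlinarith [sq_nonneg (A z₀)]
    · exact ⟨1, by norm_num, fun _ => by linarith⟩
  have hWε : ∀ v, lorentz v (ε • W) = ε * lorentz v W := fun v => lorentz_smul_right ε v W
  have hf3 := contDiffOn_pi.1 h.smooth 3
  have hτ : ContDiffOn ℝ ∞ (fun z => ε * f z 3) U := contDiffOn_const.mul hf3
  have hB : ContDiffOn ℝ ∞ (fun z => lorentz (f z) (ε • W)) U :=
    h.smooth.lorentz contDiffOn_const
  have hdτ : ∀ z ∈ U, ∀ w, dirDeriv w (fun z => ε * f z 3) z = ε * dirDeriv w f z 3 := by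
    intro z hz w
    rw [dirDeriv_mul (differentiableAt_const _) (hf3.diffAt h.isOpen hz), dirDeriv_const,
      dirDeriv_apply (h.smooth.diffAt h.isOpen hz)]
    ring
  obtain ⟨U₁, x, hU₁, hz₁, hsub, hx, hxall⟩ := exists_coordinate h.isOpen hz₀ hAs hB hτ
    (fun z hz w => by
      rw [hdA z hz, hdτ z hz, hWε]
      linear_combination (-(lorentz (f z) W * Real.sqrt (A z ^ 2 + 1) * dirDeriv w f z 3)) * hε)
    (fun z hz w => by
      rw [dirDeriv_lorentz (h.smooth.diffAt h.isOpen hz) (differentiableAt_const _),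
        dirDeriv_const, hWε, hdB z hz, hdτ z hz]
      simp [lorentz]
      ring) hA₀
  have h₁ := h.mono hU₁ hsub
  -- The vertical translation is chosen so that z₀ has height zero, in agreement with the lower
  -- limit of the integral χ.
  obtain ⟨Φ, U₂, y, hΦ, hU₂, hz₂, hsub₂, hy, hmodel⟩ := h₁.exists_isModelOn hz₁ hx
    (c₁ := A z₀) (c₂ := lorentz (f z₀) (ε • W)) (ε := ε) (c := -(ε * f z₀ 3)) (W := ε • W) hε
    (by rw [hWε, hWε, lorentz_smul_left, hWW z₀ hz₀]
        linear_combination (1 + A z₀ ^ 2 - lorentz (f z₀) W ^ 2) * hε +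
          (lorentz (f z₀) W ^ 2) * hε)
    (fun hle => by
      rw [hWε]
      refine hεpos ?_
      rw [hWε, lorentz_smul_left] at hle
      have : ε * (ε * lorentz W W) = lorentz W W := by linear_combination lorentz W W * hε
      rwa [this] at hle)
    (fun z hz => (hxall z hz).2.1)
    (fun z hz => by rw [← (hxall z hz).2.2]; ring)
  exact ⟨Φ, U₂, x, y, _, _, hΦ, hU₂, hz₂, hsub₂.trans hsub, hx.mono hsub₂, hy, hmodel,
    fun z hz => by rw [← hA z (hsub (hsub₂ hz)), (hxall z (hsub₂ hz)).1]⟩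

end LocalModel

/-! ### Charts of the surface from the model coordinates, and the classification -/

theorem exists_openPartialHomeomorph {U : Set E2} (hU : IsOpen U) {z₀ : E2} (hz₀ : z₀ ∈ U)
    {g : E2 → E2} (hg : ContDiffOn ℝ ∞ g U)
    (hinj : ∀ z ∈ U, ∀ w, dirDeriv w g z = 0 → w = 0) :
    ∃ G : OpenPartialHomeomorph E2 E2, z₀ ∈ G.source ∧ G.source ⊆ U ∧ (G : E2 → E2) = g ∧
      ContDiffOn ℝ ∞ G.symm G.target := by
  have hequiv : ∀ z ∈ U, ∃ L : E2 ≃L[ℝ] E2, HasFDerivAt g (L : E2 →L[ℝ] E2) z := by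
    intro z hz
    let L := (LinearEquiv.ofInjectiveEndo (fderiv ℝ g z).toLinearMap
      ((injective_iff_map_eq_zero _).2 fun w hw => hinj z hz w hw)).toContinuousLinearEquiv
    have hL : (L : E2 →L[ℝ] E2) = fderiv ℝ g z := by ext w; rfl
    exact ⟨L, by rw [hL]; exact (hg.diffAt hU hz).hasFDerivAt⟩
  obtain ⟨L, hL⟩ := hequiv z₀ hz₀
  have hc := hg.contDiffAt (hU.mem_nhds hz₀)
  let G := (hc.toOpenPartialHomeomorph g hL (by simp)).restrOpen U hU
  have hG : (G : E2 → E2) = g := rfl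
  have hGs : G.source ⊆ U := fun z hz => hz.2
  refine ⟨G, ⟨hc.mem_toOpenPartialHomeomorph_source hL (by simp), hz₀⟩, hGs, hG, fun y hy => ?_⟩
  have hy' := hGs (G.map_target hy)
  -- Smoothness of the inverse is needed on the whole target, so the differential must be invertible
  -- at every point and not only at z₀.
  obtain ⟨L', hL'⟩ := hequiv _ hy'
  exact (G.contDiffAt_symm hy hL' (hg.contDiffAt (hU.mem_nhds hy'))).contDiffWithinAt

/-- The coordinates of a model are local coordinates of the surface. -/
theorem IsPatch.coordinates_injective {U : Set E2} {f ξ : E2 → E4} (h : IsPatch U f ξ)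
    {Φ : E4 → E4} (hΦ : IsAmbientIsometry Φ) {x y : E2 → ℝ} {c₁ c₂ : ℝ}
    (hg : ContDiffOn ℝ ∞ (fun z => (WithLp.toLp 2 ![x z, y z] : E2)) U)
    (hm : IsModelOn U c₁ c₂ (fun z => Φ (f z)) x y) {z : E2} (hz : z ∈ U) {w : E2}
    (hw : dirDeriv w (fun z => (WithLp.toLp 2 ![x z, y z] : E2)) z = 0) : w = 0 := by
  obtain ⟨m, hmd, hmeq⟩ := hm.differentiableAt
  have hfd := h.smooth.diffAt h.isOpen hz
  have h1 : dirDeriv w (fun z => Φ (f z)) z = 0 := by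
    rw [dirDeriv_congr h.isOpen hmeq hz, dirDeriv,
      fderiv_fun_comp z (hmd _) (hg.diffAt h.isOpen hz)]
    change fderiv ℝ m _ (dirDeriv w (fun z => (WithLp.toLp 2 ![x z, y z] : E2)) z) = 0
    rw [hw, map_zero]
  have h2 : fderiv ℝ Φ (f z) (dirDeriv w f z) = 0 := by
    rw [← h1]
    simp only [dirDeriv]
    rw [fderiv_fun_comp z ((hΦ.smooth _ (h.mem z hz)).differentiableAt (by simp)) hfd]
    rfl
  -- A direction that kills (x, y) kills Φ ∘ f; as Φ preserves lengths, df(w) has length zero.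
  have h3 := hΦ.preserves _ (h.mem z hz) _ _ (h.lorentz_dirDeriv hz w) (h.lorentz_dirDeriv hz w)
  rw [h2] at h3
  refine h.immersion z hz w (metric_self_eq_zero (by rw [(h.mem z hz).1]; norm_num)
    (h.lorentz_dirDeriv hz w) ?_)
  rw [← h3]; simp [metric, lorentz]

theorem normal_three_ne_zero {M : Type*} {ξ : M → E4} {p : M}
    (h : angle ξ p ≠ Real.pi / 2) :
    ξ p 3 ≠ 0 := by
  intro h0
  rw [angle, metric_dt_left, h0, Real.arccos_zero] at h
  exact h rfl

variable {M : Type*} [TopologicalSpace M] [ChartedSpace E2 M] [IsManifold 𝓘(ℝ, E2) ∞ M]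

theorem exists_isLocallyModel {F ξ : M → E4} (hF : IsImmersedSurface F) (hξ : IsUnitNormal F ξ)
    (hν : ∀ p, ξ p 3 ≠ 0) (hmin : IsMinimal F ξ) (hprin : IsPrincipalT F ξ) (p : M) :
    ∃ (Φ : E4 → E4) (e : OpenPartialHomeomorph M E2) (c₁ c₂ : ℝ),
      p ∈ e.source ∧ IsLocallyModel F Φ e c₁ c₂ ∧
        ∀ q ∈ e.source, ξ q 3 / Real.sqrt (1 - ξ q 3 ^ 2) = a c₁ c₂ (e q 0) := by
  set φ := chartAt E2 p with hφ
  have hP := hF.isPatch hξ p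
  have hmp : ∀ z ∈ φ.target, ξ (φ.symm z) 3 ^ 2 < 1 ∧ ∃ κ,
      IsMinimalPrincipal (F (φ.symm z)) (ξ (φ.symm z))
        (fun w => dirDeriv w (fun z => F (φ.symm z)) z)
        (fun w => dirDeriv w (fun z => ξ (φ.symm z)) z) κ := fun z hz =>
    (isMinimal_and_isPrincipalT_iff hF hξ p hz).1 ⟨hmin _, hprin _⟩
  have hz₀ : φ p ∈ φ.target := mem_chart_target E2 p
  -- The direction is that of T, along which the height has derivative 1 - ν² > 0. Keeping u fixed,
  -- the derivative stays nonzero on a small ball.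
  obtain ⟨u, hu⟩ : ∃ u, dirDeriv u (fun z => F (φ.symm z)) (φ p) 3 ≠ 0 := by
    have hlt := (hmp _ hz₀).1
    have ht := hP.tangent _ hz₀
    obtain ⟨u, hu⟩ := mem_range_of_normal (by simp) (hP.mem _ hz₀)
      (fderiv ℝ (fun z => F (φ.symm z)) (φ p)).toLinearMap
      ((injective_iff_map_eq_zero _).2 fun w hw => hP.immersion _ hz₀ w hw)
      (hP.lorentz_dirDeriv hz₀) ht (hP.unit _ hz₀) (hP.normal _ hz₀)
      (w := dt - ξ (φ.symm (φ p)) 3 • ξ (φ.symm (φ p)))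
      (by simp only [lorentz, Pi.sub_apply, Pi.smul_apply, dt_zero, dt_one, dt_two, smul_eq_mul]
          simp only [lorentz] at ht
          linear_combination (-ξ (φ.symm (φ p)) 3) * ht)
      (by rw [metric_sub_right, metric_smul_right, hP.unit _ hz₀, metric_dt_right]; ring)
    refine ⟨u, ?_⟩
    change dirDeriv u (fun z => F (φ.symm z)) (φ p) = _ at hu
    rw [hu]
    simp only [Pi.sub_apply, Pi.smul_apply, smul_eq_mul, dt_three]
    intro h0
    nlinarith
  have hopen : IsOpen (φ.target ∩
      (fun z => dirDeriv u (fun z => F (φ.symm z)) z 3) ⁻¹' {0}ᶜ) :=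
    (contDiffOn_pi.1 (hP.smooth.dirDeriv hP.isOpen u) 3).continuousOn.isOpen_inter_preimage
      hP.isOpen isOpen_compl_singleton
  obtain ⟨r, hr, hball⟩ := Metric.isOpen_iff.1 hopen (φ p) ⟨hz₀, hu⟩
  have hsub : Metric.ball (φ p) r ⊆ φ.target := hball.trans Set.inter_subset_left
  obtain ⟨Φ, U', x, y, c₁, c₂, hΦ, hU', hz', hsub', hx, hy, hmodel, ha⟩ :=
    (hP.mono Metric.isOpen_ball hsub).exists_model (convex_ball _ _) (Metric.mem_ball_self hr)
      (fun z _ => hν _) (fun z hz => hmp z (hsub hz)) (u := u) (fun z hz => (hball hz).2)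
  have hP' := hP.mono hU' (hsub'.trans hsub)
  have hg : ContDiffOn ℝ ∞ (fun z => (WithLp.toLp 2 ![x z, y z] : E2)) U' := by
    rw [contDiffOn_euclidean]
    intro i
    fin_cases i
    · exact hx
    · exact hy
  obtain ⟨G, hGz, hGs, hGg, hGsymm⟩ := exists_openPartialHomeomorph hU' hz' hg
    (fun z hz w hw => hP'.coordinates_injective hΦ hg hmodel hz hw)
  have hsrc : ∀ q ∈ (φ.trans G).source, q ∈ φ.source ∧ φ q ∈ U' := by
    intro q hq
    rw [OpenPartialHomeomorph.trans_source] at hq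
    exact ⟨hq.1, hGs hq.2⟩
  have hcoe : ∀ q, (φ.trans G) q = WithLp.toLp 2 ![x (φ q), y (φ q)] := by
    intro q
    rw [OpenPartialHomeomorph.coe_trans, Function.comp_apply, hGg]
  refine ⟨Φ, φ.trans G, c₁, c₂, ?_, ⟨hΦ, ?_, ?_⟩, fun q hq => ?_⟩
  · rw [OpenPartialHomeomorph.trans_source]
    exact ⟨mem_chart_source E2 p, hGz⟩
  · refine OpenPartialHomeomorph.mem_maximalAtlas_of_contMDiffOn _ ?_ ?_
    · rw [OpenPartialHomeomorph.coe_trans, hGg]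
      exact (contMDiffOn_iff_contDiffOn.2 hg).comp
        ((contMDiffOn_chart (I := 𝓘(ℝ, E2)) (n := ∞) (x := p)).mono fun q hq => (hsrc q hq).1)
        fun q hq => (hsrc q hq).2
    · rw [OpenPartialHomeomorph.coe_trans_symm]
      refine (contMDiffOn_chart_symm (I := 𝓘(ℝ, E2)) (n := ∞) (x := p)).comp
        ((contMDiffOn_iff_contDiffOn.2 hGsymm).mono ?_) ?_ <;>
      · intro z hz
        rw [OpenPartialHomeomorph.trans_target] at hz
        first | exact hz.1 | exact hz.2
  · have hval : ∀ q ∈ (φ.trans G).source, F (φ.symm (φ q)) = F q := fun q hq => by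
      rw [φ.left_inv (hsrc q hq).1]
    refine hmodel.imp (fun h => ⟨h.1, fun q hq => ?_⟩) (Or.imp (fun h => ⟨h.1, fun q hq => ?_⟩)
      fun h => ⟨h.1, fun q hq => ?_⟩) <;>
    · have h1 : Φ (F (φ.symm (φ q))) = _ := h.2 _ (hsrc q hq).2
      rw [hval q hq] at h1
      rw [h1, hcoe]
      rfl
  · have h1 : ξ (φ.symm (φ q)) 3 / Real.sqrt (1 - ξ (φ.symm (φ q)) 3 ^ 2) = _ :=
      ha _ (hsrc q hq).2
    rw [φ.left_inv (hsrc q hq).1] at h1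
    rw [h1, hcoe]
    rfl

end HypCyl

theorem theorem6 {M : Type*} [TopologicalSpace M] [ChartedSpace HypCyl.E2 M]
    [IsManifold 𝓘(ℝ, HypCyl.E2) ∞ M] (F ξ : M → HypCyl.E4)
    (hF : HypCyl.IsImmersedSurface F) (hξ : HypCyl.IsUnitNormal F ξ)
    (hθ : ∀ p, HypCyl.angle ξ p ≠ 0 ∧ HypCyl.angle ξ p ≠ Real.pi / 2) :
    -- the classification
    ((HypCyl.IsMinimal F ξ ∧ HypCyl.IsPrincipalT F ξ) ↔
      ∀ p : M, ∃ (Φ : HypCyl.E4 → HypCyl.E4) (e : OpenPartialHomeomorph M HypCyl.E2) (c₁ c₂ : ℝ),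
        p ∈ e.source ∧ HypCyl.IsLocallyModel F Φ e c₁ c₂) ∧
    -- the local representation can be chosen so that `θ = arctan (1 / a(x))` modulo `π`
    ((HypCyl.IsMinimal F ξ ∧ HypCyl.IsPrincipalT F ξ) →
      ∀ p : M, ∃ (Φ : HypCyl.E4 → HypCyl.E4) (e : OpenPartialHomeomorph M HypCyl.E2) (c₁ c₂ : ℝ),
        p ∈ e.source ∧ HypCyl.IsLocallyModel F Φ e c₁ c₂ ∧
          ∀ q ∈ e.source, HypCyl.a c₁ c₂ (e q 0) ≠ 0 ∧
            Real.tan (HypCyl.angle ξ q) = 1 / HypCyl.a c₁ c₂ (e q 0)) ∧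
    -- in every local representation this holds up to the sign of the unit normal
    (∀ (Φ : HypCyl.E4 → HypCyl.E4) (e : OpenPartialHomeomorph M HypCyl.E2) (c₁ c₂ : ℝ),
      HypCyl.IsLocallyModel F Φ e c₁ c₂ →
        ∀ q ∈ e.source, HypCyl.a c₁ c₂ (e q 0) ≠ 0 ∧
          (Real.tan (HypCyl.angle ξ q) = 1 / HypCyl.a c₁ c₂ (e q 0) ∨
            Real.tan (HypCyl.angle ξ q) = -(1 / HypCyl.a c₁ c₂ (e q 0)))) := by
  have hν : ∀ p, ξ p 3 ≠ 0 := fun p => HypCyl.normal_three_ne_zero (hθ p).2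
  refine ⟨⟨fun h p => ?_, fun h => ?_⟩, fun h p => ?_, fun Φ e c₁ c₂ h q hq => ?_⟩
  · obtain ⟨Φ, e, c₁, c₂, hp, hm, -⟩ := HypCyl.exists_isLocallyModel hF hξ hν h.1 h.2 p
    exact ⟨Φ, e, c₁, c₂, hp, hm⟩
  · have key : ∀ p, (∃ A, HypCyl.IsShapeOperator F ξ p A ∧
        LinearMap.trace ℝ (TangentSpace 𝓘(ℝ, HypCyl.E2) p) A = 0) ∧
        ∃ A, HypCyl.IsShapeOperator F ξ p A ∧
        ∃ t, HypCyl.IsTangentPart F ξ p t ∧ ∃ κ : ℝ, Module.End.HasEigenvector A κ t := by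
      intro p
      obtain ⟨Φ, e, c₁, c₂, hp, hm⟩ := h p
      obtain ⟨⟨σ, hσ, h3⟩, κ, hκ⟩ := hm.normal_and_shape hF hξ hp
      have hsymm := (chartAt HypCyl.E2 p).left_inv (mem_chart_source HypCyl.E2 p)
      have := HypCyl.isMinimal_and_isPrincipalT_iff hF hξ p (mem_chart_target HypCyl.E2 p)
      simp only at this
      rw [hsymm] at this
      -- The bound ν² < 1 comes from ν² = a²/(a² + 1).
      refine this.2 ⟨?_, κ, hκ⟩
      have hσσ : σ ^ 2 = 1 := by rcases hσ with rfl | rfl <;> norm_num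
      rw [h3, mul_pow, hσσ, div_pow, Real.sq_sqrt (by positivity), one_mul,
        div_lt_one (by positivity)]
      linarith
    exact ⟨fun p => (key p).1, fun p => (key p).2⟩
  · obtain ⟨Φ, e, c₁, c₂, hp, hm, ha⟩ := HypCyl.exists_isLocallyModel hF hξ hν h.1 h.2 p
    refine ⟨Φ, e, c₁, c₂, hp, hm, fun q hq => ⟨?_, ?_⟩⟩
    · obtain ⟨⟨σ, -, h3⟩, -⟩ := hm.normal_and_shape hF hξ hq
      intro h0
      rw [h0] at h3
      exact hν q (by simpa using h3)
    · rw [← ha q hq, HypCyl.angle, HypCyl.metric_dt_left, Real.tan_arccos, one_div_div]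
  · obtain ⟨⟨σ, hσ, h3⟩, -⟩ := h.normal_and_shape hF hξ hq
    have ha : HypCyl.a c₁ c₂ (e q 0) ≠ 0 := by
      intro h0
      rw [h0] at h3
      exact hν q (by simpa using h3)
    refine ⟨ha, ?_⟩
    rw [HypCyl.angle, HypCyl.metric_dt_left, h3, HypCyl.tan_arccos_of_sign hσ ha]
    rcases hσ with rfl | rfl
    · left; ring
    · right; ring
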